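/- Let $m\ge 2$ and $k\ge 2$ be integers. Let $\mathbb C\{\mathbf z\}$, $\mathbf z=(z_1,\dots,z_m)$, be the ring of convergent power series, $\mathfrak Z$ its maximal ideal, $f_{\mathbf n}$ the coefficients of $f$, and $J_N f=\sum_{|\mathbf n|\le N}f_{\mathbf n}\mathbf z^{\mathbf n}$. For a multi-sequence $a=(a_{\mathbf n})_{\mathbf n\in\mathbb N^m}$ of positive reals with $\lim_{|\mathbf n|\to\infty}a_{\mathbf n}^{1/|\mathbf n|}=0$ put $\|f\|_a=\sum_{\mathbf n}a_{\mathbf n}|f_{\mathbf n}|$; a *sequential topology* on $\mathbb C\{\mathbf z\}$ is the locally convex topology given by the norms $\|\cdot\|_a$, $a\in A$, for some non-empty set $A$ of such multi-sequences. Give each of the $k$ factors of $\mathfrak Z^k$ the topology induced by a sequential topology (possibly different for different factors), and $\mathfrak Z^k$ the product topology. A function is *analytic* on an open set if near each point it is the uniform sum of a series of continuous symmetric $p$-linear forms, $p\ge0$, evaluated on the diagonal. A closed set $\Omega$ is an *analytic set* if each of its points lies in a non-empty connected open set $U$ such that $\Omega\cap U$ is the common zero set of a collection of analytic functions on $U$;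 it is *proper* if there is a point $f\in\Omega$ such that $\Omega\cap U\ne U$ for every such $U\ni f$. A set $S$ of $k$-tuples of germs is *algebraic in jets* if there are polynomial maps $\Lambda_N$ ($N\in\mathbb N$) from $k$-tuples of polynomials of degree $\le N$ to some $\mathbb C^{D(N)}$ with $S=\bigcap_N(\Lambda_N\circ J_N)^{-1}(0)$. A $k$-tuple $F=(f_1,\dots,f_k)$ of germs is *non-coprime* if some $g\in\mathfrak Z$ divides all $f_\ell$; for formal power series one takes $g$ in the maximal ideal of $\mathbb C[[\mathbf z]]$. Let $\mu(F)=\dim_{\mathbb C}\mathbb C\{\mathbf z\}/(f_1,\dots,f_k)\in\mathbb N\cup\{\infty\}$. For $d\ge 0$ let $\varphi_d$ be the linear map $(h_1,\dots,h_k)\mapsto J_{d+1}\big(\sum_\ell f_\ell h_\ell\big)$ on $k$-tuples of polynomials of degree at most $d$, and $M_d(F)$ the matrix with rows indexed by the multi-indices $\mathbf q$ with $0<|\mathbf q|\le d+1$, columns indexed by the pairs $(\ell,\mathbf p)$ with $1\le \ell\le k$, $|\mathbf p|\le d$, and entries $f_{\ell,\mathbf q-\mathbf p}$ (or $0$ if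 $\mathbf q-\mathbf p\notin\mathbb N^m$). Then: 1. The set $\mathfrak I$ of non-coprime $k$-tuples is a proper analytic subset of $\mathfrak Z^k$, and it is algebraic in jets. More precisely, for $F\in\mathfrak Z^k$ the following are equivalent: $F$ is non-coprime; $\operatorname{rank}\varphi_d\le\binom{m+d}{d}$ for all $d\ge0$; for all $d\ge0$ all minors of size $\binom{m+d}{d}+1$ of $M_d(F)$ vanish. 2. For $k$-tuples of formal power series without constant term, $F$ is non-coprime if and only if $\operatorname{rank}\varphi_d\le\binom{m+d}{d}$ for all $d\ge0$. 3. Let $f_1,f_2$ be formal power series without constant term and let $\nu$ be the order of a power series ($\nu(0)=\infty$). The following are equivalent: (a) $f_1,f_2$ are non-coprime; (b) $(f_1,f_2)$ is composite, i.e. $f_1h_1=f_2h_2$ for some formal power series with $\nu(h_1)<\nu(f_2)$ or $\nu(h_2)<\nu(f_1)$; (c) $(f_1,f_2)$ is composite at every rank $d\ge0$, i.e. there are polynomials $h_1,h_2$ of degree $\le d$ such that $J_{d+1}(f_1h_1)=J_{d+1}(f_2h_2)$ and such that $h_1$ or $h_2$ has a non-zero coefficient in some degree less than $\min(\nu(f_1),\nu(f_2))$;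 (d) for all $d\ge0$ the map $(h_1,h_2)\mapsto J_{d+1}(f_1h_1-f_2h_2)$ on pairs of polynomials of degree $\le d$ has rank at most $\binom{m+d}{d}$. 4. Every non-coprime $k$-tuple of germs has infinite Milnor number, and conversely if $m=2$. The set of $F\in\mathfrak Z^k$ with $\mu(F)=\infty$ is an analytic subset of $\mathfrak Z^k$, proper if $m\le k$; the set of $k$-tuples of germs with $\mu(F)=\infty$ is algebraic in jets. -/

import Mathlib

open Filter Topology

noncomputable section

namespace GermSpaces

/-! ### Convergent power series and sequential topologies -/

/-- A formal power series converges (absolutely on some polydisc centred at the origin). -/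
def IsConvergent {m : ℕ} (f : MvPowerSeries (Fin m) ℂ) : Prop :=
  ∃ r : ℝ, 0 < r ∧ Summable fun n : Fin m →₀ ℕ => ‖MvPowerSeries.coeff n f‖ * r ^ n.degree

theorem summable_of_le {m : ℕ} {f : MvPowerSeries (Fin m) ℂ} {r s : ℝ} (hs : 0 ≤ s) (hsr : s ≤ r)
    (h : Summable fun n : Fin m →₀ ℕ => ‖MvPowerSeries.coeff n f‖ * r ^ n.degree) :
    Summable fun n : Fin m →₀ ℕ => ‖MvPowerSeries.coeff n f‖ * s ^ n.degree :=
  h.of_nonneg_of_le (fun n => by positivity) (fun n => by gcongr)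

theorem IsConvergent.add {m : ℕ} {f g : MvPowerSeries (Fin m) ℂ} (hf : IsConvergent f)
    (hg : IsConvergent g) : IsConvergent (f + g) := by
  obtain ⟨r, hr, hf⟩ := hf
  obtain ⟨s, hs, hg⟩ := hg
  have ht : 0 < min r s := lt_min hr hs
  refine ⟨min r s, ht, ((summable_of_le ht.le (min_le_left r s) hf).add
    (summable_of_le ht.le (min_le_right r s) hg)).of_nonneg_of_le (fun n => by positivity) ?_⟩
  intro n
  rw [← add_mul, map_add]
  gcongr
  exact norm_add_le _ _

theorem IsConvergent.mul {m : ℕ} {f g : MvPowerSeries (Fin m) ℂ} (hf : IsConvergent f)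
    (hg : IsConvergent g) : IsConvergent (f * g) := by
  obtain ⟨r, hr, hf⟩ := hf
  obtain ⟨s, hs, hg⟩ := hg
  have ht : 0 < min r s := lt_min hr hs
  have hf' := summable_of_le ht.le (min_le_left r s) hf
  have hg' := summable_of_le ht.le (min_le_right r s) hg
  have hsum := summable_sum_mul_antidiagonal_of_summable_mul
    (f := fun n : Fin m →₀ ℕ => ‖MvPowerSeries.coeff n f‖ * min r s ^ n.degree)
    (g := fun n : Fin m →₀ ℕ => ‖MvPowerSeries.coeff n g‖ * min r s ^ n.degree)
    (hf'.mul_of_nonneg hg' (Pi.le_def.mpr fun n => mul_nonneg (norm_nonneg _) (pow_nonneg ht.le _))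
      (Pi.le_def.mpr fun n => mul_nonneg (norm_nonneg _) (pow_nonneg ht.le _)))
  refine ⟨min r s, ht, Summable.of_nonneg_of_le
    (fun n => mul_nonneg (norm_nonneg _) (pow_nonneg ht.le _)) ?_ hsum⟩
  intro n
  rw [MvPowerSeries.coeff_mul]
  calc ‖∑ p ∈ Finset.HasAntidiagonal.antidiagonal n, MvPowerSeries.coeff p.1 f * MvPowerSeries.coeff p.2 g‖
        * min r s ^ n.degree
      ≤ (∑ p ∈ Finset.HasAntidiagonal.antidiagonal n,
          ‖MvPowerSeries.coeff p.1 f‖ * ‖MvPowerSeries.coeff p.2 g‖) * min r s ^ n.degree := by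
        gcongr
        refine (norm_sum_le _ _).trans (Finset.sum_le_sum fun p _ => ?_)
        exact norm_mul_le _ _
    _ = _ := by
        rw [Finset.sum_mul]
        refine Finset.sum_congr rfl fun p hp => ?_
        rw [← Finset.HasAntidiagonal.mem_antidiagonal.mp hp, map_add, pow_add]
        ring

theorem isConvergent_algebraMap {m : ℕ} (c : ℂ) :
    IsConvergent (algebraMap ℂ (MvPowerSeries (Fin m) ℂ) c) := by
  classical
  refine ⟨1, one_pos, summable_of_ne_finset_zero (s := {0}) ?_⟩
  intro n hn
  have hn' : n ≠ 0 := by simpa using hn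
  simp [MvPowerSeries.algebraMap_apply, MvPowerSeries.coeff_C, hn']

/-- The algebra `ℂ{z₁, …, z_m}` of germs at the origin of holomorphic functions,
realised as the algebra of convergent power series. -/
def germ (m : ℕ) : Subalgebra ℂ (MvPowerSeries (Fin m) ℂ) where
  carrier := {f | IsConvergent f}
  mul_mem' := IsConvergent.mul
  add_mem' := IsConvergent.add
  algebraMap_mem' := isConvergent_algebraMap

/-- The germs that vanish at the origin: the maximal ideal `𝔷` of `ℂ{z}`. -/
def germMax (m : ℕ) : Ideal (germ m) :=
  RingHom.ker ((MvPowerSeries.constantCoeff (σ := Fin m) (R := ℂ)).comp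
    (germ m).val.toRingHom)

/-- Multi-sequences `a` of positive numbers with `a_n ^ (1 / |n|) → 0` as `|n| → ∞`. -/
def FlatSeq (m : ℕ) : Type :=
  {a : (Fin m →₀ ℕ) → ℝ // (∀ n, 0 < a n) ∧
    Tendsto (fun n => a n ^ (1 / (n.degree : ℝ))) (comap Finsupp.degree atTop) (𝓝 0)}

theorem FlatSeq.summable {m : ℕ} (a : FlatSeq m) (f : germ m) :
    Summable fun n => a.1 n * ‖MvPowerSeries.coeff n (f : MvPowerSeries (Fin m) ℂ)‖ := by
  obtain ⟨a, hpos, hlim⟩ := a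
  obtain ⟨r, hr, hf⟩ := f.2
  have h1 : ∀ᶠ n : Fin m →₀ ℕ in comap Finsupp.degree atTop, a n ^ (1 / (n.degree : ℝ)) < r :=
    hlim.eventually (gt_mem_nhds hr)
  obtain ⟨N, hN⟩ := mem_atTop_sets.mp (mem_comap.mp h1).choose_spec.1
  have h2 := (mem_comap.mp h1).choose_spec.2
  have hfin : {n : Fin m →₀ ℕ | n.degree < N + 1}.Finite := Finsupp.finite_of_degree_lt (N + 1)
  refine Summable.of_norm_bounded_eventually hf ?_
  rw [eventually_cofinite]
  refine hfin.subset fun n hn => ?_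
  by_contra hlt
  have hdeg : N + 1 ≤ n.degree := by simpa using hlt
  apply hn
  have h3 : a n ^ (1 / (n.degree : ℝ)) < r := h2 (hN n.degree (by omega))
  have h4 : a n ≤ r ^ n.degree := by
    have h5 : (a n ^ (1 / (n.degree : ℝ))) ^ n.degree = a n := by
      rw [one_div]
      exact Real.rpow_inv_natCast_pow (hpos n).le (by omega)
    rw [← h5]
    exact pow_le_pow_left₀ (Real.rpow_nonneg (hpos n).le _) h3.le _
  rw [Real.norm_of_nonneg (mul_nonneg (hpos n).le (norm_nonneg _)), mul_comm]
  gcongr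

/-- The `a`-norm `‖∑ f_n z^n‖_a = ∑ a_n |f_n|`. -/
def aNorm {m : ℕ} (a : FlatSeq m) : Seminorm ℂ (germ m) :=
  Seminorm.of (fun f => ∑' n, a.1 n * ‖MvPowerSeries.coeff n (f : MvPowerSeries (Fin m) ℂ)‖)
    (by
      intro f g
      rw [← (a.summable f).tsum_add (a.summable g)]
      refine (a.summable (f + g)).tsum_le_tsum (fun n => ?_) ((a.summable f).add (a.summable g))
      rw [← mul_add]
      refine mul_le_mul_of_nonneg_left ?_ (a.2.1 n).le
      simpa using norm_add_le (MvPowerSeries.coeff n (f : MvPowerSeries (Fin m) ℂ))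
        (MvPowerSeries.coeff n (g : MvPowerSeries (Fin m) ℂ)))
    (by
      intro c f
      rw [← tsum_mul_left]
      refine tsum_congr fun n => ?_
      simp only [Subalgebra.coe_smul, map_smul, smul_eq_mul, norm_mul]
      ring)

/-- The sequential topology on `ℂ{z}` given by a set `A` of flat multi-sequences:
the coarsest one finer than the topologies of all the norms `‖·‖_a`, `a ∈ A`. -/
abbrev seqTopology {m : ℕ} (A : Set (FlatSeq m)) : TopologicalSpace (germ m) :=
  ⨅ a : A, (aNorm a.1).toSeminormedAddCommGroup.toUniformSpace.toTopologicalSpace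

/-- The maximal ideal `𝔷`, as a topological vector space with the sequential topology of `A`. -/
def SeqMax {m : ℕ} (_A : Set (FlatSeq m)) : Type := germMax m

instance {m : ℕ} (A : Set (FlatSeq m)) : AddCommGroup (SeqMax A) :=
  inferInstanceAs (AddCommGroup (germMax m))

instance {m : ℕ} (A : Set (FlatSeq m)) : Module ℂ (SeqMax A) :=
  inferInstanceAs (Module ℂ (germMax m))

instance {m : ℕ} (A : Set (FlatSeq m)) : TopologicalSpace (SeqMax A) :=
  (seqTopology A).induced fun f : germMax m => (f : germ m)

/-- A family in `𝔷^k`, each factor carrying its own topology, as a family of germs. -/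
def toGerms {m k : ℕ} {A : Fin k → Set (FlatSeq m)} (F : (ℓ : Fin k) → SeqMax (A ℓ)) :
    Fin k → germ m :=
  fun ℓ => Subtype.val (p := fun f : germ m => f ∈ germMax m) (F ℓ)

/-! ### Analytic functions and analytic sets in topological vector spaces -/

section AnalyticSets

variable {E : Type*} [AddCommGroup E] [Module ℂ E] [TopologicalSpace E]

/-- `Λ` is, near `f`, the uniform sum of a power series of continuous symmetric
multilinear forms. -/
def IsAnalyticAt (Λ : E → ℂ) (f : E) : Prop :=
  ∃ P : (p : ℕ) → ContinuousMultilinearMap ℂ (fun _ : Fin p => E) ℂ,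
    (∀ (p : ℕ) (σ : Equiv.Perm (Fin p)) (v : Fin p → E), P p (fun i => v (σ i)) = P p v) ∧
    ∃ W ∈ 𝓝 (0 : E), TendstoUniformlyOn
      (fun (N : ℕ) (h : E) => ∑ p ∈ Finset.range (N + 1), P p (fun _ => h))
      (fun h => Λ (f + h)) atTop W

/-- On `U`, the set `Ω` is the common zero set of some collection of functions
analytic on `U`. -/
def IsCutOutOn (Ω U : Set E) : Prop :=
  ∃ S : Set (E → ℂ), (∀ Λ ∈ S, ∀ f ∈ U, IsAnalyticAt Λ f) ∧
    Ω ∩ U = {f ∈ U | ∀ Λ ∈ S, Λ f = 0}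

/-- Analytic sets: closed, and locally cut out by analytic functions on a domain. -/
def IsAnalyticSet (Ω : Set E) : Prop :=
  IsClosed Ω ∧ ∀ f ∈ Ω, ∃ U : Set E, IsOpen U ∧ IsConnected U ∧ f ∈ U ∧ IsCutOutOn Ω U

/-- Proper analytic sets: at one of its points, `Ω` fills no domain on which it is cut out by
analytic functions. -/
def IsProperAnalyticSet (Ω : Set E) : Prop :=
  IsAnalyticSet Ω ∧ ∃ f ∈ Ω, ∀ U : Set E, IsOpen U → IsConnected U → f ∈ U →
    IsCutOutOn Ω U → Ω ∩ U ≠ U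

end AnalyticSets

/-! ### Coprimality and Milnor number -/

/-- Some germ in the maximal ideal divides every member of the family. -/
def IsNonCoprime {m k : ℕ} (F : Fin k → germ m) : Prop :=
  ∃ g ∈ germMax m, ∀ ℓ, g ∣ F ℓ

/-- Some formal power series without constant term divides every member of the family. -/
def IsFormallyNonCoprime {m k : ℕ} (F : Fin k → MvPowerSeries (Fin m) ℂ) : Prop :=
  ∃ g : MvPowerSeries (Fin m) ℂ, MvPowerSeries.constantCoeff g = 0 ∧ ∀ ℓ, g ∣ F ℓ

/-- The Milnor number `dim_ℂ ℂ{z} / (f₁, …, f_k)`. -/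
def milnorNumber {m k : ℕ} (F : Fin k → germ m) : ℕ∞ :=
  Cardinal.toENat (Module.rank ℂ (germ m ⧸ Ideal.span (Set.range F)))

/-- A set of `k`-tuples of germs is the intersection over `N` of the zero sets of polynomial
maps (to some `ℂ^{D N}`) in the coefficients of the `N`-jets of the members of the tuple. -/
def IsAlgebraicInJets {m k : ℕ} (S : Set (Fin k → germ m)) : Prop :=
  ∃ (D : ℕ → ℕ)
    (Λ : (N : ℕ) → Fin (D N) → MvPolynomial (Fin k × {n : Fin m →₀ ℕ // n.degree ≤ N}) ℂ),
    S = ⋂ N : ℕ, {F | ∀ i : Fin (D N), MvPolynomial.eval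
      (fun x => MvPowerSeries.coeff x.2.1 (F x.1 : MvPowerSeries (Fin m) ℂ)) (Λ N i) = 0}

/-! ### Jet maps and Macaulay matrices -/

/-- The jet `J_N`: the sum of the terms of total degree at most `N`. -/
def jet {m : ℕ} (N : ℕ) : MvPowerSeries (Fin m) ℂ →ₗ[ℂ] MvPolynomial (Fin m) ℂ :=
  MvPowerSeries.truncTotal (N + 1)

/-- The map `(h₁, …, h_k) ↦ J_{d+1} (∑ f_ℓ h_ℓ)` on `k`-tuples of polynomials of degree `≤ d`. -/
def macaulayMap {m k : ℕ} (F : Fin k → MvPowerSeries (Fin m) ℂ) (d : ℕ) :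
    (Fin k → MvPolynomial.restrictTotalDegree (Fin m) ℂ d) →ₗ[ℂ] MvPolynomial (Fin m) ℂ where
  toFun h := jet (d + 1) (∑ ℓ, F ℓ * ((h ℓ).1 : MvPowerSeries (Fin m) ℂ))
  map_add' h h' := by simp [mul_add, Finset.sum_add_distrib]
  map_smul' c h := by
    rw [RingHom.id_apply, ← map_smul, Finset.smul_sum]
    congr 1
    refine Finset.sum_congr rfl fun ℓ _ => ?_
    simp

/-- For a pair, the map `(h₁, h₂) ↦ J_{d+1} (f₁ h₁ - f₂ h₂)`. -/
def pairMap {m : ℕ} (f₁ f₂ : MvPowerSeries (Fin m) ℂ) (d : ℕ) :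
    (MvPolynomial.restrictTotalDegree (Fin m) ℂ d ×
      MvPolynomial.restrictTotalDegree (Fin m) ℂ d) →ₗ[ℂ] MvPolynomial (Fin m) ℂ where
  toFun h := jet (d + 1)
    (f₁ * (h.1.1 : MvPowerSeries (Fin m) ℂ) - f₂ * (h.2.1 : MvPowerSeries (Fin m) ℂ))
  map_add' h h' := by
    rw [← map_add]
    congr 1
    simp
    ring
  map_smul' c h := by
    rw [RingHom.id_apply, ← map_smul, smul_sub]
    simp

/-- The Macaulay-type matrix of `macaulayMap F d` in the monomial bases: rows are indexed by
`0 < |q| ≤ d + 1`, columns by `ℓ` and `|p| ≤ d`, and the entry is the coefficient of `f_ℓ` at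
`q - p`, or `0` if `q - p` is not a multi-index. -/
def macaulayMatrix {m k : ℕ} (F : Fin k → MvPowerSeries (Fin m) ℂ) (d : ℕ) :
    Matrix {q : Fin m →₀ ℕ // 0 < q.degree ∧ q.degree ≤ d + 1}
      (Fin k × {p : Fin m →₀ ℕ // p.degree ≤ d}) ℂ :=
  fun q x => open Classical in
    if x.2.1 ≤ q.1 then MvPowerSeries.coeff (q.1 - x.2.1) (F x.1) else 0

/-! ### Composite pairs -/

/-- A pair `(f₁, f₂)` is composite: `f₁ h₁ = f₂ h₂` with `ν(h₁) < ν(f₂)` or `ν(h₂) < ν(f₁)`,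
where `ν` is the order (the two inequalities imply each other when `f₁` and `f₂` are nonzero). -/
def IsComposite {m : ℕ} (f₁ f₂ : MvPowerSeries (Fin m) ℂ) : Prop :=
  ∃ h₁ h₂ : MvPowerSeries (Fin m) ℂ, f₁ * h₁ = f₂ * h₂ ∧
    (h₁.order < f₂.order ∨ h₂.order < f₁.order)

/-- A pair is composite at rank `d`: there are `h₁, h₂` of degree `≤ d` such that `f₁ h₁` and
`f₂ h₂` have the same coefficients up to degree `d + 1`, and such that one of them has a nonzero
coefficient in some degree less than `min (ν(f₁), ν(f₂))`. -/
def IsCompositeAtRank {m : ℕ} (f₁ f₂ : MvPowerSeries (Fin m) ℂ) (d : ℕ) : Prop :=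
  ∃ h₁ h₂ : MvPolynomial.restrictTotalDegree (Fin m) ℂ d,
    (∀ n : Fin m →₀ ℕ, n.degree ≤ d + 1 →
      MvPowerSeries.coeff n (f₁ * (h₁.1 : MvPowerSeries (Fin m) ℂ)) =
        MvPowerSeries.coeff n (f₂ * (h₂.1 : MvPowerSeries (Fin m) ℂ))) ∧
    ∃ q : Fin m →₀ ℕ, (q.degree : ℕ∞) < min f₁.order f₂.order ∧
      (h₁.1.coeff q ≠ 0 ∨ h₂.1.coeff q ≠ 0)

end GermSpaces

end

/-! Everything is read off from the dimension `jetRank N F` of the space of N-jets of members of the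
ideal I generated by F, in n variables.

If g without constant term divides F, the (d+1)-jets of I are determined by the d-jets of the
cofactors of g, so their dimension is at most binom(n+d, d). By Pascal's rule this says that the
codimension of I in the N-jets is at least binom(n-1+N, N), a polynomial of degree n-1 in N.

Conversely, let F be nonzero and coprime. After a linear change of coordinates some member is
regular of order ν in the first variable, and Weierstrass division replaces F by a Weierstrass
polynomial and remainders over the ring R of series in the other variables. Over Frac R these
generate a principal ideal. A proper one would have a generator dividing a monic polynomial; since R
is integrally closed, this generator could be taken monic over R and would give a common divisor
(`exists_dvd_or_lift_mem`). So the ideal is the unit ideal, and clearing denominators gives a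
nonzero s in R ∩ I. Modulo I a series is then described by ν elements of R/(s), so the codimension
is bounded by a polynomial of degree n-2 in N (`le_jetRank_add`), too small for large N.

The same dichotomy yields Euclid's lemma, hence unique factorization, hence integral closedness in
one more variable; this closes the induction. Only Weierstrass division and a few stability
properties are used, so formal and convergent series are treated together as an
`IsWeierstrassFamily`. For convergent series, division is a Neumann series that contracts in a
weighted l¹-norm giving small weight to the variables other than the first.

Rank bounds are vanishing of minors in the coefficients, and coefficients are continuous
functionals: hence algebraicity in jets and analyticity. Properness is tested at 0 along a line that
meets the set only there. By Nakayama, the Milnor number is infinite exactly when the codimension in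
the N-jets is at least N+1 for all N; for n = 2 this is the bound binom(1+N, N) characterizing
non-coprimality. For pairs, truncated cofactors give compositeness at every rank, a compactness
argument for linear systems lifts this to formal series, and Euclid's lemma returns to a common
divisor. -/

open scoped ENNReal NNReal

noncomputable section

namespace GermSpaces

/-! ### Weighted norms -/

/-- The weighted `ℓ¹`-norm of the coefficients, with values in `[0, ∞]`. -/
def wnorm {m : ℕ} (w : (Fin m →₀ ℕ) → ℝ≥0∞) (f : MvPowerSeries (Fin m) ℂ) : ℝ≥0∞ :=
  ∑' n, ‖MvPowerSeries.coeff n f‖ₑ * w n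

section Wnorm

variable {m : ℕ} {w : (Fin m →₀ ℕ) → ℝ≥0∞}

theorem wnorm_zero : wnorm w (0 : MvPowerSeries (Fin m) ℂ) = 0 := by simp [wnorm]

theorem wnorm_add_le (f g : MvPowerSeries (Fin m) ℂ) :
    wnorm w (f + g) ≤ wnorm w f + wnorm w g := by
  rw [wnorm, wnorm, wnorm, ← ENNReal.tsum_add]
  refine ENNReal.tsum_le_tsum fun n => ?_
  rw [← add_mul, map_add]
  gcongr
  exact enorm_add_le _ _

theorem wnorm_neg (f : MvPowerSeries (Fin m) ℂ) : wnorm w (-f) = wnorm w f := by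
  simp [wnorm]

theorem wnorm_sum_le {ι : Type*} (s : Finset ι) (f : ι → MvPowerSeries (Fin m) ℂ) :
    wnorm w (∑ i ∈ s, f i) ≤ ∑ i ∈ s, wnorm w (f i) := by
  classical
  induction s using Finset.induction_on with
  | empty => simp [wnorm_zero]
  | insert a s ha ih =>
    rw [Finset.sum_insert ha, Finset.sum_insert ha]
    exact (wnorm_add_le _ _).trans (by gcongr)

theorem wnorm_mul_le (hw : ∀ a b, w (a + b) = w a * w b) (f g : MvPowerSeries (Fin m) ℂ) :
    wnorm w (f * g) ≤ wnorm w f * wnorm w g := by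
  classical
  have key : wnorm w f * wnorm w g = ∑' n, ∑ p ∈ Finset.HasAntidiagonal.antidiagonal n,
      (‖MvPowerSeries.coeff p.1 f‖ₑ * w p.1) * (‖MvPowerSeries.coeff p.2 g‖ₑ * w p.2) := by
    rw [wnorm, wnorm, ← ENNReal.tsum_mul_right]
    simp_rw [← ENNReal.tsum_mul_left]
    rw [← ENNReal.tsum_prod (f := fun a b => (‖MvPowerSeries.coeff a f‖ₑ * w a) *
      (‖MvPowerSeries.coeff b g‖ₑ * w b)), ← Finset.HasAntidiagonal.sigmaAntidiagonalEquivProd.tsum_eq,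
      ENNReal.tsum_sigma']
    refine tsum_congr fun n => ?_
    rw [tsum_fintype, ← Finset.sum_coe_sort (Finset.HasAntidiagonal.antidiagonal n)]
    rfl
  rw [key]
  refine ENNReal.tsum_le_tsum fun n => ?_
  rw [MvPowerSeries.coeff_mul]
  calc _ ≤ (∑ p ∈ Finset.HasAntidiagonal.antidiagonal n,
          ‖MvPowerSeries.coeff p.1 f * MvPowerSeries.coeff p.2 g‖ₑ) * w n := by
        gcongr
        exact enorm_sum_le _ _
    _ = _ := by
        rw [Finset.sum_mul]
        refine Finset.sum_congr rfl fun p hp => ?_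
        rw [← Finset.HasAntidiagonal.mem_antidiagonal.mp hp, hw, enorm_mul]
        ring

theorem wnorm_one (h0 : w 0 = 1) : wnorm w (1 : MvPowerSeries (Fin m) ℂ) = 1 := by
  classical
  rw [wnorm, tsum_eq_single 0]
  · simp [h0]
  · intro n hn
    simp [MvPowerSeries.coeff_one, hn]

theorem wnorm_pow_le (h0 : w 0 = 1) (hw : ∀ a b, w (a + b) = w a * w b)
    (f : MvPowerSeries (Fin m) ℂ) (j : ℕ) : wnorm w (f ^ j) ≤ wnorm w f ^ j := by
  induction j with
  | zero => simp [wnorm_one h0]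
  | succ j ih =>
    rw [pow_succ, pow_succ]
    exact (wnorm_mul_le hw _ _).trans (by gcongr)

theorem wnorm_prod_le (h0 : w 0 = 1) (hw : ∀ a b, w (a + b) = w a * w b) {ι : Type*}
    (s : Finset ι) (f : ι → MvPowerSeries (Fin m) ℂ) :
    wnorm w (∏ i ∈ s, f i) ≤ ∏ i ∈ s, wnorm w (f i) := by
  classical
  induction s using Finset.induction_on with
  | empty => simp [wnorm_one h0]
  | insert a s ha ih =>
    rw [Finset.prod_insert ha, Finset.prod_insert ha]
    exact (wnorm_mul_le hw _ _).trans (by gcongr)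

theorem wnorm_smul (c : ℂ) (f : MvPowerSeries (Fin m) ℂ) :
    wnorm w (c • f) = ‖c‖ₑ * wnorm w f := by
  rw [wnorm, wnorm, ← ENNReal.tsum_mul_left]
  refine tsum_congr fun n => ?_
  rw [map_smul, smul_eq_mul, enorm_mul, mul_assoc]

theorem wnorm_monomial (n : Fin m →₀ ℕ) (c : ℂ) :
    wnorm w (MvPowerSeries.monomial n c) = ‖c‖ₑ * w n := by
  classical
  rw [wnorm, tsum_eq_single n]
  · simp
  · intro k hk
    simp [MvPowerSeries.coeff_monomial, hk]

theorem wnorm_mono {w' : (Fin m →₀ ℕ) → ℝ≥0∞} (h : ∀ n, w n ≤ w' n)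
    (f : MvPowerSeries (Fin m) ℂ) : wnorm w f ≤ wnorm w' f :=
  ENNReal.tsum_le_tsum fun n => by gcongr; exact h n

end Wnorm

/-- The weight `r ^ |n| t ^ δ(n)`. -/
def bwt {m : ℕ} (δ : (Fin m →₀ ℕ) →+ ℕ) (r t : ℝ≥0) (n : Fin m →₀ ℕ) : ℝ≥0∞ :=
  (r : ℝ≥0∞) ^ n.degree * (t : ℝ≥0∞) ^ δ n

section Bwt

variable {m : ℕ} (δ : (Fin m →₀ ℕ) →+ ℕ) (r t : ℝ≥0)

theorem bwt_add (a b : Fin m →₀ ℕ) : bwt δ r t (a + b) = bwt δ r t a * bwt δ r t b := by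
  simp only [bwt, map_add, pow_add]
  ring

theorem bwt_zero : bwt δ r t 0 = 1 := by simp [bwt]

theorem bwt_le {t : ℝ≥0} (ht : t ≤ 1) (n : Fin m →₀ ℕ) : bwt δ r t n ≤ bwt δ r 1 n := by
  unfold bwt
  gcongr

/-- Every surviving term carries at least one factor `t`; this makes multiplication by such a series
contracting for small `t`. -/
theorem wnorm_bwt_le_mul {t : ℝ≥0} (ht : t ≤ 1) {f : MvPowerSeries (Fin m) ℂ}
    (hf : ∀ n, δ n = 0 → MvPowerSeries.coeff n f = 0) :
    wnorm (bwt δ r t) f ≤ t * wnorm (bwt δ r 1) f := by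
  rw [wnorm, wnorm, ← ENNReal.tsum_mul_left]
  refine ENNReal.tsum_le_tsum fun n => ?_
  by_cases h : δ n = 0
  · simp [hf n h]
  · obtain ⟨k, hk⟩ := Nat.exists_eq_succ_of_ne_zero h
    have h1 : (t : ℝ≥0∞) ^ k ≤ 1 := pow_le_one₀ (zero_le) (by exact_mod_cast ht)
    simp only [bwt, hk, Nat.succ_eq_add_one, pow_succ, ENNReal.coe_one, one_pow, mul_one]
    calc _ = (t : ℝ≥0∞) * (‖MvPowerSeries.coeff n f‖ₑ * (r : ℝ≥0∞) ^ n.degree) * (t : ℝ≥0∞) ^ k := by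
          ring
      _ ≤ (t : ℝ≥0∞) * (‖MvPowerSeries.coeff n f‖ₑ * (r : ℝ≥0∞) ^ n.degree) * 1 := by gcongr
      _ = _ := by ring

end Bwt

theorem isConvergent_iff {m : ℕ} {f : MvPowerSeries (Fin m) ℂ} :
    IsConvergent f ↔ ∃ r : ℝ≥0, 0 < r ∧ wnorm (fun n => (r : ℝ≥0∞) ^ n.degree) f ≠ ∞ := by
  have key : ∀ r : ℝ≥0, wnorm (fun n => (r : ℝ≥0∞) ^ n.degree) f ≠ ∞ ↔
      Summable fun n : Fin m →₀ ℕ => ‖MvPowerSeries.coeff n f‖ * (r : ℝ) ^ n.degree := by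
    intro r
    have : wnorm (fun n => (r : ℝ≥0∞) ^ n.degree) f =
        ∑' n, ((‖MvPowerSeries.coeff n f‖₊ * r ^ n.degree : ℝ≥0) : ℝ≥0∞) := by
      simp [wnorm, enorm_eq_nnnorm]
    rw [this, ENNReal.tsum_coe_ne_top_iff_summable, ← NNReal.summable_coe]
    simp
  constructor
  · rintro ⟨r, hr, h⟩
    exact ⟨⟨r, hr.le⟩, hr, (key _).2 h⟩
  · rintro ⟨r, hr, h⟩
    exact ⟨r, hr, (key _).1 h⟩

theorem wnorm_bwt_one {m : ℕ} (δ : (Fin m →₀ ℕ) →+ ℕ) (r : ℝ≥0) (f : MvPowerSeries (Fin m) ℂ) :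
    wnorm (bwt δ r 1) f = wnorm (fun n => (r : ℝ≥0∞) ^ n.degree) f := by
  simp [wnorm, bwt]

/-- As `t ≤ 1` and `δ n` is at most the total degree, the isotropic weight of radius `r * t` is
dominated by the anisotropic one. -/
theorem isConvergent_of_wnorm_bwt {m : ℕ} {δ : (Fin m →₀ ℕ) →+ ℕ} (hδ : ∀ n, δ n ≤ n.degree)
    {r t : ℝ≥0} (hr : 0 < r) (ht : 0 < t) (ht1 : t ≤ 1) {f : MvPowerSeries (Fin m) ℂ}
    (hf : wnorm (bwt δ r t) f ≠ ∞) : IsConvergent f := by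
  refine isConvergent_iff.2 ⟨r * t, mul_pos hr ht, ne_top_of_le_ne_top hf (wnorm_mono ?_ f)⟩
  intro n
  rw [bwt, ENNReal.coe_mul, mul_pow]
  refine mul_le_mul_right ?_ _
  exact pow_le_pow_of_le_one zero_le (by exact_mod_cast ht1) (hδ n)

theorem wnorm_degree_mono {m : ℕ} {r s : ℝ≥0} (h : r ≤ s) (f : MvPowerSeries (Fin m) ℂ) :
    wnorm (fun n => (r : ℝ≥0∞) ^ n.degree) f ≤ wnorm (fun n => (s : ℝ≥0∞) ^ n.degree) f :=
  wnorm_mono (fun n => by gcongr) f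

/-! ### Neumann series for operators raising a degree -/

section Neumann

variable {m : ℕ} {δ : (Fin m →₀ ℕ) → ℕ}
  {T : MvPowerSeries (Fin m) ℂ →ₗ[ℂ] MvPowerSeries (Fin m) ℂ}

/-- The hypothesis on `T` says that it raises the order with respect to `δ` by at least one, so a
fixed vector vanishes degree by degree. -/
theorem eq_zero_of_fixed
    (hT : ∀ v n, (∀ k, δ k < δ n → MvPowerSeries.coeff k v = 0) → MvPowerSeries.coeff n (T v) = 0)
    {v : MvPowerSeries (Fin m) ℂ} (hv : v = T v) : v = 0 := by
  have : ∀ d n, δ n = d → MvPowerSeries.coeff n v = 0 := by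
    intro d
    induction d using Nat.strong_induction_on with
    | _ d ih =>
      intro n hn
      rw [hv]
      exact hT v n fun k hk => ih (δ k) (hn ▸ hk) k rfl
  ext n
  simpa using this _ n rfl

/-- The series ∑ Tⁱ g is a finite sum in each coefficient, because Tⁱ g has no terms of `δ`-degree
below i. The solution is built formally, so the weight and the contraction constant may be chosen
afterwards. -/
theorem exists_neumann
    (hT : ∀ v n, (∀ k, δ k < δ n → MvPowerSeries.coeff k v = 0) → MvPowerSeries.coeff n (T v) = 0)
    (g : MvPowerSeries (Fin m) ℂ) :
    ∃ v, v = g + T v ∧ ∀ (w : (Fin m →₀ ℕ) → ℝ≥0∞) (κ : ℝ≥0∞), κ < 1 →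
      (∀ u, wnorm w (T u) ≤ κ * wnorm w u) → wnorm w g ≠ ∞ → wnorm w v ≠ ∞ := by
  have hpow : ∀ i n, δ n < i → MvPowerSeries.coeff n ((T ^ i) g) = 0 := by
    intro i
    induction i with
    | zero => intro n hn; omega
    | succ i ih =>
      intro n hn
      rw [pow_succ', Module.End.mul_apply]
      exact hT _ n fun k hk => ih k (by omega)
  set S : ℕ → MvPowerSeries (Fin m) ℂ := fun N => ∑ i ∈ Finset.range N, (T ^ i) g with hS
  have hSst : ∀ n M N, δ n < M → M ≤ N → MvPowerSeries.coeff n (S N) = MvPowerSeries.coeff n (S M) := by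
    intro n M N hM hMN
    induction N, hMN using Nat.le_induction with
    | base => rfl
    | succ N hN ih =>
      simp only [hS] at ih ⊢
      rw [Finset.sum_range_succ, map_add, hpow N n (by omega), add_zero, ih]
  -- The coefficient at `n` is stable from the partial sum with `δ n + 1` terms on.
  let v : MvPowerSeries (Fin m) ℂ := fun n => MvPowerSeries.coeff n (S (δ n + 1))
  have hv : ∀ n N, δ n < N → MvPowerSeries.coeff n v = MvPowerSeries.coeff n (S N) := by
    intro n N hN
    rw [hSst n (δ n + 1) N (by omega) hN]
    rfl
  have hSsucc : ∀ N, S (N + 1) = g + T (S N) := by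
    intro N
    simp only [hS, Finset.sum_range_succ', map_sum, pow_succ', Module.End.mul_apply, pow_zero,
      Module.End.one_apply]
    rw [add_comm]
  refine ⟨v, ?_, ?_⟩
  · ext n
    have h1 : MvPowerSeries.coeff n (T v) = MvPowerSeries.coeff n (T (S (δ n))) := by
      rw [← sub_eq_zero, ← map_sub, ← map_sub]
      refine hT _ n fun k hk => ?_
      rw [map_sub, hv k (δ n) hk, sub_self]
    rw [map_add, h1, ← map_add, ← hSsucc, hv n _ (Nat.lt_succ_self _)]
  · intro w κ hκ hc hg
    -- Finitely many coefficients of `v` are those of a single partial sum, which the geometric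
    -- series bounds.
    have hle : wnorm w v ≤ (1 - κ)⁻¹ * wnorm w g := by
      refine ENNReal.summable.tsum_le_of_sum_le fun s => ?_
      obtain ⟨N, hN⟩ : ∃ N, ∀ n ∈ s, δ n < N :=
        ⟨s.sup δ + 1, fun n hn => Nat.lt_succ_of_le (Finset.le_sup (f := δ) hn)⟩
      calc ∑ n ∈ s, ‖MvPowerSeries.coeff n v‖ₑ * w n
          = ∑ n ∈ s, ‖MvPowerSeries.coeff n (S N)‖ₑ * w n :=
            Finset.sum_congr rfl fun n hn => by rw [hv n N (hN n hn)]
        _ ≤ wnorm w (S N) := ENNReal.sum_le_tsum s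
        _ ≤ ∑ i ∈ Finset.range N, wnorm w ((T ^ i) g) := wnorm_sum_le _ _
        _ ≤ ∑ i ∈ Finset.range N, κ ^ i * wnorm w g := by
            refine Finset.sum_le_sum fun i hi => ?_
            clear hi
            induction i with
            | zero => simp
            | succ i ih =>
              rw [pow_succ', Module.End.mul_apply, pow_succ', mul_assoc]
              exact (hc _).trans (by gcongr)
        _ = (∑ i ∈ Finset.range N, κ ^ i) * wnorm w g := by rw [Finset.sum_mul]
        _ ≤ (∑' i, κ ^ i) * wnorm w g := by
            gcongr
            exact ENNReal.sum_le_tsum _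
        _ = _ := by rw [ENNReal.tsum_geometric]
    refine ne_top_of_le_ne_top (ENNReal.mul_ne_top ?_ hg) hle
    exact ENNReal.inv_ne_top.2 (tsub_pos_of_lt hκ).ne'

end Neumann

theorem coeff_mul_eq_zero {m : ℕ} {δ : (Fin m →₀ ℕ) →+ ℕ} {f v : MvPowerSeries (Fin m) ℂ} {d : ℕ}
    (hv : ∀ k, δ k < d → MvPowerSeries.coeff k v = 0) {n : Fin m →₀ ℕ} (hn : δ n < d) :
    MvPowerSeries.coeff n (f * v) = 0 := by
  classical
  rw [MvPowerSeries.coeff_mul]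
  refine Finset.sum_eq_zero fun p hp => ?_
  have h1 := congrArg δ (Finset.HasAntidiagonal.mem_antidiagonal.mp hp)
  rw [map_add] at h1
  rw [hv p.2 (by omega), mul_zero]

theorem coeff_mul_eq_zero' {m : ℕ} {δ : (Fin m →₀ ℕ) →+ ℕ} {f v : MvPowerSeries (Fin m) ℂ} {d : ℕ}
    (hf : ∀ k, δ k = 0 → MvPowerSeries.coeff k f = 0)
    (hv : ∀ k, δ k < d → MvPowerSeries.coeff k v = 0) {n : Fin m →₀ ℕ} (hn : δ n ≤ d) :
    MvPowerSeries.coeff n (f * v) = 0 := by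
  classical
  rw [MvPowerSeries.coeff_mul]
  refine Finset.sum_eq_zero fun p hp => ?_
  have h1 := congrArg δ (Finset.HasAntidiagonal.mem_antidiagonal.mp hp)
  rw [map_add] at h1
  by_cases h2 : δ p.1 = 0
  · rw [hf p.1 h2, zero_mul]
  · rw [hv p.2 (by omega), mul_zero]

theorem exists_small_mul {a b : ℝ≥0∞} (ha : a ≠ ∞) (hb : b ≠ ∞) :
    ∃ t : ℝ≥0, 0 < t ∧ t ≤ 1 ∧ (t : ℝ≥0∞) * a * b < 1 := by
  lift a to ℝ≥0 using ha
  lift b to ℝ≥0 using hb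
  refine ⟨(1 + a * b)⁻¹, by positivity, inv_le_one_of_one_le₀ (by simp), ?_⟩
  norm_cast
  rw [mul_assoc, inv_mul_lt_one₀ (by positivity)]
  simp

/-- A convergent power series with nonzero constant term is invertible among convergent ones. -/
theorem IsConvergent.exists_mul_eq_one {m : ℕ} {f : MvPowerSeries (Fin m) ℂ} (hf : IsConvergent f)
    (h0 : MvPowerSeries.constantCoeff f ≠ 0) : ∃ g, IsConvergent g ∧ f * g = 1 := by
  classical
  set c := MvPowerSeries.constantCoeff f with hc
  set x : MvPowerSeries (Fin m) ℂ := 1 - c⁻¹ • f with hx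
  let δ : (Fin m →₀ ℕ) →+ ℕ := Finsupp.degree
  have hxc : IsConvergent x := by
    have h1 : c⁻¹ • f ∈ germ m := (germ m).smul_mem hf _
    exact (germ m).sub_mem (germ m).one_mem h1
  have hx0 : ∀ n, δ n = 0 → MvPowerSeries.coeff n x = 0 := by
    intro n hn
    have hn' : n = 0 := (Finsupp.degree_eq_zero_iff n).1 hn
    subst hn'
    simp only [hx, map_sub, map_smul, smul_eq_mul, MvPowerSeries.coeff_zero_eq_constantCoeff_apply,
      map_one]
    rw [← hc, inv_mul_cancel₀ h0, sub_self]
  -- With x = 1 - c⁻¹ f, the inverse of f is the solution of v = c⁻¹ + x v.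
  obtain ⟨v, hv, hvn⟩ := exists_neumann (δ := δ) (T := LinearMap.mulLeft ℂ x)
    (fun v n h => coeff_mul_eq_zero' hx0 h le_rfl) (c⁻¹ • 1)
  obtain ⟨r, hr, hxr⟩ := isConvergent_iff.1 hxc
  obtain ⟨t, ht, ht1, hlt⟩ := exists_small_mul hxr ENNReal.one_ne_top
  rw [mul_one] at hlt
  refine ⟨v, isConvergent_of_wnorm_bwt (δ := δ) (fun n => le_rfl) hr ht ht1 (hvn _ _ hlt ?_ ?_), ?_⟩
  · intro u
    refine (wnorm_mul_le (bwt_add δ r t) x u).trans ?_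
    gcongr
    rw [← wnorm_bwt_one δ]
    exact wnorm_bwt_le_mul δ r ht1 hx0
  · rw [wnorm_smul, wnorm_one (bwt_zero δ r t), mul_one]
    exact enorm_ne_top
  · have h1 : c⁻¹ • (f * v) = c⁻¹ • (1 : MvPowerSeries (Fin m) ℂ) := by
      rw [LinearMap.mulLeft_apply, hx, sub_mul, one_mul, smul_mul_assoc] at hv
      linear_combination hv
    exact (smul_right_injective _ (inv_ne_zero h0)) h1

/-! ### Separating the first variable -/

/-- Power series in the variables other than the first one. -/
def lift (m : ℕ) : MvPowerSeries (Fin m) ℂ →ₐ[ℂ] MvPowerSeries (Fin (m + 1)) ℂ :=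
  (MvPowerSeries.finSuccEquiv ℂ m).symm.toAlgHom.comp
    (IsScalarTower.toAlgHom ℂ (MvPowerSeries (Fin m) ℂ) (PowerSeries (MvPowerSeries (Fin m) ℂ)))

theorem finSuccEquiv_lift {m : ℕ} (r : MvPowerSeries (Fin m) ℂ) :
    MvPowerSeries.finSuccEquiv ℂ m (lift m r) = PowerSeries.C r := by
  simp [lift]

theorem coeff_lift_mul_X_pow {m : ℕ} (r : MvPowerSeries (Fin m) ℂ) (j : ℕ)
    (n : Fin (m + 1) →₀ ℕ) :
    MvPowerSeries.coeff n (lift m r * MvPowerSeries.X 0 ^ j) =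
      if n 0 = j then MvPowerSeries.coeff n.tail r else 0 := by
  rw [← Finsupp.cons_tail n, ← MvPowerSeries.coeff_coeff_finSuccEquiv, map_mul, map_pow,
    finSuccEquiv_lift, MvPowerSeries.finSuccEquiv_X_zero, PowerSeries.coeff_C_mul,
    PowerSeries.coeff_X_pow]
  simp only [Finsupp.cons_zero, Finsupp.tail_cons]
  split_ifs <;> simp

theorem coeff_lift {m : ℕ} (r : MvPowerSeries (Fin m) ℂ) (n : Fin (m + 1) →₀ ℕ) :
    MvPowerSeries.coeff n (lift m r) = if n 0 = 0 then MvPowerSeries.coeff n.tail r else 0 := by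
  simpa using coeff_lift_mul_X_pow r 0 n

theorem lift_injective (m : ℕ) : Function.Injective (lift m) := by
  intro a b h
  ext n
  have := congrArg (MvPowerSeries.coeff (Finsupp.cons 0 n)) h
  simpa [coeff_lift] using this

/-- The coefficient of the `j`-th power of the first variable. -/
def slice {m : ℕ} (j : ℕ) (f : MvPowerSeries (Fin (m + 1)) ℂ) : MvPowerSeries (Fin m) ℂ :=
  PowerSeries.coeff j (MvPowerSeries.finSuccEquiv ℂ m f)

theorem coeff_slice {m : ℕ} (j : ℕ) (f : MvPowerSeries (Fin (m + 1)) ℂ) (n : Fin m →₀ ℕ) :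
    MvPowerSeries.coeff n (slice j f) = MvPowerSeries.coeff (n.cons j) f :=
  MvPowerSeries.coeff_coeff_finSuccEquiv f

/-- The total degree in the variables other than the first one. -/
def tailDegree (m : ℕ) : (Fin (m + 1) →₀ ℕ) →+ ℕ where
  toFun n := n.tail.degree
  map_zero' := by
    rw [show (0 : Fin (m + 1) →₀ ℕ).tail = 0 from by ext; simp [Finsupp.tail_apply]]
    simp
  map_add' a b := by
    rw [show (a + b).tail = a.tail + b.tail from by ext; simp [Finsupp.tail_apply]]
    simp

theorem degree_eq_add_tail {m : ℕ} (n : Fin (m + 1) →₀ ℕ) :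
    n.degree = n 0 + n.tail.degree := by
  rw [Finsupp.degree_eq_sum, Finsupp.degree_eq_sum, Fin.sum_univ_succ]
  simp [Finsupp.tail_apply]

theorem tailDegree_le {m : ℕ} (n : Fin (m + 1) →₀ ℕ) : tailDegree m n ≤ n.degree := by
  rw [degree_eq_add_tail]
  exact Nat.le_add_left _ _

theorem degree_cons {m : ℕ} (j : ℕ) (n : Fin m →₀ ℕ) : (n.cons j).degree = j + n.degree := by
  rw [degree_eq_add_tail, Finsupp.cons_zero, Finsupp.tail_cons]

theorem eq_single_of_tailDegree {m : ℕ} {n : Fin (m + 1) →₀ ℕ} (h : tailDegree m n = 0) :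
    n = Finsupp.single 0 (n 0) := by
  have h1 : n.tail = 0 := (Finsupp.degree_eq_zero_iff _).1 h
  rw [← Finsupp.cons_tail n, h1]
  ext i
  refine Fin.cases ?_ (fun i => ?_) i <;> simp

theorem tailDegree_single (m j : ℕ) : tailDegree m (Finsupp.single 0 j) = 0 := by
  change (Finsupp.tail (Finsupp.single 0 j : Fin (m + 1) →₀ ℕ)).degree = 0
  rw [Finsupp.degree_eq_zero_iff]
  ext i
  simp [Finsupp.tail_apply]

/-- The terms of degree less than `ν` in the first variable. -/
def low {m : ℕ} (ν : ℕ) (f : MvPowerSeries (Fin (m + 1)) ℂ) : MvPowerSeries (Fin (m + 1)) ℂ :=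
  fun n => if n 0 < ν then MvPowerSeries.coeff n f else 0

/-- The terms of degree at least `ν` in the first variable, divided by the `ν`-th power of it. -/
def high {m : ℕ} (ν : ℕ) : MvPowerSeries (Fin (m + 1)) ℂ →ₗ[ℂ] MvPowerSeries (Fin (m + 1)) ℂ where
  toFun f := fun n => MvPowerSeries.coeff (n + Finsupp.single 0 ν) f
  map_add' _ _ := rfl
  map_smul' _ _ := rfl

section LowHigh

variable {m : ℕ} (ν : ℕ) (f : MvPowerSeries (Fin (m + 1)) ℂ)

theorem coeff_low (n : Fin (m + 1) →₀ ℕ) :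
    MvPowerSeries.coeff n (low ν f) = if n 0 < ν then MvPowerSeries.coeff n f else 0 := rfl

theorem coeff_high (n : Fin (m + 1) →₀ ℕ) :
    MvPowerSeries.coeff n (high ν f) = MvPowerSeries.coeff (n + Finsupp.single 0 ν) f := rfl

theorem low_eq_sum : low ν f =
    ∑ j : Fin ν, lift m (slice j f) * MvPowerSeries.X 0 ^ (j : ℕ) := by
  ext n
  rw [map_sum, coeff_low]
  simp only [coeff_lift_mul_X_pow, coeff_slice]
  split_ifs with h
  · rw [Finset.sum_eq_single (⟨n 0, h⟩ : Fin ν)]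
    · simp
    · intro b _ hb
      rw [if_neg]
      intro h'
      exact hb (Fin.ext h'.symm)
    · simp
  · refine (Finset.sum_eq_zero fun b _ => if_neg ?_).symm
    have := b.2
    omega

theorem low_add_X_pow_mul_high : low ν f + MvPowerSeries.X 0 ^ ν * high ν f = f := by
  classical
  ext n
  rw [map_add, coeff_low, MvPowerSeries.X_pow_eq, MvPowerSeries.coeff_monomial_mul, one_mul,
    coeff_high]
  by_cases h : n 0 < ν
  · rw [if_pos h, if_neg, add_zero]
    simpa [Finsupp.single_le_iff] using h
  · have h' : Finsupp.single 0 ν ≤ n := by simpa [Finsupp.single_le_iff] using h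
    rw [if_neg h, if_pos h', zero_add, tsub_add_cancel_of_le h']

theorem high_X_pow_mul : high ν (MvPowerSeries.X 0 ^ ν * f) = f := by
  classical
  ext n
  rw [coeff_high, MvPowerSeries.X_pow_eq, add_comm n, MvPowerSeries.coeff_add_monomial_mul, one_mul]

theorem high_sum_lift (r : Fin ν → MvPowerSeries (Fin m) ℂ) :
    high ν (∑ j : Fin ν, lift m (r j) * MvPowerSeries.X 0 ^ (j : ℕ)) = 0 := by
  ext n
  rw [coeff_high, map_sum]
  refine Finset.sum_eq_zero fun j _ => ?_
  rw [coeff_lift_mul_X_pow, if_neg]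
  have := j.2
  simp
  omega

theorem wnorm_low_le (w : (Fin (m + 1) →₀ ℕ) → ℝ≥0∞) : wnorm w (low ν f) ≤ wnorm w f := by
  refine ENNReal.tsum_le_tsum fun n => ?_
  rw [coeff_low]
  split_ifs <;> simp

theorem wnorm_high_mul_le {w : (Fin (m + 1) →₀ ℕ) → ℝ≥0∞} (hw : ∀ a b, w (a + b) = w a * w b) :
    wnorm w (high ν f) * w (Finsupp.single 0 ν) ≤ wnorm w f := by
  rw [wnorm, ← ENNReal.tsum_mul_right]
  refine le_trans (le_of_eq ?_) (ENNReal.tsum_comp_le_tsum_of_injective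
    (add_left_injective (Finsupp.single 0 ν)) _)
  refine tsum_congr fun n => ?_
  rw [coeff_high, hw]
  ring

end LowHigh

/-- Regularity of order `ν` in the first variable. -/
def IsRegularOfOrder {m : ℕ} (ν : ℕ) (f : MvPowerSeries (Fin (m + 1)) ℂ) : Prop :=
  (∀ j < ν, MvPowerSeries.coeff (Finsupp.single 0 j) f = 0) ∧
    MvPowerSeries.coeff (Finsupp.single 0 ν) f ≠ 0

theorem IsRegularOfOrder.coeff_low_eq_zero {m ν : ℕ} {f : MvPowerSeries (Fin (m + 1)) ℂ}
    (h : IsRegularOfOrder ν f) (n : Fin (m + 1) →₀ ℕ) (hn : tailDegree m n = 0) :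
    MvPowerSeries.coeff n (low ν f) = 0 := by
  rw [coeff_low]
  split_ifs with h'
  · rw [eq_single_of_tailDegree hn]
    exact h.1 _ h'
  · rfl

theorem IsRegularOfOrder.constantCoeff_high {m ν : ℕ} {f : MvPowerSeries (Fin (m + 1)) ℂ}
    (h : IsRegularOfOrder ν f) : MvPowerSeries.constantCoeff (high ν f) ≠ 0 := by
  rw [← MvPowerSeries.coeff_zero_eq_constantCoeff_apply, coeff_high, zero_add]
  exact h.2

theorem IsConvergent.high {m ν : ℕ} {f : MvPowerSeries (Fin (m + 1)) ℂ} (hf : IsConvergent f) :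
    IsConvergent (high ν f) := by
  obtain ⟨r, hr, h⟩ := isConvergent_iff.1 hf
  refine isConvergent_iff.2 ⟨r, hr, fun htop => h ?_⟩
  have h1 := wnorm_high_mul_le ν f (w := fun n => (r : ℝ≥0∞) ^ n.degree)
    (fun a b => by rw [map_add, pow_add])
  rw [htop, ENNReal.top_mul (by positivity)] at h1
  exact top_le_iff.1 h1

/-- By regularity `low ν f` has no term in the first variable alone, so multiplication by it raises
the degree in the other variables, while `high` only shifts the exponent of the first one. -/
theorem high_lowering_raises {m ν : ℕ} {f e : MvPowerSeries (Fin (m + 1)) ℂ}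
    (hf : IsRegularOfOrder ν f) (v : MvPowerSeries (Fin (m + 1)) ℂ) (n : Fin (m + 1) →₀ ℕ)
    (hv : ∀ k, tailDegree m k < tailDegree m n → MvPowerSeries.coeff k v = 0) :
    MvPowerSeries.coeff n (-(high ν (low ν f * (e * v)))) = 0 := by
  rw [map_neg, coeff_high, neg_eq_zero]
  refine coeff_mul_eq_zero' (δ := tailDegree m) (d := tailDegree m n) hf.coeff_low_eq_zero
    (fun k hk => coeff_mul_eq_zero hv hk) ?_
  rw [map_add, tailDegree_single, add_zero]

/-- The operator whose fixed points solve the Weierstrass division problem. -/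
def divisionOp {m : ℕ} (ν : ℕ) (f e : MvPowerSeries (Fin (m + 1)) ℂ) :
    MvPowerSeries (Fin (m + 1)) ℂ →ₗ[ℂ] MvPowerSeries (Fin (m + 1)) ℂ :=
  -((high ν).comp ((LinearMap.mulLeft ℂ (low ν f)).comp (LinearMap.mulLeft ℂ e)))

theorem divisionOp_apply {m : ℕ} (ν : ℕ) (f e v : MvPowerSeries (Fin (m + 1)) ℂ) :
    divisionOp ν f e v = -(high ν (low ν f * (e * v))) := rfl

/-- Cancelling `high ν f` against `e` turns division of g by f, with quotient `e * v`, into the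
fixed-point equation v = high ν g + T v. -/
theorem high_mul_of_inverse {m ν : ℕ} {f e : MvPowerSeries (Fin (m + 1)) ℂ}
    (he : high ν f * e = 1) (v : MvPowerSeries (Fin (m + 1)) ℂ) :
    high ν (e * v * f) = v - divisionOp ν f e v := by
  have h1 : e * v * f = low ν f * (e * v) + MvPowerSeries.X 0 ^ ν * v := by
    conv_lhs => rw [← low_add_X_pow_mul_high ν f]
    linear_combination (MvPowerSeries.X 0 ^ ν * v) * he
  rw [h1, map_add, high_X_pow_mul, divisionOp_apply]
  ring

/-- This is Weierstrass division: being killed by `high ν` means that the remainder has degree less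
than `ν` in the first variable. One quotient serves the formal and the convergent case. -/
theorem exists_quotient {m ν : ℕ} {f : MvPowerSeries (Fin (m + 1)) ℂ}
    (hf : IsRegularOfOrder ν f) (g : MvPowerSeries (Fin (m + 1)) ℂ) :
    ∃ q, high ν (g - q * f) = 0 ∧ (IsConvergent f → IsConvergent g → IsConvergent q) := by
  set e := (high ν f)⁻¹ with he_def
  have he : high ν f * e = 1 := MvPowerSeries.mul_inv_cancel _ hf.constantCoeff_high
  obtain ⟨v, hv, hvn⟩ := exists_neumann (δ := tailDegree m) (T := divisionOp ν f e)
    (fun v n h => high_lowering_raises hf v n h) (high ν g)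
  refine ⟨e * v, ?_, fun hfc hgc => ?_⟩
  · rw [map_sub, high_mul_of_inverse he, sub_eq_zero]
    linear_combination -hv
  -- The formal inverse is the convergent one, by uniqueness of inverses.
  have hec : IsConvergent e := by
    obtain ⟨e', he', h1⟩ := hfc.high.exists_mul_eq_one hf.constantCoeff_high
    have : e = e' := by
      calc e = e * (high ν f * e') := by rw [h1, mul_one]
        _ = (high ν f * e) * e' := by ring
        _ = e' := by rw [he, one_mul]
    rwa [this]
  refine hec.mul ?_
  obtain ⟨r₁, hr₁, h₁⟩ := isConvergent_iff.1 hfc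
  obtain ⟨r₂, hr₂, h₂⟩ := isConvergent_iff.1 hec
  obtain ⟨r₃, hr₃, h₃⟩ := isConvergent_iff.1 (hgc.high (ν := ν))
  set r := min r₁ (min r₂ r₃) with hr_def
  have hr : 0 < r := lt_min hr₁ (lt_min hr₂ hr₃)
  have hf' := ne_top_of_le_ne_top h₁ (wnorm_degree_mono (min_le_left r₁ (min r₂ r₃)) f)
  have he' := ne_top_of_le_ne_top h₂ (wnorm_degree_mono
    ((min_le_right r₁ (min r₂ r₃)).trans (min_le_left _ _)) e)
  have hg' := ne_top_of_le_ne_top h₃ (wnorm_degree_mono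
    ((min_le_right r₁ (min r₂ r₃)).trans (min_le_right _ _)) (high ν g))
  rw [← hr_def, ← wnorm_bwt_one (tailDegree m)] at hf' he' hg'
  have hr0 : (r : ℝ≥0∞) ^ ν ≠ 0 := by positivity
  have hrt : (r : ℝ≥0∞) ^ ν ≠ ∞ := by finiteness
  -- The operator has norm at most r^(-ν) · t · ‖f‖ · ‖e‖, the norms of f and e being taken at `t =
  -- 1`; now `t` is chosen to make this less than 1.
  obtain ⟨t, ht, ht1, hlt⟩ := exists_small_mul
    (a := ((r : ℝ≥0∞) ^ ν)⁻¹ * wnorm (bwt (tailDegree m) r 1) f)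
    (ENNReal.mul_ne_top (ENNReal.inv_ne_top.2 hr0) hf') he'
  refine isConvergent_of_wnorm_bwt (δ := tailDegree m) tailDegree_le hr ht ht1
    (hvn _ _ hlt (fun u => ?_) (ne_top_of_le_ne_top hg' (wnorm_mono (bwt_le _ _ ht1) _)))
  have hsingle : bwt (tailDegree m) r t (Finsupp.single 0 ν) = (r : ℝ≥0∞) ^ ν := by
    simp [bwt, tailDegree_single]
  have h1 := wnorm_high_mul_le ν (low ν f * (e * u)) (bwt_add (tailDegree m) r t)
  rw [hsingle] at h1
  have h2 : wnorm (bwt (tailDegree m) r t) (low ν f * (e * u)) ≤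
      (t * wnorm (bwt (tailDegree m) r 1) f) * (wnorm (bwt (tailDegree m) r 1) e *
        wnorm (bwt (tailDegree m) r t) u) := by
    refine (wnorm_mul_le (bwt_add _ _ _) _ _).trans ?_
    gcongr
    · refine (wnorm_bwt_le_mul _ _ ht1 hf.coeff_low_eq_zero).trans ?_
      gcongr
      exact wnorm_low_le _ _ _
    · refine (wnorm_mul_le (bwt_add _ _ _) _ _).trans ?_
      gcongr
      exact wnorm_mono (bwt_le _ _ ht1) _
  rw [divisionOp_apply, wnorm_neg]
  calc _ = ((r : ℝ≥0∞) ^ ν)⁻¹ *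
        (wnorm (bwt (tailDegree m) r t) (high ν (low ν f * (e * u))) * (r : ℝ≥0∞) ^ ν) := by
        rw [mul_comm _ ((r : ℝ≥0∞) ^ ν), ENNReal.inv_mul_cancel_left hr0 hrt]
    _ ≤ ((r : ℝ≥0∞) ^ ν)⁻¹ * ((t * wnorm (bwt (tailDegree m) r 1) f) *
        (wnorm (bwt (tailDegree m) r 1) e * wnorm (bwt (tailDegree m) r t) u)) := by
        exact mul_le_mul_right (h1.trans h2) _
    _ = _ := by ring

/-- Uniqueness in Weierstrass division. -/
theorem eq_zero_of_high_mul_eq_zero {m ν : ℕ} {f q : MvPowerSeries (Fin (m + 1)) ℂ}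
    (hf : IsRegularOfOrder ν f) (h : high ν (q * f) = 0) : q = 0 := by
  set e := (high ν f)⁻¹ with he_def
  have he : high ν f * e = 1 := MvPowerSeries.mul_inv_cancel _ hf.constantCoeff_high
  have h1 := high_mul_of_inverse he (high ν f * q)
  have h2 : e * (high ν f * q) * f = q * f := by
    linear_combination (q * f) * he
  rw [h2, h] at h1
  have h3 := eq_zero_of_fixed (δ := tailDegree m) (T := divisionOp ν f e)
    (fun v n h => high_lowering_raises hf v n h) (v := high ν f * q) (by linear_combination -h1)
  calc q = (high ν f * e) * q := by rw [he, one_mul]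
    _ = e * (high ν f * q) := by ring
    _ = 0 := by rw [h3, mul_zero]

theorem IsConvergent.slice {m : ℕ} {f : MvPowerSeries (Fin (m + 1)) ℂ} (hf : IsConvergent f)
    (j : ℕ) : IsConvergent (slice j f) := by
  obtain ⟨r, hr, h⟩ := isConvergent_iff.1 hf
  refine isConvergent_iff.2 ⟨r, hr, fun htop => h ?_⟩
  have h1 : wnorm (fun n => (r : ℝ≥0∞) ^ n.degree) (GermSpaces.slice j f) * (r : ℝ≥0∞) ^ j ≤
      wnorm (fun n => (r : ℝ≥0∞) ^ n.degree) f := by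
    rw [wnorm, ← ENNReal.tsum_mul_right]
    refine le_trans (le_of_eq ?_) (ENNReal.tsum_comp_le_tsum_of_injective
      (Finsupp.cons_right_injective j) _)
    refine tsum_congr fun n => ?_
    beta_reduce
    rw [coeff_slice, degree_cons, pow_add]
    ring
  rw [htop, ENNReal.top_mul (by positivity)] at h1
  exact top_le_iff.1 h1

theorem IsConvergent.lift {m : ℕ} {f : MvPowerSeries (Fin m) ℂ} (hf : IsConvergent f) :
    IsConvergent (lift m f) := by
  obtain ⟨r, hr, h⟩ := isConvergent_iff.1 hf
  refine isConvergent_iff.2 ⟨r, hr, ?_⟩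
  have h1 : wnorm (fun n => (r : ℝ≥0∞) ^ n.degree) (GermSpaces.lift m f) =
      wnorm (fun n => (r : ℝ≥0∞) ^ n.degree) f := by
    rw [wnorm, wnorm, ← (Finsupp.cons_right_injective (0 : ℕ)).tsum_eq]
    · refine tsum_congr fun n => ?_
      simp [coeff_lift, degree_cons]
    · intro n hn
      refine ⟨n.tail, ?_⟩
      by_cases h0 : n 0 = 0
      · rw [← h0, Finsupp.cons_tail]
      · simp [coeff_lift, h0] at hn
  rwa [h1]

/-! ### Linear changes of coordinates -/

/-- The linear forms `c_s z_0` (`s = 0`) and `z_s + c_s z_0` (`s ≠ 0`). -/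
def shearVec {m : ℕ} (c : Fin (m + 1) → ℂ) (s : Fin (m + 1)) : MvPowerSeries (Fin (m + 1)) ℂ :=
  c s • MvPowerSeries.X 0 + if s = 0 then 0 else MvPowerSeries.X s

theorem constantCoeff_shearVec {m : ℕ} (c : Fin (m + 1) → ℂ) (s : Fin (m + 1)) :
    MvPowerSeries.constantCoeff (shearVec c s) = 0 := by
  rw [shearVec]
  split_ifs <;> simp

theorem hasSubst_shearVec {m : ℕ} (c : Fin (m + 1) → ℂ) :
    MvPowerSeries.HasSubst (shearVec c) :=
  MvPowerSeries.hasSubst_of_constantCoeff_zero (constantCoeff_shearVec c)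

/-- Substitution of the linear forms `shearVec c`. -/
def shear {m : ℕ} (c : Fin (m + 1) → ℂ) :
    MvPowerSeries (Fin (m + 1)) ℂ →ₐ[ℂ] MvPowerSeries (Fin (m + 1)) ℂ :=
  MvPowerSeries.substAlgHom (hasSubst_shearVec c)

theorem shear_apply {m : ℕ} (c : Fin (m + 1) → ℂ) (f : MvPowerSeries (Fin (m + 1)) ℂ) :
    shear c f = MvPowerSeries.subst (shearVec c) f := by
  rw [shear, MvPowerSeries.substAlgHom_apply]

theorem shear_X {m : ℕ} (c : Fin (m + 1) → ℂ) (s : Fin (m + 1)) :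
    shear c (MvPowerSeries.X s) = shearVec c s := by
  rw [shear_apply, MvPowerSeries.subst_X (hasSubst_shearVec c)]

/-- The parameters of the inverse of a linear change of coordinates. -/
def shearInv {m : ℕ} (c : Fin (m + 1) → ℂ) (s : Fin (m + 1)) : ℂ :=
  if s = 0 then (c 0)⁻¹ else -(c s * (c 0)⁻¹)

theorem shearInv_zero_ne {m : ℕ} {c : Fin (m + 1) → ℂ} (h : c 0 ≠ 0) : shearInv c 0 ≠ 0 := by
  simpa [shearInv] using h

theorem shear_shearInv {m : ℕ} {c : Fin (m + 1) → ℂ} (h : c 0 ≠ 0)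
    (f : MvPowerSeries (Fin (m + 1)) ℂ) : shear (shearInv c) (shear c f) = f := by
  have hv : (fun s => MvPowerSeries.subst (shearVec (shearInv c)) (shearVec c s)) =
      MvPowerSeries.X := by
    funext s
    rw [← shear_apply, shearVec, map_add, map_smul, shear_X]
    by_cases hs : s = 0
    · subst hs
      simp [shearVec, shearInv, smul_smul, h]
    · simp [hs, shear_X, shearVec, shearInv, smul_smul]
  rw [shear_apply, shear_apply, MvPowerSeries.subst_comp_subst_apply (hasSubst_shearVec _)
    (hasSubst_shearVec _), hv, MvPowerSeries.subst_self, id]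

theorem shearInv_shearInv {m : ℕ} {c : Fin (m + 1) → ℂ} (h : c 0 ≠ 0) :
    shearInv (shearInv c) = c := by
  funext s
  by_cases hs : s = 0
  · subst hs
    simp [shearInv]
  · simp [shearInv, hs, h]

theorem shear_shearInv' {m : ℕ} {c : Fin (m + 1) → ℂ} (h : c 0 ≠ 0)
    (f : MvPowerSeries (Fin (m + 1)) ℂ) : shear c (shear (shearInv c) f) = f := by
  conv_lhs => rw [← shearInv_shearInv h]
  simpa [shearInv_shearInv h] using shear_shearInv (shearInv_zero_ne h) f

theorem le_order_shear {m : ℕ} (c : Fin (m + 1) → ℂ) (f : MvPowerSeries (Fin (m + 1)) ℂ) :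
    f.order ≤ (shear c f).order := by
  refine MvPowerSeries.le_order fun n hn => ?_
  rw [shear_apply, MvPowerSeries.coeff_subst (hasSubst_shearVec c)]
  refine finsum_eq_zero_of_forall_eq_zero fun d => ?_
  by_cases hd : (d.degree : ℕ∞) < f.order
  · rw [MvPowerSeries.coeff_of_lt_order hd, zero_smul]
  · have h : MvPowerSeries.coeff n (d.prod fun s e => shearVec c s ^ e) = 0 := by
      refine MvPowerSeries.coeff_of_lt_order ?_
      refine lt_of_lt_of_le (hn.trans_le (not_lt.1 hd)) ?_
      rw [Finsupp.prod]
      refine le_trans ?_ (MvPowerSeries.le_order_prod _ _)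
      rw [Finsupp.degree_apply, Nat.cast_sum]
      refine Finset.sum_le_sum fun i _ => ?_
      refine le_trans ?_ (MvPowerSeries.le_order_pow _)
      have : 1 ≤ (shearVec c i).order :=
        MvPowerSeries.one_le_order_iff_constCoeff_eq_zero.2 (constantCoeff_shearVec c i)
      calc ((d i : ℕ) : ℕ∞) = d i • 1 := by simp
        _ ≤ _ := nsmul_le_nsmul_right this _
    rw [h, smul_zero]

theorem constantCoeff_shear {m : ℕ} (c : Fin (m + 1) → ℂ) {f : MvPowerSeries (Fin (m + 1)) ℂ}
    (hf : MvPowerSeries.constantCoeff f = 0) : MvPowerSeries.constantCoeff (shear c f) = 0 := by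
  rw [← MvPowerSeries.one_le_order_iff_constCoeff_eq_zero] at hf ⊢
  exact hf.trans (le_order_shear c f)

theorem IsConvergent.shear {m : ℕ} (c : Fin (m + 1) → ℂ) {f : MvPowerSeries (Fin (m + 1)) ℂ}
    (hf : IsConvergent f) : IsConvergent (shear c f) := by
  obtain ⟨r, hr, h⟩ := isConvergent_iff.1 hf
  -- On the radius `r / K` every substituted linear form has norm at most `r`, since 1 + |c s| ≤ K.
  set K : ℝ≥0 := 1 + ∑ i, ‖c i‖₊ with hK
  have hK0 : 0 < K := by positivity
  refine isConvergent_iff.2 ⟨r / K, div_pos hr hK0, ?_⟩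
  set w : (Fin (m + 1) →₀ ℕ) → ℝ≥0∞ := fun n => ((r / K : ℝ≥0) : ℝ≥0∞) ^ n.degree with hw
  have hw0 : w 0 = 1 := by simp [hw]
  have hwa : ∀ a b, w (a + b) = w a * w b := fun a b => by simp [hw, pow_add]
  have hX : ∀ s, wnorm w (MvPowerSeries.X s) = ((r / K : ℝ≥0) : ℝ≥0∞) := by
    intro s
    rw [MvPowerSeries.X, wnorm_monomial]
    simp [hw]
  have hv : ∀ s, wnorm w (shearVec c s) ≤ r := by
    intro s
    have h1 : wnorm w (shearVec c s) ≤ ‖c s‖ₑ * ((r / K : ℝ≥0) : ℝ≥0∞) + ((r / K : ℝ≥0) : ℝ≥0∞) := by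
      rw [shearVec]
      refine (wnorm_add_le _ _).trans ?_
      rw [wnorm_smul, hX]
      gcongr
      split_ifs
      · simp [wnorm_zero]
      · rw [hX]
    refine h1.trans ?_
    rw [enorm_eq_nnnorm]
    norm_cast
    have h2 : ‖c s‖₊ ≤ ∑ i, ‖c i‖₊ :=
      Finset.single_le_sum (f := fun i => ‖c i‖₊) (fun _ _ => zero_le) (Finset.mem_univ s)
    calc ‖c s‖₊ * (r / K) + r / K = (1 + ‖c s‖₊) * (r / K) := by ring
      _ ≤ K * (r / K) := by
        rw [hK]
        gcongr
      _ = r := mul_div_cancel₀ r hK0.ne'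
  have hmon : ∀ d : Fin (m + 1) →₀ ℕ, wnorm w (d.prod fun s e => shearVec c s ^ e) ≤
      (r : ℝ≥0∞) ^ d.degree := by
    intro d
    rw [Finsupp.prod, Finsupp.degree_apply, ← Finset.prod_pow_eq_pow_sum]
    refine (wnorm_prod_le hw0 hwa _ _).trans (Finset.prod_le_prod' fun i _ => ?_)
    refine (wnorm_pow_le hw0 hwa _ _).trans ?_
    gcongr
    exact hv i
  refine ne_top_of_le_ne_top h ?_
  calc wnorm w (GermSpaces.shear c f)
      ≤ ∑' n, ∑' d, ‖MvPowerSeries.coeff d f‖ₑ *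
          (‖MvPowerSeries.coeff n (d.prod fun s e => shearVec c s ^ e)‖ₑ * w n) := by
        refine ENNReal.tsum_le_tsum fun n => ?_
        simp_rw [← mul_assoc]
        rw [ENNReal.tsum_mul_right]
        refine mul_le_mul_left ?_ _
        rw [shear_apply, MvPowerSeries.coeff_subst (hasSubst_shearVec c),
          finsum_eq_sum _ (MvPowerSeries.coeff_subst_finite (hasSubst_shearVec c) f n)]
        refine (enorm_sum_le _ _).trans (le_trans (le_of_eq ?_) (ENNReal.sum_le_tsum
          (MvPowerSeries.coeff_subst_finite (hasSubst_shearVec c) f n).toFinset))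
        refine Finset.sum_congr rfl fun d _ => ?_
        rw [smul_eq_mul, enorm_mul]
    _ = ∑' d, ‖MvPowerSeries.coeff d f‖ₑ * wnorm w (d.prod fun s e => shearVec c s ^ e) := by
        rw [ENNReal.tsum_comm]
        simp_rw [ENNReal.tsum_mul_left]
        rfl
    _ ≤ _ := ENNReal.tsum_le_tsum fun d => by gcongr; exact hmon d

/-- Restriction to the axis of the first variable. -/
def axis (m : ℕ) : MvPowerSeries (Fin (m + 1)) ℂ →+* PowerSeries ℂ :=
  (PowerSeries.map (MvPowerSeries.constantCoeff (σ := Fin m) (R := ℂ))).comp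
    (MvPowerSeries.finSuccEquiv ℂ m).toRingEquiv.toRingHom

theorem coeff_axis {m : ℕ} (f : MvPowerSeries (Fin (m + 1)) ℂ) (j : ℕ) :
    PowerSeries.coeff j (axis m f) = MvPowerSeries.coeff (Finsupp.single 0 j) f := by
  have h1 : PowerSeries.coeff j (axis m f) = MvPowerSeries.constantCoeff
      (PowerSeries.coeff j (MvPowerSeries.finSuccEquiv ℂ m f)) := by
    simp [axis]
  rw [h1, ← MvPowerSeries.coeff_zero_eq_constantCoeff_apply,
    MvPowerSeries.coeff_coeff_finSuccEquiv]
  congr 2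
  ext i
  refine Fin.cases ?_ (fun i => ?_) i <;> simp

theorem axis_lift {m : ℕ} (r : MvPowerSeries (Fin m) ℂ) :
    axis m (lift m r) = PowerSeries.C (MvPowerSeries.constantCoeff r) := by
  simp [axis, finSuccEquiv_lift]

theorem axis_X_zero (m : ℕ) : axis m (MvPowerSeries.X 0) = PowerSeries.X := by
  simp [axis]

theorem axis_shearVec {m : ℕ} (c : Fin (m + 1) → ℂ) (s : Fin (m + 1)) :
    axis m (shearVec c s) = PowerSeries.C (c s) * PowerSeries.X := by
  have hX : ∀ j : Fin m, axis m (MvPowerSeries.X j.succ) = 0 := by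
    intro j
    simp [axis]
  have hC : ∀ a : ℂ, axis m (MvPowerSeries.C a) = PowerSeries.C a := by
    intro a
    simp [axis]
  rw [shearVec, MvPowerSeries.smul_eq_C_mul, map_add, map_mul, hC, axis_X_zero]
  refine Fin.cases ?_ (fun i => ?_) s
  · simp
  · simp [hX]

/-- Along the axis of the first variable the substitution is z₀ ↦ z₀ c, so the coefficient of z₀^ν
becomes the leading form of `f` evaluated at `c`. -/
theorem exists_isRegularOfOrder_shear {m ν : ℕ} {f : MvPowerSeries (Fin (m + 1)) ℂ}
    (hf : f.order = ν) : ∃ c : Fin (m + 1) → ℂ, c 0 ≠ 0 ∧ IsRegularOfOrder ν (shear c f) := by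
  classical
  have hcoeff : ∀ (c : Fin (m + 1) → ℂ) (d : Fin (m + 1) →₀ ℕ),
      MvPowerSeries.coeff (Finsupp.single 0 ν) (d.prod fun s e => shearVec c s ^ e) =
        if d.degree = ν then ∏ i, c i ^ d i else 0 := by
    intro c d
    rw [← coeff_axis, Finsupp.prod_fintype _ _ (fun i => by simp), map_prod]
    simp_rw [map_pow, axis_shearVec, mul_pow]
    rw [Finset.prod_mul_distrib, Finset.prod_pow_eq_pow_sum, ← Finsupp.degree_eq_sum]
    simp_rw [← map_pow]
    rw [← map_prod, PowerSeries.coeff_C_mul, PowerSeries.coeff_X_pow]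
    simp only [mul_ite, mul_one, mul_zero, eq_comm]
  have hfin : {d : Fin (m + 1) →₀ ℕ | d.degree = ν}.Finite :=
    (Finsupp.finite_of_degree_lt (ν + 1)).subset fun d hd => by
      simp only [Set.mem_ofPred_eq] at hd ⊢
      omega
  set P : MvPolynomial (Fin (m + 1)) ℂ := MvPowerSeries.truncFinset ℂ hfin.toFinset f with hP
  have hPc : ∀ d, P.coeff d = if d.degree = ν then MvPowerSeries.coeff d f else 0 := by
    intro d
    rw [hP, MvPowerSeries.coeff_truncFinset]
    simp
  -- The extra factor forces `c 0 ≠ 0` at the same point, which makes the change of coordinates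
  -- invertible.
  have hP0 : P * MvPolynomial.X 0 ≠ 0 := by
    refine mul_ne_zero ?_ (MvPolynomial.X_ne_zero 0)
    obtain ⟨⟨d, hd, hdν⟩, -⟩ := MvPowerSeries.order_eq_nat.1 hf
    intro h
    have := hPc d
    rw [h] at this
    rw [if_pos hdν] at this
    exact hd (by simpa using this.symm)
  obtain ⟨c, hc⟩ : ∃ c, MvPolynomial.eval c (P * MvPolynomial.X 0) ≠ 0 := by
    by_contra! hall
    exact hP0 (MvPolynomial.funext fun c => by rw [hall c, map_zero])
  rw [map_mul, MvPolynomial.eval_X] at hc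
  refine ⟨c, right_ne_zero_of_mul hc, ?_, ?_⟩
  · intro j hj
    refine MvPowerSeries.coeff_of_lt_order (lt_of_lt_of_le ?_ (le_order_shear c f))
    rw [hf]
    simpa using hj
  · rw [shear_apply, MvPowerSeries.coeff_subst (hasSubst_shearVec c)]
    simp_rw [hcoeff]
    rw [finsum_eq_sum_of_support_subset (s := P.support)]
    · convert left_ne_zero_of_mul hc using 1
      rw [MvPolynomial.eval_eq']
      refine Finset.sum_congr rfl fun d hd => ?_
      rw [MvPolynomial.mem_support_iff, hPc] at hd
      rw [hPc]
      split_ifs with h <;> simp_all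
    · intro d hd
      rw [Function.mem_support] at hd
      rw [Finset.mem_coe, MvPolynomial.mem_support_iff, hPc]
      split_ifs with h <;> simp_all

/-! ### Families of power series algebras with Weierstrass division -/

/-- A family of algebras of power series in `m = 0, 1, 2, …` variables that is stable under the
operations of Weierstrass theory. -/
structure IsWeierstrassFamily (O : ∀ m, Subalgebra ℂ (MvPowerSeries (Fin m) ℂ)) : Prop where
  coe_mem : ∀ {m} (p : MvPolynomial (Fin m) ℂ), (p : MvPowerSeries (Fin m) ℂ) ∈ O m
  lift_mem : ∀ {m f}, f ∈ O m → lift m f ∈ O (m + 1)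
  slice_mem : ∀ {m f} (j : ℕ), f ∈ O (m + 1) → slice j f ∈ O m
  shear_mem : ∀ {m f} (c : Fin (m + 1) → ℂ), f ∈ O (m + 1) → shear c f ∈ O (m + 1)
  quotient_mem : ∀ {m ν f g}, f ∈ O (m + 1) → IsRegularOfOrder ν f → g ∈ O (m + 1) →
    ∃ q ∈ O (m + 1), high ν (g - q * f) = 0

theorem isWeierstrassFamily_top : IsWeierstrassFamily fun _ => ⊤ where
  coe_mem _ := Algebra.mem_top
  lift_mem _ := Algebra.mem_top
  slice_mem _ _ := Algebra.mem_top
  shear_mem _ _ := Algebra.mem_top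
  quotient_mem _ hf _ := by
    obtain ⟨q, hq, -⟩ := exists_quotient hf _
    exact ⟨q, Algebra.mem_top, hq⟩

theorem isConvergent_coe {m : ℕ} (p : MvPolynomial (Fin m) ℂ) :
    IsConvergent (p : MvPowerSeries (Fin m) ℂ) := by
  refine ⟨1, one_pos, summable_of_ne_finset_zero (s := p.support) fun n hn => ?_⟩
  rw [MvPolynomial.coeff_coe, MvPolynomial.notMem_support_iff.1 hn]
  simp

theorem isWeierstrassFamily_germ : IsWeierstrassFamily germ where
  coe_mem := isConvergent_coe
  lift_mem := IsConvergent.lift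
  slice_mem j h := IsConvergent.slice h j
  shear_mem c h := IsConvergent.shear c h
  quotient_mem hfc hf hg := by
    obtain ⟨q, hq, hc⟩ := exists_quotient hf _
    exact ⟨q, hc hfc hg, hq⟩

instance {σ : Type*} : IsDomain (MvPowerSeries σ ℂ) := NoZeroDivisors.to_isDomain _

/-- The members of a family of subalgebras, as a type whose only ring structure is the
commutative one. -/
def Member (O : ∀ m, Subalgebra ℂ (MvPowerSeries (Fin m) ℂ)) (m : ℕ) : Type := O m

instance (O : ∀ m, Subalgebra ℂ (MvPowerSeries (Fin m) ℂ)) (m : ℕ) : CommRing (Member O m) :=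
  inferInstanceAs (CommRing (O m))

instance (O : ∀ m, Subalgebra ℂ (MvPowerSeries (Fin m) ℂ)) (m : ℕ) : IsDomain (Member O m) :=
  inferInstanceAs (IsDomain (O m))

namespace Member

variable {O : ∀ m, Subalgebra ℂ (MvPowerSeries (Fin m) ℂ)} {m : ℕ}

/-- The power series underlying a member of a family. -/
def ser : Member O m →+* MvPowerSeries (Fin m) ℂ := (O m).val.toRingHom

theorem ser_mem (f : Member O m) : f.ser ∈ O m := f.2

theorem ser_injective : Function.Injective (ser : Member O m → _) := Subtype.val_injective

/-- The constant term of a member of a family. -/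
def constCoeff : Member O m →+* ℂ :=
  (MvPowerSeries.constantCoeff (σ := Fin m) (R := ℂ)).comp ser

/-- A power series that belongs to the family. -/
def of (f : MvPowerSeries (Fin m) ℂ) (hf : f ∈ O m) : Member O m := ⟨f, hf⟩

theorem not_isUnit_of_constCoeff {g : Member O m} (hg : constCoeff g = 0) : ¬ IsUnit g := fun h => by
  have := h.map (constCoeff (O := O) (m := m))
  rw [hg] at this
  exact not_isUnit_zero this

/-- Ring homomorphisms to a family from a ring. -/
def codRestrict {R : Type*} [CommRing R] (φ : R →+* MvPowerSeries (Fin m) ℂ)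
    (h : ∀ x, φ x ∈ O m) : R →+* Member O m :=
  RingHom.codRestrict φ (O m) h

end Member

open Member

theorem high_zero {m : ℕ} (f : MvPowerSeries (Fin (m + 1)) ℂ) : high 0 f = f := by
  ext n
  rw [coeff_high, Finsupp.single_zero, add_zero]

/-! ### Units, Weierstrass preparation and division in a family -/

namespace IsWeierstrassFamily

variable {O : ∀ m, Subalgebra ℂ (MvPowerSeries (Fin m) ℂ)} (hO : IsWeierstrassFamily O) {m : ℕ}
include hO

/-- Division of 1 by a series regular of order 0 leaves no remainder. -/
theorem isUnit_of_constCoeff {f : Member O (m + 1)} (h0 : constCoeff f ≠ 0) : IsUnit f := by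
  have hreg : IsRegularOfOrder 0 f.ser :=
    ⟨fun j hj => absurd hj (Nat.not_lt_zero j), by
      rwa [Finsupp.single_zero, MvPowerSeries.coeff_zero_eq_constantCoeff_apply]⟩
  obtain ⟨q, hq, h⟩ := hO.quotient_mem f.ser_mem hreg (1 : Member O (m + 1)).ser_mem
  rw [high_zero, sub_eq_zero] at h
  exact IsUnit.of_mul_eq_one_right (of q hq) (ser_injective h.symm)

/-- Inclusion of the series in the variables other than the first one. -/
def liftHom (m : ℕ) : Member O m →+* Member O (m + 1) :=
  codRestrict ((lift m).toRingHom.comp ser) fun x => hO.lift_mem x.ser_mem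

theorem ser_liftHom (a : Member O m) : (hO.liftHom m a).ser = lift m a.ser := rfl

/-- The first variable, as a member of the family. -/
def firstVar (m : ℕ) : Member O (m + 1) :=
  of (MvPowerSeries.X 0) (by simpa using hO.coe_mem (MvPolynomial.X (0 : Fin (m + 1))))

theorem ser_firstVar : (hO.firstVar m).ser = MvPowerSeries.X 0 := rfl

/-- Evaluation of polynomials over `O m` at the first variable. -/
def polyEval (m : ℕ) : Polynomial (Member O m) →+* Member O (m + 1) :=
  Polynomial.eval₂RingHom (hO.liftHom m) (hO.firstVar m)

theorem polyEval_C (a : Member O m) : hO.polyEval m (Polynomial.C a) = hO.liftHom m a :=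
  Polynomial.eval₂_C _ _

theorem polyEval_X : hO.polyEval m Polynomial.X = hO.firstVar m := Polynomial.eval₂_X _ _

theorem ser_sum_lift {ν : ℕ} (r : Fin ν → Member O m) :
    (∑ j : Fin ν, hO.liftHom m (r j) * hO.firstVar m ^ (j : ℕ)).ser =
    ∑ j : Fin ν, lift m (r j).ser * MvPowerSeries.X 0 ^ (j : ℕ) := by
  rw [map_sum]
  simp_rw [map_mul, map_pow, ser_liftHom, ser_firstVar]

theorem high_polyEval {ν : ℕ} {p : Polynomial (Member O m)} (hp : p.degree < ν) :
    high ν (hO.polyEval m p).ser = 0 := by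
  by_cases h0 : p = 0
  · rw [h0, map_zero, map_zero, map_zero]
  have h1 : hO.polyEval m p =
      ∑ j : Fin ν, hO.liftHom m (p.coeff j) * hO.firstVar m ^ (j : ℕ) := by
    rw [polyEval, Polynomial.coe_eval₂RingHom, Polynomial.eval₂_eq_sum_range' _
      ((Polynomial.natDegree_lt_iff_degree_lt h0).2 hp), Finset.sum_range]
  rw [h1, ser_sum_lift, high_sum_lift]

theorem exists_polyEval {ν : ℕ} (f : Member O (m + 1)) (h : high ν f.ser = 0) :
    ∃ p : Polynomial (Member O m), p.degree < ν ∧ hO.polyEval m p = f := by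
  let r : Fin ν → Member O m := fun j => of (slice j f.ser) (hO.slice_mem j f.ser_mem)
  refine ⟨∑ j : Fin ν, Polynomial.C (r j) * Polynomial.X ^ (j : ℕ),
    Polynomial.degree_sum_fin_lt r, ?_⟩
  rw [map_sum]
  simp_rw [map_mul, map_pow, polyEval_C, polyEval_X]
  apply ser_injective
  rw [ser_sum_lift]
  conv_rhs => rw [← low_add_X_pow_mul_high ν f.ser, h, mul_zero, add_zero, low_eq_sum]
  rfl

theorem axis_polyEval (p : Polynomial (Member O m)) :
    axis m (hO.polyEval m p).ser = ((p.map constCoeff : Polynomial ℂ) : PowerSeries ℂ) := by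
  have h : (axis m).comp (ser.comp (hO.polyEval m)) =
      Polynomial.coeToPowerSeries.ringHom.comp
        (Polynomial.mapRingHom (constCoeff (O := O) (m := m))) := by
    refine Polynomial.ringHom_ext (fun a => ?_) ?_
    · change axis m (hO.polyEval m (Polynomial.C a)).ser =
        ((Polynomial.map constCoeff (Polynomial.C a) : Polynomial ℂ) : PowerSeries ℂ)
      rw [polyEval_C, ser_liftHom, axis_lift, Polynomial.map_C, Polynomial.coe_C]
      rfl
    · change axis m (hO.polyEval m Polynomial.X).ser =
        ((Polynomial.map (constCoeff (O := O) (m := m)) Polynomial.X : Polynomial ℂ) : PowerSeries ℂ)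
      rw [polyEval_X, Polynomial.map_X, Polynomial.coe_X]
      exact axis_X_zero m
  exact DFunLike.congr_fun h p

theorem constantCoeff_polyEval (p : Polynomial (Member O m)) :
    constCoeff (hO.polyEval m p) = constCoeff (p.coeff 0) := by
  have h := congrArg (PowerSeries.coeff 0) (hO.axis_polyEval p)
  rw [coeff_axis, Polynomial.coeff_coe, Polynomial.coeff_map, Finsupp.single_zero] at h
  exact h

/-- Weierstrass preparation. -/
theorem exists_weierstrass {ν : ℕ} (f : Member O (m + 1)) (hf : IsRegularOfOrder ν f.ser) :
    ∃ p : Polynomial (Member O m), p.Monic ∧ p.map constCoeff = Polynomial.X ^ ν ∧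
      Associated (hO.polyEval m p) f := by
  obtain ⟨q, hq, h⟩ := hO.quotient_mem f.ser_mem hf (hO.firstVar m ^ ν).ser_mem
  obtain ⟨r, hr, hrE⟩ := hO.exists_polyEval (hO.firstVar m ^ ν - of q hq * f) h
  have hE : hO.polyEval m (Polynomial.X ^ ν - r) = of q hq * f := by
    rw [map_sub, map_pow, polyEval_X, hrE]
    ring
  have hmonic : (Polynomial.X ^ ν - r).Monic := Polynomial.monic_X_pow_sub hr
  -- On the axis the product q f is divisible by X^ν and equals X^ν minus the reduction of r, of
  -- degree less than ν. So r reduces to 0, and the coefficient of X^ν then shows that q has nonzero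
  -- constant term.
  have hax : axis m q * axis m f.ser =
      (((Polynomial.X ^ ν - r).map constCoeff : Polynomial ℂ) : PowerSeries ℂ) := by
    rw [← axis_polyEval hO, hE, ← map_mul]
    rfl
  have hdvd : (PowerSeries.X : PowerSeries ℂ) ^ ν ∣ axis m f.ser := by
    rw [PowerSeries.X_pow_dvd_iff]
    intro j hj
    rw [coeff_axis]
    exact hf.1 j hj
  have hmap : (Polynomial.X ^ ν - r).map constCoeff = Polynomial.X ^ ν := by
    have h1 := PowerSeries.X_pow_dvd_iff.1 (hax ▸ hdvd.mul_left (axis m q))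
    have h2 : r.map constCoeff = 0 := by
      ext j
      by_cases hj : j < ν
      · have h3 := h1 j hj
        rw [Polynomial.coeff_coe, Polynomial.map_sub, Polynomial.map_pow, Polynomial.map_X,
          Polynomial.coeff_sub, Polynomial.coeff_X_pow, if_neg hj.ne] at h3
        simpa using h3
      · rw [Polynomial.coeff_map, Polynomial.coeff_eq_zero_of_degree_lt
          (hr.trans_le (by exact_mod_cast not_lt.1 hj))]
        simp
    rw [Polynomial.map_sub, h2, sub_zero, Polynomial.map_pow, Polynomial.map_X]
  refine ⟨_, hmonic, hmap, ?_⟩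
  have hq0 : MvPowerSeries.constantCoeff q ≠ 0 := by
    intro h0
    rw [hmap] at hax
    have h1 := congrArg (PowerSeries.coeff ν) hax
    obtain ⟨g, hg⟩ := hdvd
    have h2 : PowerSeries.constantCoeff (axis m q) = 0 := by
      rw [← PowerSeries.coeff_zero_eq_constantCoeff_apply, coeff_axis, Finsupp.single_zero,
        MvPowerSeries.coeff_zero_eq_constantCoeff_apply, h0]
    rw [hg, mul_left_comm, PowerSeries.coeff_X_pow_mul', Polynomial.coeff_coe] at h1
    simp [h2] at h1
  rw [hE]
  exact associated_unit_mul_left f _ (hO.isUnit_of_constCoeff (f := of q hq) hq0)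

theorem exists_division {ν : ℕ} {f : Member O (m + 1)} (hf : IsRegularOfOrder ν f.ser)
    (g : Member O (m + 1)) : ∃ (q : Member O (m + 1)) (r : Polynomial (Member O m)),
      r.degree < ν ∧ g = q * f + hO.polyEval m r := by
  obtain ⟨q, hq, h⟩ := hO.quotient_mem f.ser_mem hf g.ser_mem
  obtain ⟨r, hr, hrE⟩ := hO.exists_polyEval (g - of q hq * f) h
  exact ⟨of q hq, r, hr, by rw [hrE]; ring⟩

theorem polyEval_eq_zero_of_dvd {ν : ℕ} {f : Member O (m + 1)} (hf : IsRegularOfOrder ν f.ser)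
    {r : Polynomial (Member O m)} (hr : r.degree < ν) (h : f ∣ hO.polyEval m r) :
    hO.polyEval m r = 0 := by
  obtain ⟨q, hq⟩ := h
  have h1 := hO.high_polyEval hr
  rw [hq, map_mul, mul_comm] at h1
  have h2 : q = 0 := ser_injective ((eq_zero_of_high_mul_eq_zero hf h1).trans (map_zero ser).symm)
  rw [hq, h2, mul_zero]

end IsWeierstrassFamily

/-! ### Elimination of a variable, Euclid's lemma and unique factorization -/

theorem exists_C_mem_of_map_eq_top {R : Type*} [CommRing R] [IsDomain R] {J : Ideal (Polynomial R)}
    (h : J.map (Polynomial.mapRingHom (algebraMap R (FractionRing R))) = ⊤) :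
    ∃ s : R, s ≠ 0 ∧ Polynomial.C s ∈ J := by
  set φ := Polynomial.mapRingHom (algebraMap R (FractionRing R)) with hφ
  -- Clearing denominators: a nonzero constant brings each member of the extended ideal back into
  -- `J`; this is then applied to 1.
  have key : ∀ x ∈ J.map φ, ∃ s : R, s ≠ 0 ∧ ∃ y ∈ J, φ y = φ (Polynomial.C s) * x := by
    intro x hx
    refine Submodule.span_induction ?_ ?_ ?_ ?_ hx
    · rintro _ ⟨y, hy, rfl⟩
      exact ⟨1, one_ne_zero, y, hy, by simp⟩
    · exact ⟨1, one_ne_zero, 0, J.zero_mem, by simp⟩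
    · rintro x x' - - ⟨s, hs, y, hy, h1⟩ ⟨s', hs', y', hy', h2⟩
      refine ⟨s * s', mul_ne_zero hs hs', Polynomial.C s' * y + Polynomial.C s * y',
        J.add_mem (J.mul_mem_left _ hy) (J.mul_mem_left _ hy'), ?_⟩
      rw [map_add, map_mul, map_mul, h1, h2, Polynomial.C_mul, map_mul]
      ring
    · rintro a x - ⟨s, hs, y, hy, h1⟩
      obtain ⟨b, hbM, hb⟩ := IsLocalization.integerNormalization_spec (nonZeroDivisors R) a
      refine ⟨b * s, mul_ne_zero (nonZeroDivisors.ne_zero hbM) hs,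
        IsLocalization.integerNormalization (nonZeroDivisors R) a * y, J.mul_mem_left _ hy, ?_⟩
      have hb' : φ (IsLocalization.integerNormalization (nonZeroDivisors R) a) =
          φ (Polynomial.C b) * a := by
        rw [hφ, Polynomial.coe_mapRingHom, hb, Polynomial.map_C, ← Polynomial.smul_eq_C_mul,
          algebraMap_smul]
      rw [map_mul, hb', h1, Polynomial.C_mul, map_mul, smul_eq_mul]
      ring
  obtain ⟨s, hs, y, hy, h1⟩ := key 1 (h ▸ Submodule.mem_top)
  rw [mul_one] at h1
  have : y = Polynomial.C s :=
    Polynomial.map_injective _ (IsFractionRing.injective R (FractionRing R)) h1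
  exact ⟨s, hs, this ▸ hy⟩

namespace IsWeierstrassFamily

variable {O : ∀ m, Subalgebra ℂ (MvPowerSeries (Fin m) ℂ)} (hO : IsWeierstrassFamily O) {m : ℕ}
include hO

/-- Elimination of the first variable: a family with a regular member has a common divisor without
constant term, or the ideal it generates contains a nonzero series in the other variables. -/
theorem exists_dvd_or_lift_mem [IsIntegrallyClosed (Member O m)] {ι : Type*} (F : ι → Member O (m + 1)) (i₀ : ι)
    {ν : ℕ} (hf : IsRegularOfOrder ν (F i₀).ser) :
    (∃ g, constCoeff g = 0 ∧ ∀ i, g ∣ F i) ∨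
      ∃ s : Member O m, s ≠ 0 ∧ hO.liftHom m s ∈ Ideal.span (Set.range F) := by
  obtain ⟨p, hp, hpmap, hassoc⟩ := hO.exists_weierstrass _ hf
  choose q r hr hqr using fun i => hO.exists_division hf (F i)
  set φ := Polynomial.mapRingHom (algebraMap (Member O m) (FractionRing (Member O m))) with hφ
  have hinj : Function.Injective (algebraMap (Member O m) (FractionRing (Member O m))) :=
    IsFractionRing.injective _ _
  -- By preparation and division, `p` and the remainders evaluate to generators of the ideal of the
  -- `F i`, so the problem moves to a polynomial ring.
  set J : Ideal (Polynomial (Member O m)) := Ideal.span (insert p (Set.range r)) with hJ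
  have hpJ : p ∈ J := Ideal.subset_span (Set.mem_insert _ _)
  have hrJ : ∀ i, r i ∈ J := fun i => Ideal.subset_span (Set.mem_insert_of_mem _ ⟨i, rfl⟩)
  by_cases htop : J.map φ = ⊤
  · right
    obtain ⟨s, hs, hsJ⟩ := exists_C_mem_of_map_eq_top htop
    refine ⟨s, hs, ?_⟩
    have hmem : ∀ i, F i ∈ Ideal.span (Set.range F) := fun i => Ideal.subset_span ⟨i, rfl⟩
    have hle : J ≤ (Ideal.span (Set.range F)).comap (hO.polyEval m) := by
      rw [hJ, Ideal.span_le, Set.insert_subset_iff]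
      refine ⟨show hO.polyEval m p ∈ Ideal.span (Set.range F) from
        Ideal.mem_of_dvd _ hassoc.symm.dvd (hmem i₀), ?_⟩
      rintro _ ⟨i, rfl⟩
      have : hO.polyEval m (r i) = F i - q i * F i₀ := by
        rw [eq_sub_iff_add_eq']
        exact (hqr i).symm
      change hO.polyEval m (r i) ∈ Ideal.span (Set.range F)
      rw [this]
      exact Ideal.sub_mem _ (hmem i) (Ideal.mul_mem_left _ _ (hmem i₀))
    rw [← hO.polyEval_C]
    exact hle hsJ
  · left
    obtain ⟨g, hg⟩ := (IsPrincipalIdealRing.principal (J.map φ)).principal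
    rw [Ideal.submodule_span_eq] at hg
    have hgdvd : ∀ x ∈ J, g ∣ φ x := fun x hx =>
      Ideal.mem_span_singleton.1 (hg ▸ Ideal.mem_map_of_mem φ hx)
    -- The generator divides the monic `p`; integral closedness shows that, up to its leading
    -- coefficient, it is defined over the base ring.
    obtain ⟨g', hg'⟩ := IsIntegrallyClosed.eq_map_mul_C_of_dvd (FractionRing (Member O m)) hp (hgdvd p hpJ)
    have hg0 : g ≠ 0 := by
      rintro rfl
      have h1 := zero_dvd_iff.1 (hgdvd p hpJ)
      exact hp.ne_zero (Polynomial.map_injective _ hinj (h1.trans (map_zero φ).symm))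
    have hmonic : g'.Monic := by
      refine Polynomial.monic_of_injective hinj ?_
      have h1 := congrArg Polynomial.leadingCoeff hg'
      rw [Polynomial.leadingCoeff_mul, Polynomial.leadingCoeff_C] at h1
      exact mul_right_cancel₀ (Polynomial.leadingCoeff_ne_zero.2 hg0) (h1.trans (one_mul _).symm)
    have hdvd : ∀ x ∈ J, g' ∣ x := fun x hx => by
      rw [← Polynomial.map_dvd_map _ hinj hmonic]
      exact (Dvd.intro _ hg').trans (hgdvd x hx)
    refine ⟨hO.polyEval m g', ?_, fun i => ?_⟩
    · rw [constantCoeff_polyEval]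
      -- Modulo the maximal ideal `g'` is a power of X up to a unit. The power is not X⁰, since then
      -- `g'` would be 1 and the extended ideal everything; so the constant term of `g'` reduces to
      -- 0.
      have h1 : g'.map constCoeff ∣ Polynomial.X ^ ν :=
        hpmap ▸ Polynomial.map_dvd _ (hdvd p hpJ)
      obtain ⟨i, -, hi⟩ := (dvd_prime_pow Polynomial.prime_X ν).1 h1
      have hi0 : i ≠ 0 := by
        rintro rfl
        rw [pow_zero, associated_one_iff_isUnit] at hi
        have h2 := Polynomial.natDegree_eq_zero_of_isUnit hi
        rw [hmonic.natDegree_map] at h2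
        have h3 : g' = 1 := hmonic.natDegree_eq_zero.1 h2
        apply htop
        rw [hg, Ideal.span_singleton_eq_top, ← hg', h3, Polynomial.map_one, one_mul,
          Polynomial.isUnit_C]
        exact (Polynomial.leadingCoeff_ne_zero.2 hg0).isUnit
      have h4 : Polynomial.X ∣ g'.map constCoeff :=
        (dvd_pow_self _ hi0).trans hi.symm.dvd
      rw [← Polynomial.coeff_map]
      exact Polynomial.X_dvd_iff.1 h4
    · rw [hqr i]
      exact dvd_add (Dvd.dvd.mul_left ((map_dvd _ (hdvd p hpJ)).trans hassoc.dvd) _)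
        (map_dvd _ (hdvd _ (hrJ i)))

/-- The linear changes of coordinates of the members of a family. -/
def shearHom (c : Fin (m + 1) → ℂ) : Member O (m + 1) →+* Member O (m + 1) :=
  codRestrict ((shear c).toRingHom.comp ser) fun x => hO.shear_mem c x.ser_mem

theorem shearHom_shearInv {c : Fin (m + 1) → ℂ} (hc : c 0 ≠ 0) (f : Member O (m + 1)) :
    hO.shearHom (shearInv c) (hO.shearHom c f) = f :=
  ser_injective (shear_shearInv hc _)

theorem shearHom_dvd_iff {c : Fin (m + 1) → ℂ} (hc : c 0 ≠ 0) {f g : Member O (m + 1)} :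
    hO.shearHom c f ∣ hO.shearHom c g ↔ f ∣ g := by
  refine ⟨fun h => ?_, map_dvd _⟩
  simpa only [shearHom_shearInv hO hc] using map_dvd (hO.shearHom (shearInv c)) h

theorem exists_dvd_or_shear_mem [IsIntegrallyClosed (Member O m)] {ι : Type*}
    (F : ι → Member O (m + 1)) (i₀ : ι) (hF : F i₀ ≠ 0) :
    (∃ g, constCoeff g = 0 ∧ ∀ i, g ∣ F i) ∨
      ∃ c : Fin (m + 1) → ℂ, c 0 ≠ 0 ∧
        (∃ ν, IsRegularOfOrder ν (hO.shearHom c (F i₀)).ser) ∧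
        ∃ s : Member O m, s ≠ 0 ∧
          hO.liftHom m s ∈ Ideal.span (Set.range fun i => hO.shearHom c (F i)) := by
  have hF' : (F i₀).ser ≠ 0 := fun h => hF (ser_injective (h.trans (map_zero ser).symm))
  obtain ⟨c, hc, hreg⟩ := exists_isRegularOfOrder_shear
    (MvPowerSeries.ne_zero_iff_order_finite.1 hF').symm
  rcases hO.exists_dvd_or_lift_mem (fun i => hO.shearHom c (F i)) i₀ hreg with ⟨g, hg, hdvd⟩ | h
  · left
    refine ⟨hO.shearHom (shearInv c) g, constantCoeff_shear _ hg, fun i => ?_⟩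
    simpa only [shearHom_shearInv hO hc] using map_dvd (hO.shearHom (shearInv c)) (hdvd i)
  · exact Or.inr ⟨c, hc, ⟨_, hreg⟩, h⟩

/-- Euclid's lemma for coprime power series. -/
theorem dvd_of_dvd_mul [IsIntegrallyClosed (Member O m)] {f₁ f₂ h : Member O (m + 1)} (hf₁ : f₁ ≠ 0)
    (hcop : ∀ g, constCoeff g = 0 → g ∣ f₁ → ¬ g ∣ f₂) (hdvd : f₁ ∣ f₂ * h) :
    f₁ ∣ h := by
  rcases hO.exists_dvd_or_shear_mem ![f₁, f₂] 0 hf₁ with ⟨g, hg, hall⟩ | ⟨c, hc, ⟨ν, hreg⟩, s, hs, hmem⟩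
  · exact absurd (hall 1) (hcop g hg (hall 0))
  have hrange : (Set.range fun i => hO.shearHom c (![f₁, f₂] i)) =
      {hO.shearHom c f₁, hO.shearHom c f₂} := by
    ext x
    simp [Fin.exists_fin_two, eq_comm]
  rw [hrange, Ideal.mem_span_pair] at hmem
  obtain ⟨a, b, hab⟩ := hmem
  rw [← hO.shearHom_dvd_iff hc] at hdvd ⊢
  change IsRegularOfOrder ν (hO.shearHom c f₁).ser at hreg
  obtain ⟨q, r, hr, hqr⟩ := hO.exists_division hreg (hO.shearHom c h)
  -- In the new coordinates s = a f₁ + b f₂ and h = q f₁ + r, so s r is a multiple of f₁ of degree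
  -- less than ν in the first variable. Uniqueness of division gives s r = 0, hence r = 0.
  have h1 : hO.shearHom c f₁ ∣ hO.polyEval m (Polynomial.C s * r) := by
    have h2 : hO.polyEval m (Polynomial.C s * r) =
        (a * hO.shearHom c h - hO.liftHom m s * q) * hO.shearHom c f₁ + b * hO.shearHom c (f₂ * h) := by
      rw [map_mul, polyEval_C, map_mul]
      linear_combination (-hO.liftHom m s) * hqr - (hO.shearHom c h) * hab
    rw [h2]
    exact dvd_add (dvd_mul_left _ _) (hdvd.mul_left _)
  have hdeg : (Polynomial.C s * r).degree < ν := by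
    rwa [Polynomial.degree_C_mul hs]
  have h3 := hO.polyEval_eq_zero_of_dvd hreg hdeg h1
  rw [map_mul, polyEval_C] at h3
  have h4 : hO.liftHom m s ≠ 0 := by
    intro h5
    refine hs (ser_injective (lift_injective m ?_))
    rw [← ser_liftHom hO, h5, map_zero, map_zero, map_zero]
  rw [hqr, (mul_eq_zero.1 h3).resolve_left h4, add_zero]
  exact dvd_mul_left _ _

/-- A non-unit factor raises the order, so divisor chains terminate. An irreducible element not
dividing `a` has no common divisor with it in the maximal ideal, so Euclid's lemma makes it prime.
-/
theorem uniqueFactorizationMonoid [IsIntegrallyClosed (Member O m)] :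
    UniqueFactorizationMonoid (Member O (m + 1)) := by
  have hwf : WfDvdMonoid (Member O (m + 1)) := by
    refine ⟨Subrelation.wf ?_ (InvImage.wf
      (fun f : Member O (m + 1) => f.ser.order) wellFounded_lt)⟩
    rintro a b ⟨ha, x, hx, rfl⟩
    change a.ser.order < (a * x).ser.order
    have ha' : a.ser ≠ 0 := fun h => ha (ser_injective (h.trans (map_zero ser).symm))
    have hx' : 1 ≤ x.ser.order := by
      rw [MvPowerSeries.one_le_order_iff_constCoeff_eq_zero]
      by_contra h
      exact hx (hO.isUnit_of_constCoeff h)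
    rw [map_mul, MvPowerSeries.order_mul, ← MvPowerSeries.ne_zero_iff_order_finite.1 ha']
    calc ((a.ser.order.toNat : ℕ) : ℕ∞) < (a.ser.order.toNat : ℕ) + 1 := by
          exact_mod_cast Nat.lt_succ_self _
      _ ≤ _ := by gcongr
  refine { hwf with irreducible_iff_prime := fun {f} => ⟨fun hf => ?_, Prime.irreducible⟩ }
  refine ⟨hf.ne_zero, hf.not_isUnit, fun a b hab => ?_⟩
  by_cases hfa : f ∣ a
  · exact Or.inl hfa
  refine Or.inr (hO.dvd_of_dvd_mul hf.ne_zero (fun g hg hgf hga => ?_) hab)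
  obtain ⟨h, rfl⟩ := hgf
  rcases hf.isUnit_or_isUnit rfl with hu | hu
  · exact not_isUnit_of_constCoeff hg hu
  · exact hfa ((hu.mul_right_dvd).2 hga)

/-- Induction on the number of variables: the ring is ℂ without variables, and integral closedness
in m variables gives unique factorization in m + 1. -/
theorem isIntegrallyClosed : ∀ m, IsIntegrallyClosed (Member O m)
  | 0 => by
    let φ : ℂ →+* Member O 0 := codRestrict MvPowerSeries.C fun c => (O 0).algebraMap_mem c
    have hbij : Function.Bijective φ := by
      refine ⟨φ.injective, fun f => ?_⟩
      obtain ⟨c, hc⟩ := MvPowerSeries.C_surjective f.ser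
      exact ⟨c, ser_injective hc⟩
    exact IsIntegrallyClosed.of_equiv (RingEquiv.ofBijective φ hbij)
  | m + 1 => by
    have := isIntegrallyClosed m
    have := hO.uniqueFactorizationMonoid (m := m)
    infer_instance

end IsWeierstrassFamily

/-! ### Coordinates of jets -/

theorem order_mul {σ : Type*} (f g : MvPowerSeries σ ℂ) : (f * g).order = f.order + g.order := by
  by_cases hf : f = 0
  · simp [hf]
  by_cases hg : g = 0
  · simp [hg]
  have hp := MvPowerSeries.ne_zero_iff_order_finite.1 hf
  have hq := MvPowerSeries.ne_zero_iff_order_finite.1 hg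
  refine le_antisymm (not_lt.1 fun hlt => ?_) MvPowerSeries.le_order_mul
  rw [← hp, ← hq, ← Nat.cast_add] at hlt
  have h1 := MvPowerSeries.weightedHomogeneousComponent_of_lt_weightedOrder_eq_zero hlt
  rw [MvPowerSeries.weightedHomogeneousComponent_mul_of_le_weightedOrder hp.le hq.le] at h1
  rcases mul_eq_zero.1 h1 with h | h
  · exact MvPowerSeries.weightedHomogeneousComponent_of_weightedOrder hp h
  · exact MvPowerSeries.weightedHomogeneousComponent_of_weightedOrder hq h

/-- The multi-indices of degree at most `N`. -/
abbrev JetIndex (m N : ℕ) : Type := {n : Fin m →₀ ℕ // n.degree ≤ N}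

instance (m N : ℕ) : Finite (JetIndex m N) :=
  ((Finsupp.finite_of_degree_lt (N + 1)).subset fun n (hn : n.degree ≤ N) =>
    Nat.lt_succ_of_le hn).to_subtype

instance (m N : ℕ) : Fintype (JetIndex m N) := Fintype.ofFinite _

/-- A slack exponent N - |n| turns these multi-indices into those of degree exactly N in one more
variable. -/
theorem card_jetIndex (m N : ℕ) : Fintype.card (JetIndex m N) = (m + N).choose N := by
  classical
  rw [← Nat.card_eq_fintype_card]
  have e : JetIndex m N ≃ (Finset.univ : Finset (Fin (m + 1))).finsuppAntidiag N :=
    { toFun := fun n => ⟨n.1.cons (N - n.1.degree), by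
        rw [Finset.mem_finsuppAntidiag]
        refine ⟨?_, Finset.subset_univ _⟩
        have := degree_cons (N - n.1.degree) n.1
        rw [Finsupp.degree_eq_sum] at this
        rw [this]
        exact Nat.sub_add_cancel n.2⟩
      invFun := fun n => ⟨n.1.tail, by
        have h := (Finset.mem_finsuppAntidiag.1 n.2).1
        rw [← Finsupp.degree_eq_sum, degree_eq_add_tail] at h
        exact (Nat.le_add_left _ _).trans h.le⟩
      left_inv := fun n => Subtype.ext (Finsupp.tail_cons _ _)
      right_inv := fun n => by
        have h := (Finset.mem_finsuppAntidiag.1 n.2).1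
        rw [← Finsupp.degree_eq_sum, degree_eq_add_tail] at h
        refine Subtype.ext ?_
        conv_rhs => rw [← Finsupp.cons_tail n.1]
        change Finsupp.cons (N - n.1.tail.degree) n.1.tail = _
        rw [Nat.sub_eq_of_eq_add h.symm] }
  rw [Nat.card_congr e, Nat.card_eq_fintype_card, Fintype.card_coe,
    Finset.card_finsuppAntidiag_nat_eq_choose, Finset.card_univ, Fintype.card_fin]
  congr 1
  omega

/-- The coefficients of degree at most `N`. -/
def coords (m N : ℕ) : MvPowerSeries (Fin m) ℂ →ₗ[ℂ] (JetIndex m N → ℂ) :=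
  LinearMap.pi fun n => MvPowerSeries.coeff n.1

theorem coords_apply {m N : ℕ} (f : MvPowerSeries (Fin m) ℂ) (n : JetIndex m N) :
    coords m N f n = MvPowerSeries.coeff n.1 f := rfl

/-- The polynomial with given coefficients of degree at most `N`. -/
def ofCoords (m N : ℕ) : (JetIndex m N → ℂ) →ₗ[ℂ] MvPolynomial (Fin m) ℂ :=
  ∑ n : JetIndex m N, (MvPolynomial.monomial n.1).comp (LinearMap.proj n)

theorem coeff_ofCoords {m N : ℕ} (v : JetIndex m N → ℂ) (n : Fin m →₀ ℕ) :
    (ofCoords m N v).coeff n = if h : n.degree ≤ N then v ⟨n, h⟩ else 0 := by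
  classical
  rw [ofCoords, LinearMap.sum_apply, MvPolynomial.coeff_sum]
  simp only [LinearMap.comp_apply, LinearMap.proj_apply, MvPolynomial.coeff_monomial]
  split_ifs with h
  · rw [Finset.sum_eq_single ⟨n, h⟩ (fun b _ hb => if_neg fun hbn => hb (Subtype.ext hbn))
      (fun hn => absurd (Finset.mem_univ _) hn)]
    exact if_pos rfl
  · exact Finset.sum_eq_zero fun b _ => if_neg fun hb : b.1 = n => h (hb ▸ b.2)

theorem ofCoords_mem (m N : ℕ) (v : JetIndex m N → ℂ) :
    ofCoords m N v ∈ MvPolynomial.restrictTotalDegree (Fin m) ℂ N := by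
  rw [MvPolynomial.mem_restrictTotalDegree]
  refine Finset.sup_le fun n hn => ?_
  rw [MvPolynomial.mem_support_iff, coeff_ofCoords] at hn
  by_contra h
  exact hn (dif_neg fun h' => h (by rwa [Finsupp.degree_apply] at h'))

/-- The polynomial with given coefficients of degree at most `N`, as a power series. -/
def serOfCoords (m N : ℕ) : (JetIndex m N → ℂ) →ₗ[ℂ] MvPowerSeries (Fin m) ℂ :=
  (MvPolynomial.coeToMvPowerSeries.algHom (R := ℂ) (σ := Fin m) ℂ).toLinearMap.comp (ofCoords m N)

theorem serOfCoords_apply {m N : ℕ} (v : JetIndex m N → ℂ) :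
    serOfCoords m N v = (ofCoords m N v : MvPowerSeries (Fin m) ℂ) := by
  simp [serOfCoords, MvPolynomial.coeToMvPowerSeries.algHom_apply]

theorem coords_serOfCoords {m N : ℕ} (v : JetIndex m N → ℂ) : coords m N (serOfCoords m N v) = v := by
  funext n
  rw [coords_apply, serOfCoords_apply, MvPolynomial.coeff_coe, coeff_ofCoords, dif_pos n.2]

theorem ofCoords_coords {m N : ℕ} (f : MvPowerSeries (Fin m) ℂ) :
    ofCoords m N (coords m N f) = jet N f := by
  ext n
  rw [coeff_ofCoords, jet, MvPowerSeries.coeff_truncTotal_eq_ite]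
  simp only [Nat.lt_succ_iff, coords_apply, dite_eq_ite]

theorem ofCoords_injective (m N : ℕ) : Function.Injective (ofCoords m N) := by
  intro v w h
  rw [← coords_serOfCoords v, ← coords_serOfCoords w, serOfCoords_apply, serOfCoords_apply, h]

theorem coords_eq_zero_iff {m N : ℕ} {f : MvPowerSeries (Fin m) ℂ} :
    coords m N f = 0 ↔ ((N + 1 : ℕ) : ℕ∞) ≤ f.order := by
  constructor
  · intro h
    refine MvPowerSeries.nat_le_order fun n hn => ?_
    exact congrFun h ⟨n, Nat.le_of_lt_succ hn⟩
  · intro h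
    funext n
    exact MvPowerSeries.coeff_of_lt_order (lt_of_lt_of_le (Nat.cast_lt.2 (Nat.lt_succ_of_le n.2)) h)

theorem coords_eq_iff {m N : ℕ} {f g : MvPowerSeries (Fin m) ℂ} :
    coords m N f = coords m N g ↔ ((N + 1 : ℕ) : ℕ∞) ≤ (f - g).order := by
  rw [← coords_eq_zero_iff, map_sub, sub_eq_zero]

theorem coords_mul_congr {m N : ℕ} (g : MvPowerSeries (Fin m) ℂ) {u v : MvPowerSeries (Fin m) ℂ}
    (h : coords m N u = coords m N v) : coords m N (g * u) = coords m N (g * v) := by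
  rw [coords_eq_iff] at h ⊢
  rw [← mul_sub, order_mul]
  exact h.trans le_add_self

/-- A factor without constant term gains one degree; this is why cofactors of degree d suffice for
(d+1)-jets. -/
theorem coords_succ_mul_congr {m N : ℕ} {g : MvPowerSeries (Fin m) ℂ}
    (hg : MvPowerSeries.constantCoeff g = 0) {u v : MvPowerSeries (Fin m) ℂ}
    (h : coords m N u = coords m N v) : coords m (N + 1) (g * u) = coords m (N + 1) (g * v) := by
  rw [coords_eq_iff] at h ⊢
  rw [← MvPowerSeries.one_le_order_iff_constCoeff_eq_zero] at hg
  rw [← mul_sub, order_mul, Nat.cast_add (N + 1) 1, add_comm]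
  exact add_le_add hg h

/-- The `N`-jets, in coordinates, of the members of the ideal generated by a family. -/
def jetSpan {m : ℕ} {ι : Type*} (N : ℕ) (F : ι → MvPowerSeries (Fin m) ℂ) :
    Submodule ℂ (JetIndex m N → ℂ) :=
  ((Ideal.span (Set.range F)).restrictScalars ℂ).map (coords m N)

theorem mem_jetSpan {m : ℕ} {ι : Type*} {N : ℕ} {F : ι → MvPowerSeries (Fin m) ℂ}
    {v : JetIndex m N → ℂ} : v ∈ jetSpan N F ↔ ∃ f ∈ Ideal.span (Set.range F), coords m N f = v :=
  Iff.rfl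

/-- The dimension of the space of `N`-jets of the members of the ideal. -/
def jetRank {m : ℕ} {ι : Type*} (N : ℕ) (F : ι → MvPowerSeries (Fin m) ℂ) : ℕ :=
  Module.finrank ℂ (jetSpan N F)

theorem rank_map_jet {m N : ℕ} (W : Submodule ℂ (MvPowerSeries (Fin m) ℂ)) :
    Module.rank ℂ (W.map (jet N)) = Module.finrank ℂ (W.map (coords m N)) := by
  have h : W.map (jet N) = (W.map (coords m N)).map (ofCoords m N) := by
    rw [← Submodule.map_comp]
    congr 1
    exact LinearMap.ext fun f => (ofCoords_coords f).symm
  rw [h, ← LinearEquiv.rank_eq (Submodule.equivMapOfInjective _ (ofCoords_injective m N) _),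
    Module.finrank_eq_rank]

/-- Truncating cofactors at degree `d` does not change the (d+1)-jets, so polynomial cofactors reach
the jets of the whole ideal. -/
theorem range_macaulayMap {m k : ℕ} {F : Fin k → MvPowerSeries (Fin m) ℂ}
    (hF : ∀ ℓ, MvPowerSeries.constantCoeff (F ℓ) = 0) (d : ℕ) :
    LinearMap.range (macaulayMap F d) =
      ((Ideal.span (Set.range F)).restrictScalars ℂ).map (jet (d + 1)) := by
  refine le_antisymm ?_ ?_
  · rintro _ ⟨h, rfl⟩
    refine ⟨∑ ℓ, F ℓ * ((h ℓ).1 : MvPowerSeries (Fin m) ℂ), ?_, rfl⟩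
    exact Ideal.sum_mem _ fun ℓ _ => Ideal.mul_mem_right _ _ (Ideal.subset_span ⟨ℓ, rfl⟩)
  · rintro _ ⟨f, hf, rfl⟩
    obtain ⟨h, rfl⟩ := (Ideal.mem_span_range_iff_exists_fun (R := MvPowerSeries (Fin m) ℂ)).1 hf
    refine ⟨fun ℓ => ⟨ofCoords m d (coords m d (h ℓ)), ofCoords_mem _ _ _⟩, ?_⟩
    change jet (d + 1) (∑ ℓ, F ℓ * (ofCoords m d (coords m d (h ℓ)) : MvPowerSeries (Fin m) ℂ)) = _
    rw [← ofCoords_coords, ← ofCoords_coords]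
    refine congrArg _ ?_
    rw [map_sum, map_sum]
    refine Finset.sum_congr rfl fun ℓ _ => ?_
    rw [mul_comm (h ℓ), ← serOfCoords_apply]
    exact coords_succ_mul_congr (hF ℓ) (coords_serOfCoords _)

theorem rank_macaulayMap {m k : ℕ} {F : Fin k → MvPowerSeries (Fin m) ℂ}
    (hF : ∀ ℓ, MvPowerSeries.constantCoeff (F ℓ) = 0) (d : ℕ) :
    (macaulayMap F d).rank = jetRank (d + 1) F := by
  rw [LinearMap.rank, range_macaulayMap hF, rank_map_jet]
  rfl

/-- The (d+1)-jet of g u depends linearly on the d-jet of u alone. -/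
theorem jetRank_le_of_dvd {m : ℕ} {ι : Type*} {F : ι → MvPowerSeries (Fin m) ℂ}
    {g : MvPowerSeries (Fin m) ℂ} (hg : MvPowerSeries.constantCoeff g = 0) (h : ∀ i, g ∣ F i)
    (d : ℕ) : jetRank (d + 1) F ≤ (m + d).choose d := by
  let T : (JetIndex m d → ℂ) →ₗ[ℂ] (JetIndex m (d + 1) → ℂ) :=
    (coords m (d + 1)).comp ((LinearMap.mulLeft ℂ g).comp (serOfCoords m d))
  have hle : jetSpan (d + 1) F ≤ LinearMap.range T := by
    rintro _ ⟨f, hf, rfl⟩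
    have hspan : Ideal.span (Set.range F) ≤ Ideal.span {g} := by
      rw [Ideal.span_le]
      rintro _ ⟨i, rfl⟩
      exact Ideal.mem_span_singleton.2 (h i)
    obtain ⟨u, rfl⟩ := Ideal.mem_span_singleton.1 (hspan hf)
    exact ⟨coords m d u, coords_succ_mul_congr hg (coords_serOfCoords _)⟩
  calc jetRank (d + 1) F ≤ Module.finrank ℂ (LinearMap.range T) := Submodule.finrank_mono hle
    _ ≤ Module.finrank ℂ (JetIndex m d → ℂ) := LinearMap.finrank_range_le T
    _ = (m + d).choose d := by rw [Module.finrank_fintype_fun_eq_card, card_jetIndex]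

/-! ### Jets of coprime families -/

theorem coords_lift_mul_congr {m N : ℕ} {u v : MvPowerSeries (Fin m) ℂ} (j : ℕ)
    (h : coords m N u = coords m N v) :
    coords (m + 1) N (lift m u * MvPowerSeries.X 0 ^ j) =
      coords (m + 1) N (lift m v * MvPowerSeries.X 0 ^ j) := by
  funext n
  rw [coords_apply, coords_apply, coeff_lift_mul_X_pow, coeff_lift_mul_X_pow]
  split_ifs
  · exact congrFun h ⟨n.1.tail, (tailDegree_le n.1).trans n.2⟩
  · rfl

/-- By division every jet is, modulo the ideal, given by `ν` jets in the other variables, and those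
divisible by `s` give 0. So the codimension is at most ν times the dimension of N-jets minus that of
(N-e)-jets; the statement avoids the subtraction. -/
theorem le_jetRank_add {m ν e N : ℕ} {ι : Type*} {F : ι → MvPowerSeries (Fin (m + 1)) ℂ} {i₀ : ι}
    (hF : IsRegularOfOrder ν (F i₀)) {s : MvPowerSeries (Fin m) ℂ} (hs : s.order = e)
    (hmem : lift m s ∈ Ideal.span (Set.range F)) (hN : e ≤ N) :
    (m + 1 + N).choose N + ν * (m + (N - e)).choose (N - e) ≤
      jetRank N F + ν * (m + N).choose N := by
  let P : (Fin ν → JetIndex m N → ℂ) →ₗ[ℂ] (JetIndex (m + 1) N → ℂ) :=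
    ∑ j : Fin ν, (coords (m + 1) N).comp ((LinearMap.mulRight ℂ (MvPowerSeries.X 0 ^ (j : ℕ))).comp
      ((lift m).toLinearMap.comp ((serOfCoords m N).comp (LinearMap.proj j))))
  have hP : ∀ r : Fin ν → MvPowerSeries (Fin m) ℂ, P (fun j => coords m N (r j)) =
      coords (m + 1) N (∑ j : Fin ν, lift m (r j) * MvPowerSeries.X 0 ^ (j : ℕ)) := by
    intro r
    rw [map_sum, LinearMap.sum_apply]
    exact Finset.sum_congr rfl fun j _ => coords_lift_mul_congr j (coords_serOfCoords _)
  let Ψ : (Fin ν → JetIndex m N → ℂ) × jetSpan N F →ₗ[ℂ] (JetIndex (m + 1) N → ℂ) :=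
    P.coprod (jetSpan N F).subtype
  have hsurj : LinearMap.range Ψ = ⊤ := by
    rw [LinearMap.range_eq_top]
    intro v
    obtain ⟨q, hq, -⟩ := exists_quotient hF (serOfCoords (m + 1) N v)
    have h1 := low_add_X_pow_mul_high ν (serOfCoords (m + 1) N v - q * F i₀)
    rw [hq, mul_zero, add_zero, low_eq_sum] at h1
    refine ⟨(fun j => coords m N (slice j (serOfCoords (m + 1) N v - q * F i₀)),
      ⟨coords (m + 1) N (q * F i₀), mem_jetSpan.2 ⟨_, Ideal.mul_mem_left _ _
        (Ideal.subset_span ⟨i₀, rfl⟩), rfl⟩⟩), ?_⟩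
    rw [LinearMap.coprod_apply, hP, h1, Submodule.subtype_apply, ← map_add, sub_add_cancel,
      coords_serOfCoords]
  -- Multiplication by `s`, of order `e`, is injective from (N-e)-jets to N-jets.
  let S : (Fin ν → JetIndex m (N - e) → ℂ) →ₗ[ℂ] (Fin ν → JetIndex m N → ℂ) :=
    LinearMap.pi fun j => (coords m N).comp ((LinearMap.mulLeft ℂ s).comp
      ((serOfCoords m (N - e)).comp (LinearMap.proj j)))
  have hS : Function.Injective S := by
    rw [← LinearMap.ker_eq_bot, LinearMap.ker_eq_bot']
    intro w hw
    funext j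
    have h1 : coords m N (s * serOfCoords m (N - e) (w j)) = 0 := congrFun hw j
    rw [coords_eq_zero_iff, order_mul, hs] at h1
    rw [← coords_serOfCoords (w j)]
    change coords m (N - e) _ = 0
    rw [coords_eq_zero_iff]
    refine (ENat.add_le_add_iff_left (ENat.natCast_ne_top e)).1 (le_trans ?_ h1)
    rw [← Nat.cast_add]
    exact Nat.cast_le.2 (by omega)
  have hPS : ∀ w, P (S w) ∈ jetSpan N F := by
    intro w
    have : P (S w) = coords (m + 1) N (∑ j : Fin ν,
        lift m (s * serOfCoords m (N - e) (w j)) * MvPowerSeries.X 0 ^ (j : ℕ)) :=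
      hP fun j => s * serOfCoords m (N - e) (w j)
    rw [this]
    refine ⟨_, Ideal.sum_mem _ fun j _ => ?_, rfl⟩
    rw [map_mul, mul_assoc]
    exact Ideal.mul_mem_right _ _ hmem
  -- Multiples of `s` give an embedded space of relations in the kernel of `Ψ`; rank-nullity
  -- finishes the count.
  let K : (Fin ν → JetIndex m (N - e) → ℂ) →ₗ[ℂ] (Fin ν → JetIndex m N → ℂ) × jetSpan N F :=
    S.prod (-(P.comp S).codRestrict (jetSpan N F) hPS)
  have hK : ∀ w, K w ∈ LinearMap.ker Ψ := by
    intro w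
    rw [LinearMap.mem_ker]
    change P (S w) + -P (S w) = 0
    exact add_neg_cancel _
  have hKinj : Function.Injective (K.codRestrict (LinearMap.ker Ψ) hK) := by
    intro a b hab
    exact hS (congrArg (fun x => x.1.1) hab)
  have h1 := LinearMap.finrank_le_finrank_of_injective hKinj
  have h2 := LinearMap.finrank_range_add_finrank_ker Ψ
  rw [hsurj, finrank_top, Module.finrank_prod, Module.finrank_fintype_fun_eq_card,
    Module.finrank_pi_fintype, Finset.sum_const, Finset.card_univ, Fintype.card_fin,
    Module.finrank_fintype_fun_eq_card, card_jetIndex, card_jetIndex, smul_eq_mul] at h2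
  rw [Module.finrank_pi_fintype, Finset.sum_const, Finset.card_univ, Fintype.card_fin,
    Module.finrank_fintype_fun_eq_card, card_jetIndex, smul_eq_mul] at h1
  change _ + _ ≤ Module.finrank ℂ (jetSpan N F) + _
  omega

theorem choose_le_choose_sub_add (p a e : ℕ) :
    (a + e).choose (p + 1) ≤ a.choose (p + 1) + e * (a + e - 1).choose p := by
  induction e with
  | zero => simp
  | succ e ih =>
    rw [← add_assoc, Nat.choose_succ_succ' (a + e) p, Nat.add_sub_cancel]
    have h : (a + e - 1).choose p ≤ (a + e).choose p := Nat.choose_le_choose p (Nat.sub_le _ _)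
    have h' := Nat.mul_le_mul_left e h
    rw [Nat.succ_mul]
    omega

/-- A multiple of the growth of a binomial coefficient is eventually less than it. -/
theorem exists_mul_choose_lt (p ν e : ℕ) : ∃ N, e ≤ N ∧ 1 ≤ N ∧
    ν * (p + 1 + N).choose N < (p + 1 + N).choose N + ν * (p + 1 + (N - e)).choose (N - e) := by
  -- The difference to be beaten is at most ν e binom(p+N, p), and (p+1) binom(p+1+N, p+1) = (p+1+N)
  -- binom(p+N, p). Hence N ≥ ν e (p+1) suffices; the other summands secure `e ≤ N` and `1 ≤ N`.
  refine ⟨ν * e * (p + 1) + e + 1, by omega, by omega, ?_⟩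
  set N := ν * e * (p + 1) + e + 1 with hN
  have h1 := choose_le_choose_sub_add p (p + 1 + (N - e)) e
  rw [show p + 1 + (N - e) + e = p + 1 + N by omega, show p + 1 + N - 1 = p + N by omega] at h1
  rw [← Nat.choose_symm_add (a := p + 1) (b := N), ← Nat.choose_symm_add (a := p + 1) (b := N - e)]
  have h2 : (p + N + 1) * (p + N).choose p = (p + N + 1).choose (p + 1) * (p + 1) :=
    Nat.add_one_mul_choose_eq _ _
  rw [show p + N + 1 = p + 1 + N by omega] at h2
  have h3 : 0 < (p + N).choose p := Nat.choose_pos (Nat.le_add_right _ _)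
  have h4 : ν * e * (p + N).choose p < (p + 1 + N).choose (p + 1) := by
    refine lt_of_mul_lt_mul_right ?_ (Nat.zero_le (p + 1))
    rw [← h2, mul_right_comm]
    exact Nat.mul_lt_mul_of_pos_right (by omega) h3
  have h5 := Nat.mul_le_mul_left ν h1
  rw [mul_add, ← mul_assoc] at h5
  omega

/-- For suitable N = d + 1 the codimension is less than binom(m+1+N, N), and Pascal's rule turns
this into the bound on the rank. -/
theorem exists_lt_jetRank {m ν : ℕ} {ι : Type*} {F : ι → MvPowerSeries (Fin (m + 2)) ℂ} {i₀ : ι}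
    (hF : IsRegularOfOrder ν (F i₀)) {s : MvPowerSeries (Fin (m + 1)) ℂ} (hs : s ≠ 0)
    (hmem : lift (m + 1) s ∈ Ideal.span (Set.range F)) :
    ∃ d, (m + 2 + d).choose d < jetRank (d + 1) F := by
  obtain ⟨N, hN, hN1, hlt⟩ := exists_mul_choose_lt m ν s.order.toNat
  have h1 := le_jetRank_add hF (MvPowerSeries.ne_zero_iff_order_finite.1 hs).symm hmem hN
  refine ⟨N - 1, ?_⟩
  rw [Nat.sub_add_cancel hN1]
  have h2 : (m + 1 + 1 + N).choose N = (m + 1 + N).choose N + (m + 2 + (N - 1)).choose (N - 1) := by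
    obtain ⟨M, rfl⟩ := Nat.exists_eq_add_of_le' hN1
    rw [show m + 1 + 1 + (M + 1) = (m + 1 + (M + 1)) + 1 by omega, Nat.choose_succ_succ', add_comm,
      Nat.add_sub_cancel, show m + 2 + M = m + 1 + (M + 1) by omega]
  omega

theorem jetRank_shear_le {m N : ℕ} {ι : Type*} (F : ι → MvPowerSeries (Fin (m + 1)) ℂ)
    {c : Fin (m + 1) → ℂ} (hc : c 0 ≠ 0) : jetRank N (fun i => shear c (F i)) ≤ jetRank N F := by
  let T : (JetIndex (m + 1) N → ℂ) →ₗ[ℂ] (JetIndex (m + 1) N → ℂ) :=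
    (coords (m + 1) N).comp ((shear c).toLinearMap.comp (serOfCoords (m + 1) N))
  have hT : ∀ f, T (coords (m + 1) N f) = coords (m + 1) N (shear c f) := by
    intro f
    change coords (m + 1) N (shear c _) = _
    rw [coords_eq_iff, ← map_sub]
    refine le_trans ?_ (le_order_shear c _)
    rw [← coords_eq_iff, coords_serOfCoords]
  have hle : jetSpan N (fun i => shear c (F i)) ≤ (jetSpan N F).map T := by
    rintro _ ⟨f, hf, rfl⟩
    have h1 : (Ideal.span (Set.range fun i => shear c (F i))).map (shear (shearInv c)) ≤
        Ideal.span (Set.range F) := by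
      rw [Ideal.map_span, Ideal.span_le]
      rintro _ ⟨_, ⟨i, rfl⟩, rfl⟩
      rw [shear_shearInv hc]
      exact Ideal.subset_span ⟨i, rfl⟩
    refine ⟨_, ⟨_, h1 (Ideal.mem_map_of_mem _ hf), rfl⟩, ?_⟩
    rw [hT, shear_shearInv' hc]
  exact (Submodule.finrank_mono hle).trans (Submodule.finrank_map_le T _)

/-- Families with a common divisor without constant term, in terms of the dimensions of the
spaces of jets. -/
theorem IsWeierstrassFamily.exists_dvd_iff {O : ∀ m, Subalgebra ℂ (MvPowerSeries (Fin m) ℂ)}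
    (hO : IsWeierstrassFamily O) {m : ℕ} {ι : Type*} (F : ι → Member O (m + 2)) :
    (∃ g, Member.constCoeff g = 0 ∧ ∀ i, g ∣ F i) ↔
      ∀ d, jetRank (d + 1) (fun i => (F i).ser) ≤ (m + 2 + d).choose d := by
  constructor
  · rintro ⟨g, hg, h⟩ d
    exact jetRank_le_of_dvd hg (fun i => map_dvd Member.ser (h i)) d
  · intro h
    by_cases h0 : ∃ i₀, F i₀ ≠ 0
    · obtain ⟨i₀, hi₀⟩ := h0
      have := hO.isIntegrallyClosed (m + 1)
      refine (hO.exists_dvd_or_shear_mem F i₀ hi₀).resolve_right ?_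
      rintro ⟨c, hc, ⟨ν, hν⟩, s, hs, hmem⟩
      have h1 := Ideal.mem_map_of_mem Member.ser hmem
      rw [Ideal.map_span, ← Set.range_comp] at h1
      obtain ⟨d, hd⟩ := exists_lt_jetRank (F := fun i => shear c (F i).ser) (i₀ := i₀) hν
        ((map_ne_zero_iff _ Member.ser_injective).2 hs) h1
      exact absurd (h d) (not_le.2 (hd.trans_le (jetRank_shear_le _ hc)))
    · push Not at h0
      refine ⟨hO.firstVar (m + 1), ?_, fun i => (h0 i).symm ▸ dvd_zero _⟩
      exact MvPowerSeries.constantCoeff_X 0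

/-! ### Rank and minors -/

theorem exists_linearIndependent_col {ι κ : Type*} [Fintype ι] [Fintype κ]
    (A : Matrix ι κ ℂ) {t : ℕ} (ht : t ≤ A.rank) :
    ∃ c : Fin t → κ, LinearIndependent ℂ (A.submatrix id c).col := by
  obtain ⟨κ', a, ha, hspan, hli⟩ := exists_linearIndependent' ℂ A.col
  have : Fintype κ' := Fintype.ofInjective a ha
  rw [Matrix.rank_eq_finrank_span_cols, ← hspan, finrank_span_eq_card hli] at ht
  obtain ⟨e⟩ : Nonempty (Fin t ↪ κ') := Function.Embedding.nonempty_of_card_le (by simpa using ht)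
  exact ⟨fun i => a (e i), hli.comp e e.injective⟩

/-- Rank above s gives s + 1 independent columns, and among their rows s + 1 independent ones.
Repetitions in `r` and `c` only add determinants that are zero anyway. -/
theorem rank_le_iff_forall_det_eq_zero {ι κ : Type*} [Fintype ι] [Fintype κ]
    (A : Matrix ι κ ℂ) (s : ℕ) :
    A.rank ≤ s ↔ ∀ (r : Fin (s + 1) → ι) (c : Fin (s + 1) → κ), (A.submatrix r c).det = 0 := by
  constructor
  · intro h r c
    by_contra hdet
    have h1 := Matrix.rank_of_isUnit _
      ((Matrix.isUnit_iff_isUnit_det (A.submatrix r c)).2 (Ne.isUnit hdet))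
    have h2 := Matrix.rank_submatrix_le A r c
    rw [h1, Fintype.card_fin] at h2
    omega
  · intro h
    by_contra hlt
    obtain ⟨c, hc⟩ := exists_linearIndependent_col A (not_le.1 hlt)
    have h1 : (A.submatrix id c).transpose.rank = s + 1 := by
      rw [LinearIndependent.rank_matrix (M := (A.submatrix id c).transpose) hc, Fintype.card_fin]
    obtain ⟨r, hr⟩ := exists_linearIndependent_col (A.submatrix id c).transpose h1.ge
    have h2 : IsUnit (A.submatrix r c) := Matrix.linearIndependent_rows_iff_isUnit.1 hr
    exact not_isUnit_zero (h r c ▸ (Matrix.isUnit_iff_isUnit_det _).1 h2)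

/-- The matrix whose columns are the jets of the products of the members of a family with the
monomials of bounded degree. -/
def jetMatrix {m k : ℕ} (N D : ℕ) (F : Fin k → MvPowerSeries (Fin m) ℂ) :
    Matrix (JetIndex m N) (Fin k × JetIndex m D) ℂ :=
  fun q x => coords m N (F x.1 * MvPowerSeries.monomial x.2.1 1) q

theorem jetMatrix_apply {m k N D : ℕ} (F : Fin k → MvPowerSeries (Fin m) ℂ) (q : JetIndex m N)
    (x : Fin k × JetIndex m D) : jetMatrix N D F q x = open Classical in
      if x.2.1 ≤ q.1 then MvPowerSeries.coeff (q.1 - x.2.1) (F x.1) else 0 := by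
  rw [jetMatrix, coords_apply, MvPowerSeries.coeff_mul_monomial, mul_one]

theorem serOfCoords_eq_sum {m N : ℕ} (v : JetIndex m N → ℂ) :
    serOfCoords m N v = ∑ n : JetIndex m N, v n • MvPowerSeries.monomial n.1 1 := by
  classical
  ext n
  rw [serOfCoords_apply, MvPolynomial.coeff_coe, coeff_ofCoords, map_sum]
  simp only [map_smul, MvPowerSeries.coeff_monomial, smul_eq_mul, mul_ite, mul_one, mul_zero]
  split_ifs with h
  · rw [Finset.sum_eq_single ⟨n, h⟩ (fun b _ hb => if_neg fun hbn => hb (Subtype.ext hbn.symm))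
      (fun hn => absurd (Finset.mem_univ _) hn)]
    exact (if_pos rfl).symm
  · exact (Finset.sum_eq_zero fun b _ => if_neg fun hb : n = b.1 => h (hb ▸ b.2)).symm

/-- The hypothesis says that cofactors may be truncated at degree `D`: always true for D = N, and
for D = N - 1 in the absence of constant terms. -/
theorem rank_jetMatrix {m k N D : ℕ} {F : Fin k → MvPowerSeries (Fin m) ℂ}
    (hF : ∀ ℓ u v, coords m D u = coords m D v → coords m N (F ℓ * u) = coords m N (F ℓ * v)) :
    (jetMatrix N D F).rank = jetRank N F := by
  suffices h : Submodule.span ℂ (Set.range (jetMatrix N D F).col) = jetSpan N F by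
    rw [Matrix.rank_eq_finrank_span_cols, jetRank, h]
  refine le_antisymm ?_ ?_
  · rw [Submodule.span_le]
    rintro _ ⟨x, rfl⟩
    exact ⟨_, Ideal.mul_mem_right _ _ (Ideal.subset_span ⟨x.1, rfl⟩), rfl⟩
  · rintro _ ⟨f, hf, rfl⟩
    obtain ⟨h, rfl⟩ := (Ideal.mem_span_range_iff_exists_fun (R := MvPowerSeries (Fin m) ℂ)).1 hf
    rw [map_sum]
    refine Submodule.sum_mem _ fun ℓ _ => ?_
    rw [mul_comm, ← hF ℓ _ _ (coords_serOfCoords (coords m D (h ℓ))), serOfCoords_eq_sum,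
      Finset.mul_sum, map_sum]
    refine Submodule.sum_mem _ fun p _ => ?_
    rw [mul_smul_comm, map_smul]
    exact Submodule.smul_mem _ _ (Submodule.subset_span ⟨(ℓ, p), rfl⟩)

theorem jetRank_succ_le_iff_macaulayMatrix {m k : ℕ} {F : Fin k → MvPowerSeries (Fin m) ℂ}
    (hF : ∀ ℓ, MvPowerSeries.constantCoeff (F ℓ) = 0) (d s : ℕ) :
    jetRank (d + 1) F ≤ s ↔ ∀ (r : Fin (s + 1) → {q : Fin m →₀ ℕ // 0 < q.degree ∧ q.degree ≤ d + 1})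
      (c : Fin (s + 1) → Fin k × {p : Fin m →₀ ℕ // p.degree ≤ d}),
      ((macaulayMatrix F d).submatrix r c).det = 0 := by
  rw [← rank_jetMatrix (D := d) fun ℓ u v h => coords_succ_mul_congr (hF ℓ) h,
    rank_le_iff_forall_det_eq_zero]
  have hsub : ∀ (r : Fin (s + 1) → {q : Fin m →₀ ℕ // 0 < q.degree ∧ q.degree ≤ d + 1})
      (c : Fin (s + 1) → Fin k × {p : Fin m →₀ ℕ // p.degree ≤ d}),
      (macaulayMatrix F d).submatrix r c =
        (jetMatrix (d + 1) d F).submatrix (fun i => ⟨(r i).1, (r i).2.2⟩) c := by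
    intro r c
    ext i j
    exact (jetMatrix_apply (N := d + 1) F ⟨(r i).1, (r i).2.2⟩ (c j)).symm
  refine ⟨fun h r c => hsub r c ▸ h _ _, fun h r c => ?_⟩
  by_cases hr : ∀ i, 0 < (r i).1.degree
  · have h1 := h (fun i => ⟨(r i).1, hr i, (r i).2⟩) c
    rw [hsub] at h1
    exact h1
  -- The row of the zero multi-index, absent from `macaulayMatrix`, vanishes because there are no
  -- constant terms.
  · push Not at hr
    obtain ⟨i, hi⟩ := hr
    refine Matrix.det_eq_zero_of_row_eq_zero i fun j => ?_
    have h0 : (r i).1 = 0 := (Finsupp.degree_eq_zero_iff _).1 (Nat.le_zero.1 hi)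
    rw [Matrix.submatrix_apply, jetMatrix, coords_apply, h0,
      MvPowerSeries.coeff_zero_eq_constantCoeff_apply, map_mul, hF, zero_mul]

/-! ### Conditions that are algebraic in jets -/

/-- The minors of `jetMatrix` are polynomials in the coefficients. Cofactors are taken up to degree
N, not N - 1, since the germs may have constant terms here. -/
theorem isAlgebraicInJets_of_jetRank {m k : ℕ} (s : ℕ → ℕ) :
    IsAlgebraicInJets {F : Fin k → germ m |
      ∀ N, jetRank N (fun ℓ => (F ℓ : MvPowerSeries (Fin m) ℂ)) ≤ s N} := by
  classical
  let P : ∀ N, Matrix (JetIndex m N) (Fin k × JetIndex m N)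
      (MvPolynomial (Fin k × JetIndex m N) ℂ) := fun N q x =>
    if x.2.1 ≤ q.1 then MvPolynomial.X (x.1, ⟨q.1 - x.2.1,
      ((Finsupp.degree_mono tsub_le_self).trans q.2)⟩) else 0
  let I : ℕ → Type := fun N =>
    (Fin (s N + 1) → JetIndex m N) × (Fin (s N + 1) → Fin k × JetIndex m N)
  refine ⟨fun N => Fintype.card (I N), fun N i =>
    ((P N).submatrix ((Fintype.equivFin (I N)).symm i).1 ((Fintype.equivFin (I N)).symm i).2).det, ?_⟩
  ext F
  simp only [Set.mem_iInter, Set.mem_ofPred_eq]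
  refine forall_congr' fun N => ?_
  have heval : ∀ j : I N, MvPolynomial.eval (fun x : Fin k × JetIndex m N =>
      MvPowerSeries.coeff x.2.1 (F x.1 : MvPowerSeries (Fin m) ℂ)) ((P N).submatrix j.1 j.2).det =
      ((jetMatrix N N fun ℓ => (F ℓ : MvPowerSeries (Fin m) ℂ)).submatrix j.1 j.2).det := by
    intro j
    rw [RingHom.map_det]
    congr 1
    ext a b
    rw [RingHom.mapMatrix_apply, Matrix.map_apply, Matrix.submatrix_apply, Matrix.submatrix_apply,
      jetMatrix_apply]
    simp only [P]
    split_ifs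
    · rw [MvPolynomial.eval_X]
    · rw [map_zero]
  rw [← rank_jetMatrix (D := N) fun ℓ u v h => coords_mul_congr _ h, rank_le_iff_forall_det_eq_zero]
  constructor
  · intro h i
    rw [heval]
    exact h _ _
  · intro h r c
    have h1 := h (Fintype.equivFin (I N) (r, c))
    rw [heval, Equiv.symm_apply_apply] at h1
    exact h1

/-! ### Polynomials in continuous linear functionals -/

section PolynomialFunctions

variable {E : Type*} [AddCommGroup E] [Module ℂ E] [TopologicalSpace E]

/-- The symmetric form obtained by averaging a product of linear functionals. -/
def symmetricProduct {p : ℕ} (l : Fin p → E →L[ℂ] ℂ) :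
    ContinuousMultilinearMap ℂ (fun _ : Fin p => E) ℂ :=
  ((p.factorial : ℂ)⁻¹) • ∑ σ : Equiv.Perm (Fin p),
    (ContinuousMultilinearMap.mkPiAlgebra ℂ (Fin p) ℂ).compContinuousLinearMap fun i => l (σ i)

theorem symmetricProduct_apply {p : ℕ} (l : Fin p → E →L[ℂ] ℂ) (v : Fin p → E) :
    symmetricProduct l v =
      (p.factorial : ℂ)⁻¹ * ∑ σ : Equiv.Perm (Fin p), ∏ i, l (σ i) (v i) := by
  rw [symmetricProduct, smul_apply, sum_apply,
    smul_eq_mul]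
  rfl

theorem symmetricProduct_perm {p : ℕ} (l : Fin p → E →L[ℂ] ℂ) (τ : Equiv.Perm (Fin p))
    (v : Fin p → E) : symmetricProduct l (fun i => v (τ i)) = symmetricProduct l v := by
  rw [symmetricProduct_apply, symmetricProduct_apply]
  congr 1
  refine Fintype.sum_equiv (Equiv.mulRight τ⁻¹) _ _ fun σ => ?_
  refine Fintype.prod_equiv τ _ _ fun i => ?_
  simp

theorem symmetricProduct_diagonal {p : ℕ} (l : Fin p → E →L[ℂ] ℂ) (h : E) :
    symmetricProduct l (fun _ => h) = ∏ i, l i h := by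
  rw [symmetricProduct_apply]
  have : ∀ σ : Equiv.Perm (Fin p), ∏ i, l (σ i) h = ∏ i, l i h := fun σ =>
    Equiv.prod_comp σ fun i => l i h
  simp_rw [this]
  rw [Finset.sum_const, Finset.card_univ, Fintype.card_perm, Fintype.card_fin, nsmul_eq_mul,
    inv_mul_cancel_left₀ (Nat.cast_ne_zero.2 p.factorial_ne_zero)]

/-- A function is a finite sum of symmetric forms evaluated on the diagonal. -/
def IsFormSum (Λ : E → ℂ) : Prop :=
  ∃ P : (p : ℕ) → ContinuousMultilinearMap ℂ (fun _ : Fin p => E) ℂ,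
    (∀ (p : ℕ) (σ : Equiv.Perm (Fin p)) (v : Fin p → E), P p (fun i => v (σ i)) = P p v) ∧
    ∃ D, ∀ N ≥ D, ∀ h, ∑ p ∈ Finset.range (N + 1), P p (fun _ => h) = Λ h

theorem isFormSum_prod {p : ℕ} (l : Fin p → E →L[ℂ] ℂ) : IsFormSum fun h => ∏ i, l i h := by
  classical
  refine ⟨fun q => if h : p = q then h ▸ symmetricProduct l else 0, fun q σ v => ?_, p,
    fun N hN h => ?_⟩
  · beta_reduce
    split_ifs with hq
    · subst hq
      exact symmetricProduct_perm l σ v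
    · rfl
  · rw [Finset.sum_eq_single p]
    · beta_reduce
      rw [dif_pos rfl]
      exact symmetricProduct_diagonal l h
    · intro q _ hq
      beta_reduce
      rw [dif_neg hq.symm]
      rfl
    · exact fun hp => absurd (Finset.mem_range.2 (Nat.lt_succ_of_le hN)) hp

theorem IsFormSum.add {Λ Γ : E → ℂ} (hΛ : IsFormSum Λ) (hΓ : IsFormSum Γ) : IsFormSum (Λ + Γ) := by
  obtain ⟨P, hP, D, hD⟩ := hΛ
  obtain ⟨Q, hQ, D', hD'⟩ := hΓ
  refine ⟨fun p => P p + Q p, fun p σ v => ?_, max D D', fun N hN h => ?_⟩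
  · simp only [add_apply, hP, hQ]
  · simp only [add_apply, Finset.sum_add_distrib, Pi.add_apply]
    rw [hD N ((le_max_left _ _).trans hN), hD' N ((le_max_right _ _).trans hN)]

theorem IsFormSum.smul {Λ : E → ℂ} (hΛ : IsFormSum Λ) (c : ℂ) : IsFormSum (c • Λ) := by
  obtain ⟨P, hP, D, hD⟩ := hΛ
  refine ⟨fun p => c • P p, fun p σ v => ?_, D, fun N hN h => ?_⟩
  · simp only [smul_apply, hP]
  · simp only [smul_apply, Pi.smul_apply]
    rw [← Finset.smul_sum, hD N hN]

theorem isFormSum_zero : IsFormSum (0 : E → ℂ) :=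
  ⟨fun _ => 0, fun _ _ _ => rfl, 0, fun _ _ _ => Finset.sum_eq_zero fun _ _ => rfl⟩

/-- The algebra is spanned by finite products of functionals, each the diagonal of one symmetrized
form. -/
theorem isFormSum_of_mem_adjoin {Λ : E → ℂ}
    (h : Λ ∈ Algebra.adjoin ℂ (Set.range fun (l : E →L[ℂ] ℂ) (x : E) => l x)) : IsFormSum Λ := by
  rw [← Subalgebra.mem_toSubmodule, Algebra.adjoin_eq_span] at h
  induction h using Submodule.span_induction with
  | mem x hx =>
    obtain ⟨L, hL, rfl⟩ := Submonoid.exists_list_of_mem_closure hx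
    choose l hl using fun i : Fin L.length => hL _ (L.get_mem i)
    convert isFormSum_prod l using 1
    funext x
    rw [← Finset.prod_apply x Finset.univ (fun (i : Fin L.length) x => l i x)]
    simp only [hl]
    rw [← List.prod_ofFn, List.ofFn_get]
  | zero => exact isFormSum_zero
  | add x y _ _ hx hy => exact hx.add hy
  | smul a x _ hx => exact hx.smul a

/-- The Taylor expansion at `f` terminates, so its partial sums are eventually equal to the
function, uniformly on the whole space. -/
theorem isAnalyticAt_eval {ι : Type*} (L : ι → E →L[ℂ] ℂ) (Q : MvPolynomial ι ℂ) (f : E) :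
    IsAnalyticAt (fun g => MvPolynomial.eval (fun x => L x g) Q) f := by
  have hmem : (fun h => MvPolynomial.eval (fun x => L x (f + h)) Q) ∈
      Algebra.adjoin ℂ (Set.range fun (l : E →L[ℂ] ℂ) (x : E) => l x) := by
    induction Q using MvPolynomial.induction_on with
    | C a =>
      simp only [MvPolynomial.eval_C]
      exact Subalgebra.algebraMap_mem _ a
    | add p q hp hq =>
      simp only [map_add] at hp hq ⊢
      exact add_mem hp hq
    | mul_X p x hp =>
      simp only [map_mul, MvPolynomial.eval_X]
      refine mul_mem hp ?_
      simp only [map_add]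
      exact add_mem (Subalgebra.algebraMap_mem _ (L x f)) (Algebra.subset_adjoin ⟨L x, rfl⟩)
  obtain ⟨P, hP, D, hD⟩ := isFormSum_of_mem_adjoin hmem
  refine ⟨P, hP, Set.univ, univ_mem, ?_⟩
  rw [Metric.tendstoUniformlyOn_iff]
  intro ε hε
  filter_upwards [eventually_ge_atTop D] with N hN h _
  rw [hD N hN h, dist_self]
  exact hε

theorem isConnected_univ_of_continuous_smul (h : ∀ x : E, Continuous fun t : ℂ => t • x) :
    IsConnected (Set.univ : Set E) := by
  refine ⟨⟨0, trivial⟩, isPreconnected_of_forall 0 fun x _ => ?_⟩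
  refine ⟨Set.range fun t : ℂ => t • x, Set.subset_univ _, ⟨0, zero_smul _ _⟩, ⟨1, one_smul _ _⟩, ?_⟩
  exact isPreconnected_range (h x)

end PolynomialFunctions

/-! ### Sequential topologies -/

theorem withSeminorms_seqTopology {m : ℕ} (A : Set (FlatSeq m)) :
    @WithSeminorms ℂ (germ m) A _ _ _ (fun a : A => aNorm a.1) (seqTopology A) := by
  let p : SeminormFamily ℂ (germ m) A := fun a => aNorm a.1
  let : TopologicalSpace (germ m) := seqTopology A
  have : IsTopologicalAddGroup (germ m) := topologicalAddGroup_iInf fun a : A =>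
    letI := (aNorm a.1).toSeminormedAddCommGroup
    inferInstance
  exact (p.withSeminorms_iff_topologicalSpace_eq_iInf).2 rfl

theorem continuous_smul_seqMax {m : ℕ} (A : Set (FlatSeq m)) (f : SeqMax A) :
    Continuous fun t : ℂ => t • f := by
  let : TopologicalSpace (germ m) := seqTopology A
  have := (withSeminorms_seqTopology A).continuousSMul
  refine continuous_induced_rng.2 ?_
  exact (continuous_id.smul continuous_const : Continuous fun t : ℂ => t • (show germMax m from f).1)

/-- The coefficients, as continuous linear functionals. -/
def coeffCLM {m : ℕ} {A : Set (FlatSeq m)} (hA : A.Nonempty) (n : Fin m →₀ ℕ) :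
    SeqMax A →L[ℂ] ℂ where
  toFun f := MvPowerSeries.coeff n ((show germMax m from f).1 : MvPowerSeries (Fin m) ℂ)
  map_add' _ _ := rfl
  map_smul' _ _ := rfl
  cont := by
    obtain ⟨a, ha⟩ := hA
    let : TopologicalSpace (germ m) := seqTopology A
    let φ : germ m →ₗ[ℂ] ℂ := (MvPowerSeries.coeff n).comp (germ m).val.toLinearMap
    have hφ : Continuous φ := by
      -- One norm from `A` suffices, since a_n |f_n| ≤ ‖f‖_a.
      refine WithSeminorms.continuous_normedSpace_rng ℂ (withSeminorms_seqTopology A)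
        φ ⟨{⟨a, ha⟩}, ⟨(a.1 n)⁻¹, (inv_pos.2 (a.2.1 n)).le⟩, ?_⟩
      intro f
      have h1 : a.1 n * ‖MvPowerSeries.coeff n (f : MvPowerSeries (Fin m) ℂ)‖ ≤ aNorm a f :=
        (a.summable f).le_tsum n fun j _ => mul_nonneg (a.2.1 j).le (norm_nonneg _)
      rw [Finset.sup_singleton]
      change ‖MvPowerSeries.coeff n (f : MvPowerSeries (Fin m) ℂ)‖ ≤ (a.1 n)⁻¹ * aNorm a f
      rwa [le_inv_mul_iff₀ (a.2.1 n)]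
    exact hφ.comp continuous_induced_dom

section ProductSpace

variable {m k : ℕ} {A : Fin k → Set (FlatSeq m)}

theorem continuous_smul_seqMax_pi (F : (ℓ : Fin k) → SeqMax (A ℓ)) :
    Continuous fun t : ℂ => t • F :=
  continuous_pi fun ℓ => continuous_smul_seqMax (A ℓ) (F ℓ)

theorem IsAlgebraicInJets.isAnalyticSet {S : Set (Fin k → germ m)} (hS : IsAlgebraicInJets S)
    (hA : ∀ ℓ, (A ℓ).Nonempty) :
    IsAnalyticSet {F : (ℓ : Fin k) → SeqMax (A ℓ) | toGerms F ∈ S} := by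
  obtain ⟨D, Λ, rfl⟩ := hS
  let L : ∀ N, Fin k × JetIndex m N → ((ℓ : Fin k) → SeqMax (A ℓ)) →L[ℂ] ℂ := fun N x =>
    (coeffCLM (hA x.1) x.2.1).comp (ContinuousLinearMap.proj x.1)
  have hset : {F : (ℓ : Fin k) → SeqMax (A ℓ) | toGerms F ∈ ⋂ N : ℕ, {F | ∀ i : Fin (D N),
      MvPolynomial.eval (fun x => MvPowerSeries.coeff x.2.1 (F x.1 : MvPowerSeries (Fin m) ℂ))
        (Λ N i) = 0}} = {F | ∀ N i, MvPolynomial.eval (fun x => L N x F) (Λ N i) = 0} := by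
    ext F
    simp only [Set.mem_iInter, Set.mem_ofPred_eq]
    rfl
  rw [hset]
  refine ⟨?_, fun f hf => ⟨Set.univ, isOpen_univ,
    isConnected_univ_of_continuous_smul continuous_smul_seqMax_pi, trivial,
    {Γ | ∃ N i, Γ = fun F => MvPolynomial.eval (fun x => L N x F) (Λ N i)}, ?_, ?_⟩⟩
  · simp only [Set.ofPred_forall]
    refine isClosed_iInter fun N => isClosed_iInter fun i => isClosed_eq ?_ continuous_const
    exact (MvPolynomial.continuous_eval (Λ N i)).comp
      (continuous_pi fun x => (L N x).continuous)
  · rintro _ ⟨N, i, rfl⟩ f _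
    exact isAnalyticAt_eval (L N) (Λ N i) f
  · ext F
    simp only [Set.mem_inter_iff, Set.mem_univ, and_true, true_and, Set.mem_ofPred_eq]
    constructor
    · rintro h _ ⟨N, i, rfl⟩
      exact h N i
    · exact fun h N i => h _ ⟨N, i, rfl⟩

/-- Every neighbourhood of 0 contains some `t • F` with `t ≠ 0`, so `Ω` fills none of them. -/
theorem isProperAnalyticSet_of_smul_notMem {Ω : Set ((ℓ : Fin k) → SeqMax (A ℓ))}
    (hΩ : IsAnalyticSet Ω) (h0 : 0 ∈ Ω) (F : (ℓ : Fin k) → SeqMax (A ℓ))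
    (hF : ∀ t : ℂ, t ≠ 0 → t • F ∉ Ω) : IsProperAnalyticSet Ω := by
  refine ⟨hΩ, 0, h0, fun U hU _ h0U _ hΩU => ?_⟩
  have h1 : ∀ᶠ t : ℂ in 𝓝 0, t • F ∈ U :=
    (continuous_smul_seqMax_pi F).continuousAt.eventually_mem (hU.mem_nhds (by rwa [zero_smul]))
  obtain ⟨t, ht, ht0⟩ := ((h1.filter_mono nhdsWithin_le_nhds).and
    (self_mem_nhdsWithin (a := (0 : ℂ)) (s := {0}ᶜ))).exists
  exact hF t ht0 (hΩU.symm ▸ ht : t • F ∈ Ω ∩ U).1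

end ProductSpace

/-! ### The Milnor number -/

/-- The germs of order at least `j`. -/
def orderIdeal (m j : ℕ) : Ideal (germ m) where
  carrier := {f | (j : ℕ∞) ≤ (f : MvPowerSeries (Fin m) ℂ).order}
  zero_mem' := by
    change (j : ℕ∞) ≤ (0 : MvPowerSeries (Fin m) ℂ).order
    rw [MvPowerSeries.order_zero]
    exact le_top
  add_mem' {f g} hf hg := (le_min hf hg).trans MvPowerSeries.min_order_le_add
  smul_mem' c f hf := by
    change (j : ℕ∞) ≤ ((c : MvPowerSeries (Fin m) ℂ) * f).order
    rw [order_mul]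
    exact le_add_left hf

theorem mem_orderIdeal {m j : ℕ} {f : germ m} :
    f ∈ orderIdeal m j ↔ (j : ℕ∞) ≤ (f : MvPowerSeries (Fin m) ℂ).order := Iff.rfl

theorem orderIdeal_zero (m : ℕ) : orderIdeal m 0 = ⊤ := by
  rw [Ideal.eq_top_iff_one, mem_orderIdeal]
  exact_mod_cast zero_le

/-- The coordinates, as germs. -/
def coordinate {m : ℕ} (i : Fin m) : germ m :=
  ⟨MvPowerSeries.X i, MvPolynomial.coe_X (R := ℂ) i ▸ isConvergent_coe (MvPolynomial.X i)⟩

theorem coe_coordinate {m : ℕ} (i : Fin m) :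
    (coordinate i : MvPowerSeries (Fin m) ℂ) = MvPowerSeries.X i := rfl

/-- Each nonzero exponent is assigned one variable occurring in it; sorting the terms of `f` by this
choice and dividing gives the `u i`, whose coefficients are zero or among those of `f`, so they
converge. -/
theorem exists_eq_sum_coordinate_mul {m j : ℕ} {f : germ (m + 1)} (hf : f ∈ orderIdeal (m + 1) (j + 1)) :
    ∃ u : Fin (m + 1) → germ (m + 1), (∀ i, u i ∈ orderIdeal (m + 1) j) ∧
      f = ∑ i, coordinate i * u i := by
  classical
  have hex : ∀ n : Fin (m + 1) →₀ ℕ, ∃ i, n ≠ 0 → n i ≠ 0 := by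
    intro n
    by_cases hn : n = 0
    · exact ⟨0, fun h => absurd hn h⟩
    · obtain ⟨i, hi⟩ := Finsupp.ne_iff.1 hn
      exact ⟨i, fun _ => hi⟩
  choose c hc using hex
  let u : Fin (m + 1) → MvPowerSeries (Fin (m + 1)) ℂ := fun i n =>
    if c (n + Finsupp.single i 1) = i then MvPowerSeries.coeff (n + Finsupp.single i 1) f.1 else 0
  have hu : ∀ i n, MvPowerSeries.coeff n (u i) = if c (n + Finsupp.single i 1) = i then
      MvPowerSeries.coeff (n + Finsupp.single i 1) f.1 else 0 := fun _ _ => rfl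
  have hle : ∀ i n, ‖MvPowerSeries.coeff n (u i)‖ ≤
      ‖MvPowerSeries.coeff (n + Finsupp.single i 1) f.1‖ := by
    intro i n
    rw [hu]
    split_ifs
    · exact le_rfl
    · simp
  have hconv : ∀ i, IsConvergent (u i) := by
    intro i
    obtain ⟨r, hr, hsum⟩ := f.2
    refine ⟨r, hr, Summable.of_nonneg_of_le (fun n => by positivity) (fun n => ?_)
      ((hsum.comp_injective (add_left_injective (Finsupp.single i 1))).mul_right r⁻¹)⟩
    rw [Function.comp_apply, map_add, Finsupp.degree_single, pow_succ, ← mul_assoc, mul_assoc _ r,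
      mul_inv_cancel₀ hr.ne', mul_one]
    gcongr
    exact hle i n
  refine ⟨fun i => ⟨u i, hconv i⟩, fun i => ?_, Subtype.ext ?_⟩
  · refine MvPowerSeries.nat_le_order fun n hn => ?_
    rw [← norm_le_zero_iff]
    refine (hle i n).trans ?_
    rw [norm_le_zero_iff]
    refine MvPowerSeries.coeff_of_lt_order (lt_of_lt_of_le (Nat.cast_lt.2 ?_) hf)
    rw [map_add, Finsupp.degree_single]
    omega
  · rw [AddSubmonoidClass.coe_finsetSum]
    ext n
    rw [map_sum]
    simp only [MulMemClass.coe_mul, coe_coordinate, MvPowerSeries.X, MvPowerSeries.coeff_monomial_mul,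
      one_mul, hu]
    by_cases hn : n = 0
    · subst hn
      rw [Finset.sum_eq_zero]
      · refine MvPowerSeries.coeff_of_lt_order (lt_of_lt_of_le ?_ hf)
        rw [map_zero]
        exact Nat.cast_lt.2 (Nat.succ_pos j)
      · intro i _
        rw [if_neg]
        intro h
        have := h i
        simp at this
    · have hle : Finsupp.single (c n) 1 ≤ n := by
        rw [Finsupp.single_le_iff]
        exact Nat.one_le_iff_ne_zero.2 (hc n hn)
      rw [Finset.sum_eq_single (c n)]
      · rw [if_pos hle, tsub_add_cancel_of_le hle, if_pos rfl]
      · intro i _ hi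
        split_ifs with h1 h2
        · rw [tsub_add_cancel_of_le h1] at h2
          exact absurd h2.symm hi
        · rfl
        · rfl
      · exact fun h => absurd (Finset.mem_univ _) h

theorem orderIdeal_succ (m j : ℕ) : orderIdeal (m + 1) (j + 1) =
    Ideal.span (Set.range coordinate) * orderIdeal (m + 1) j := by
  refine le_antisymm ?_ ?_
  · intro f hf
    obtain ⟨u, hu, rfl⟩ := exists_eq_sum_coordinate_mul hf
    exact Ideal.sum_mem _ fun i _ => Ideal.mul_mem_mul (Ideal.subset_span ⟨i, rfl⟩) (hu i)
  · rw [Ideal.mul_le]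
    intro x hx f hf
    have h1 : Ideal.span (Set.range coordinate) ≤ orderIdeal (m + 1) 1 := by
      rw [Ideal.span_le]
      rintro _ ⟨i, rfl⟩
      refine (Nat.cast_one (R := ℕ∞)).le.trans ?_
      rw [MvPowerSeries.one_le_order_iff_constCoeff_eq_zero, coe_coordinate,
        MvPowerSeries.constantCoeff_X]
    change ((j + 1 : ℕ) : ℕ∞) ≤ (x.1 * f.1).order
    rw [order_mul, Nat.cast_add, add_comm x.1.order]
    exact add_le_add hf (h1 hx)

theorem fg_orderIdeal (m : ℕ) : ∀ j, (orderIdeal (m + 1) j).FG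
  | 0 => by
    rw [orderIdeal_zero]
    exact Ideal.fg_top _
  | j + 1 => by
    rw [orderIdeal_succ]
    exact Submodule.FG.mul (Submodule.fg_span (Set.finite_range _)) (fg_orderIdeal m j)

theorem span_coordinate_le_jacobson (m : ℕ) :
    Ideal.span (Set.range (coordinate (m := m))) ≤ Ideal.jacobson ⊥ := by
  intro x hx
  rw [Ideal.mem_jacobson_bot]
  intro y
  have h0 : MvPowerSeries.constantCoeff (x : MvPowerSeries (Fin m) ℂ) = 0 := by
    have h1 : Ideal.span (Set.range coordinate) ≤ germMax m := by
      rw [Ideal.span_le]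
      rintro _ ⟨i, rfl⟩
      exact MvPowerSeries.constantCoeff_X i
    exact h1 hx
  obtain ⟨v, hv, hv1⟩ := IsConvergent.exists_mul_eq_one (x * y + 1).2 (by
    change MvPowerSeries.constantCoeff (x.1 * y.1 + 1) ≠ 0
    rw [map_add, map_mul, h0, zero_mul, zero_add, map_one]
    exact one_ne_zero)
  exact IsUnit.of_mul_eq_one ⟨v, hv⟩ (Subtype.ext hv1)

/-- Nakayama's lemma: raising the order by one is multiplication by the ideal of the coordinates,
and the order ideals are finitely generated. -/
theorem orderIdeal_le_of_le_sup {m j : ℕ} {I : Ideal (germ (m + 1))}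
    (h : orderIdeal (m + 1) j ≤ I ⊔ orderIdeal (m + 1) (j + 1)) : orderIdeal (m + 1) j ≤ I := by
  rw [orderIdeal_succ] at h
  exact Submodule.le_of_le_smul_of_le_jacobson_bot (fg_orderIdeal m j)
    (span_coordinate_le_jacobson (m + 1)) h

theorem isConvergent_serOfCoords {m N : ℕ} (v : JetIndex m N → ℂ) :
    IsConvergent (serOfCoords m N v) := by
  rw [serOfCoords_apply]
  exact isConvergent_coe _

/-- The coefficients of degree at most `N` of a germ. -/
def germCoords (m N : ℕ) : germ m →ₗ[ℂ] (JetIndex m N → ℂ) :=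
  (coords m N).comp (germ m).val.toLinearMap

theorem germCoords_surjective (m N : ℕ) : Function.Surjective (germCoords m N) := fun v =>
  ⟨⟨serOfCoords m N v, isConvergent_serOfCoords v⟩, coords_serOfCoords v⟩

theorem germCoords_eq_zero_iff {m N : ℕ} {f : germ m} :
    germCoords m N f = 0 ↔ f ∈ orderIdeal m (N + 1) := coords_eq_zero_iff

/-- Only the N-jets of cofactors matter, and these are polynomials, so the convergent and the formal
ideal have the same jets. -/
theorem map_germCoords_span {m k N : ℕ} (F : Fin k → germ m) :
    ((Ideal.span (Set.range F)).restrictScalars ℂ).map (germCoords m N) =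
      jetSpan N fun ℓ => (F ℓ : MvPowerSeries (Fin m) ℂ) := by
  refine le_antisymm ?_ ?_
  · rintro _ ⟨f, hf, rfl⟩
    refine ⟨f.1, ?_, rfl⟩
    have h1 := Ideal.mem_map_of_mem (germ m).val.toRingHom hf
    rw [Ideal.map_span, ← Set.range_comp] at h1
    exact h1
  · rintro _ ⟨f, hf, rfl⟩
    obtain ⟨h, rfl⟩ := (Ideal.mem_span_range_iff_exists_fun (R := MvPowerSeries (Fin m) ℂ)).1 hf
    rw [map_sum]
    refine Submodule.sum_mem _ fun ℓ _ => ?_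
    rw [mul_comm, ← coords_mul_congr _ (coords_serOfCoords (coords m N (h ℓ)))]
    exact ⟨F ℓ * ⟨serOfCoords m N (coords m N (h ℓ)), isConvergent_serOfCoords _⟩,
      Ideal.mul_mem_right _ _ (Ideal.subset_span ⟨ℓ, rfl⟩), rfl⟩

theorem mem_sup_orderIdeal_iff {m k N : ℕ} (F : Fin k → germ m) (f : germ m) :
    f ∈ Ideal.span (Set.range F) ⊔ orderIdeal m (N + 1) ↔
      germCoords m N f ∈ jetSpan N fun ℓ => (F ℓ : MvPowerSeries (Fin m) ℂ) := by
  rw [← map_germCoords_span, Submodule.mem_sup]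
  constructor
  · rintro ⟨g, hg, h, hh, rfl⟩
    refine ⟨g, hg, ?_⟩
    rw [map_add, germCoords_eq_zero_iff.2 hh, add_zero]
  · rintro ⟨g, hg, h⟩
    refine ⟨g, hg, f - g, ?_, add_sub_cancel _ _⟩
    rw [← germCoords_eq_zero_iff, map_sub, h, sub_self]

/-- The codimension of the space of jets of the members of an ideal. -/
theorem finrank_quotient_jetSpan {m N : ℕ} {ι : Type*} (F : ι → MvPowerSeries (Fin m) ℂ) :
    Module.finrank ℂ ((JetIndex m N → ℂ) ⧸ jetSpan N F) + jetRank N F = (m + N).choose N := by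
  rw [jetRank, Submodule.finrank_quotient_add_finrank, Module.finrank_fintype_fun_eq_card,
    card_jetIndex]

/-- The class in the quotient by the jets of the members of an ideal of a germ. -/
def germClass {m k : ℕ} (N : ℕ) (F : Fin k → germ m) :
    germ m →ₗ[ℂ] (JetIndex m N → ℂ) ⧸ jetSpan N fun ℓ => (F ℓ : MvPowerSeries (Fin m) ℂ) :=
  (Submodule.mkQ _).comp (germCoords m N)

theorem germClass_surjective {m k : ℕ} (N : ℕ) (F : Fin k → germ m) :
    Function.Surjective (germClass N F) :=
  (Submodule.mkQ_surjective _).comp (germCoords_surjective m N)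

theorem germClass_eq_zero_iff {m k N : ℕ} (F : Fin k → germ m) (f : germ m) :
    germClass N F f = 0 ↔ f ∈ Ideal.span (Set.range F) ⊔ orderIdeal m (N + 1) := by
  rw [mem_sup_orderIdeal_iff]
  exact Submodule.Quotient.mk_eq_zero _

theorem orderIdeal_anti {m i j : ℕ} (h : i ≤ j) : orderIdeal m j ≤ orderIdeal m i := fun _ hf =>
  mem_orderIdeal.2 ((Nat.cast_le.2 h).trans hf)

theorem milnorNumber_ne_top_of_orderIdeal_le {m k N : ℕ} {F : Fin k → germ m}
    (h : orderIdeal m (N + 1) ≤ Ideal.span (Set.range F)) : milnorNumber F ≠ ⊤ := by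
  let T : (JetIndex m N → ℂ) →ₗ[ℂ] germ m ⧸ Ideal.span (Set.range F) :=
    ((Ideal.Quotient.mkₐ ℂ (Ideal.span (Set.range F))).toLinearMap).comp
      (LinearMap.codRestrict (Subalgebra.toSubmodule (germ m)) (serOfCoords m N)
        isConvergent_serOfCoords)
  have hT : Function.Surjective T := by
    intro q
    obtain ⟨f, rfl⟩ := Ideal.Quotient.mk_surjective q
    refine ⟨germCoords m N f, ?_⟩
    refine Ideal.Quotient.eq.2 (h ?_)
    rw [← germCoords_eq_zero_iff, map_sub, sub_eq_zero]
    exact coords_serOfCoords _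
  have hfin : Module.Finite ℂ (germ m ⧸ Ideal.span (Set.range F)) := Module.Finite.of_surjective T hT
  rw [milnorNumber, ne_eq, Cardinal.toENat_eq_top, not_le]
  exact Module.rank_lt_aleph0 ℂ _

theorem exists_factor {V W U : Type*} [AddCommGroup V] [Module ℂ V] [AddCommGroup W] [Module ℂ W]
    [AddCommGroup U] [Module ℂ U] {g : V →ₗ[ℂ] W} {h : V →ₗ[ℂ] U} (hg : Function.Surjective g)
    (hgh : LinearMap.ker g ≤ LinearMap.ker h) : ∃ T : W →ₗ[ℂ] U, ∀ v, T (g v) = h v := by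
  obtain ⟨s, hs⟩ := g.exists_rightInverse_of_surjective (LinearMap.range_eq_top.2 hg)
  refine ⟨h.comp s, fun v => ?_⟩
  rw [LinearMap.comp_apply, ← sub_eq_zero, ← map_sub, ← LinearMap.mem_ker]
  refine hgh ?_
  rw [LinearMap.mem_ker, map_sub, sub_eq_zero]
  exact LinearMap.congr_fun hs (g v)

/-- The codimension grows strictly with N: stagnation would, by Nakayama, put an order ideal inside
the given ideal and make the Milnor number finite. -/
theorem finrank_quotient_jetSpan_lt {m k N : ℕ} {F : Fin k → germ (m + 1)}
    (h : milnorNumber F = ⊤) :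
    N + 1 ≤ Module.finrank ℂ ((JetIndex (m + 1) N → ℂ) ⧸
      jetSpan N fun ℓ => (F ℓ : MvPowerSeries (Fin (m + 1)) ℂ)) := by
  have hnot : ∀ j, ¬ orderIdeal (m + 1) j ≤
      Ideal.span (Set.range F) ⊔ orderIdeal (m + 1) (j + 1) := fun j hj =>
    milnorNumber_ne_top_of_orderIdeal_le
      ((orderIdeal_anti (Nat.le_succ j)).trans (orderIdeal_le_of_le_sup hj)) h
  induction N with
  | zero =>
    rw [zero_add, Nat.one_le_iff_ne_zero, ← Nat.pos_iff_ne_zero, Module.finrank_pos_iff_exists_ne_zero]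
    obtain ⟨f, -, hf⟩ := Set.not_subset.1 (hnot 0)
    exact ⟨germClass 0 F f, fun h0 => hf ((germClass_eq_zero_iff F f).1 h0)⟩
  | succ N ih =>
    have hker : LinearMap.ker (germClass (N + 1) F) ≤ LinearMap.ker (germClass N F) := by
      intro f hf
      rw [LinearMap.mem_ker, germClass_eq_zero_iff] at hf ⊢
      exact sup_le_sup_left (orderIdeal_anti (Nat.le_succ _)) _ hf
    obtain ⟨T, hT⟩ := exists_factor (germClass_surjective (N + 1) F) hker
    have hsurj : LinearMap.range T = ⊤ := by
      rw [LinearMap.range_eq_top]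
      intro v
      obtain ⟨f, rfl⟩ := germClass_surjective N F v
      exact ⟨_, hT f⟩
    have hpos : 0 < Module.finrank ℂ (LinearMap.ker T) := by
      obtain ⟨f, hf1, hf2⟩ := Set.not_subset.1 (hnot (N + 1))
      rw [Module.finrank_pos_iff_exists_ne_zero]
      refine ⟨⟨germClass (N + 1) F f, ?_⟩, fun h0 => hf2 ((germClass_eq_zero_iff F f).1
        (congrArg Subtype.val h0))⟩
      rw [LinearMap.mem_ker, hT, germClass_eq_zero_iff]
      exact (le_sup_right : _ ≤ Ideal.span (Set.range F) ⊔ orderIdeal (m + 1) (N + 1)) hf1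
    have h1 := LinearMap.finrank_range_add_finrank_ker T
    rw [hsurj, finrank_top] at h1
    omega

theorem succ_le_choose (m N : ℕ) : N + 1 ≤ (m + 1 + N).choose N := by
  rw [← Nat.choose_symm_add]
  calc N + 1 = (1 + N).choose 1 := by rw [Nat.choose_one_right, add_comm]
    _ = (1 + N).choose N := Nat.choose_symm_add
    _ ≤ (m + 1 + N).choose N := Nat.choose_le_choose _ (by omega)
    _ = (m + 1 + N).choose (m + 1) := Nat.choose_symm_add.symm

/-- The quotient algebra surjects onto the quotient of N-jets, so codimension at least N + 1 for all
N makes it infinite-dimensional. The subtraction never truncates, by `succ_le_choose`. -/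
theorem milnorNumber_eq_top_iff {m k : ℕ} (F : Fin k → germ (m + 1)) :
    milnorNumber F = ⊤ ↔ ∀ N, jetRank N (fun ℓ => (F ℓ : MvPowerSeries (Fin (m + 1)) ℂ)) ≤
      (m + 1 + N).choose N - (N + 1) := by
  constructor
  · intro h N
    have h1 := finrank_quotient_jetSpan_lt (N := N) h
    have h2 := finrank_quotient_jetSpan (N := N) fun ℓ => (F ℓ : MvPowerSeries (Fin (m + 1)) ℂ)
    omega
  · intro h
    rw [milnorNumber, Cardinal.toENat_eq_top]
    refine Cardinal.aleph0_le.2 fun N => ?_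
    let g := (Ideal.Quotient.mkₐ ℂ (Ideal.span (Set.range F))).toLinearMap
    have hker : LinearMap.ker g ≤ LinearMap.ker (germClass N F) := by
      intro f hf
      rw [LinearMap.mem_ker, germClass_eq_zero_iff]
      exact (le_sup_left : Ideal.span (Set.range F) ≤ _) (Ideal.Quotient.eq_zero_iff_mem.1 hf)
    obtain ⟨T, hT⟩ := exists_factor (g := g) Ideal.Quotient.mk_surjective hker
    have hsurj : Function.Surjective T := by
      intro v
      obtain ⟨f, rfl⟩ := germClass_surjective N F v
      exact ⟨_, hT f⟩
    refine le_trans ?_ (LinearMap.rank_le_of_surjective T hsurj)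
    rw [← Module.finrank_eq_rank, Nat.cast_le]
    have h2 := finrank_quotient_jetSpan (N := N) fun ℓ => (F ℓ : MvPowerSeries (Fin (m + 1)) ℂ)
    have h3 := succ_le_choose m N
    have h4 := h N
    omega

/-- Non-coprime families of germs in terms of the dimensions of the spaces of jets. -/
theorem isNonCoprime_iff {m k : ℕ} (F : Fin k → germ (m + 2)) : IsNonCoprime F ↔
    ∀ d, jetRank (d + 1) (fun ℓ => (F ℓ : MvPowerSeries (Fin (m + 2)) ℂ)) ≤
      (m + 2 + d).choose d :=
  isWeierstrassFamily_germ.exists_dvd_iff (O := germ) F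

theorem IsNonCoprime.constantCoeff {m k : ℕ} {F : Fin k → germ m} (h : IsNonCoprime F) (ℓ : Fin k) :
    F ℓ ∈ germMax m := by
  obtain ⟨g, hg, hF⟩ := h
  exact Ideal.mem_of_dvd _ (hF ℓ) hg

theorem jetRank_zero {m : ℕ} {ι : Type*} {F : ι → MvPowerSeries (Fin m) ℂ}
    (hF : ∀ i, MvPowerSeries.constantCoeff (F i) = 0) : jetRank 0 F = 0 := by
  rw [jetRank, Submodule.finrank_eq_zero, eq_bot_iff]
  rintro _ ⟨f, hf, rfl⟩
  rw [Submodule.mem_bot, coords_eq_zero_iff, zero_add, Nat.cast_one,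
    MvPowerSeries.one_le_order_iff_constCoeff_eq_zero]
  have h1 : Ideal.span (Set.range F) ≤ RingHom.ker (MvPowerSeries.constantCoeff (R := ℂ)) := by
    rw [Ideal.span_le]
    rintro _ ⟨i, rfl⟩
    exact hF i
  exact h1 hf

theorem IsNonCoprime.milnorNumber_eq_top {m k : ℕ} {F : Fin k → germ (m + 2)}
    (h : IsNonCoprime F) : milnorNumber F = ⊤ := by
  rw [milnorNumber_eq_top_iff]
  rintro (_ | d)
  · rw [jetRank_zero h.constantCoeff]
    exact Nat.zero_le _
  · refine ((isNonCoprime_iff F).1 h d).trans ?_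
    have h1 : (m + 1 + 1 + (d + 1)).choose (d + 1) =
        (m + 2 + d).choose d + (m + 1 + (d + 1)).choose (d + 1) := by
      rw [show m + 1 + 1 + (d + 1) = (m + 2 + d) + 1 by omega, Nat.choose_succ_succ',
        show m + 2 + d = m + 1 + (d + 1) by omega]
    have h2 := succ_le_choose m (d + 1)
    omega

/-- In two variables the bound for an infinite Milnor number is the one for non-coprimality. -/
theorem isNonCoprime_of_milnorNumber_eq_top {k : ℕ} {F : Fin k → germ 2}
    (h : milnorNumber F = ⊤) : IsNonCoprime F := by
  rw [isNonCoprime_iff (m := 0)]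
  intro d
  refine ((milnorNumber_eq_top_iff (m := 1) F).1 h (d + 1)).trans ?_
  have h1 : (1 + 1 + (d + 1)).choose (d + 1) = (0 + 2 + d).choose d + (d + 2) := by
    rw [show 1 + 1 + (d + 1) = (d + 2) + 1 by omega, Nat.choose_succ_succ',
      show 0 + 2 + d = d + 2 by omega, show (d + 2).choose (d + 1) = d + 2 from
        Nat.choose_succ_self_right (d + 1)]
  omega

theorem isAlgebraicInJets_isNonCoprime (m k : ℕ) :
    IsAlgebraicInJets {F : Fin k → germ (m + 2) | IsNonCoprime F} := by
  -- The space of 0-jets has dimension 1, so the condition at N = 0 is vacuous.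
  have h : {F : Fin k → germ (m + 2) | IsNonCoprime F} = {F | ∀ N,
      jetRank N (fun ℓ => (F ℓ : MvPowerSeries (Fin (m + 2)) ℂ)) ≤
        if N = 0 then 1 else (m + 2 + (N - 1)).choose (N - 1)} := by
    ext F
    rw [Set.mem_ofPred_eq, Set.mem_ofPred_eq, isNonCoprime_iff]
    refine ⟨fun h N => ?_, fun h d => h (d + 1)⟩
    rcases N with _ | d
    · refine (Submodule.finrank_le _).trans ?_
      rw [Module.finrank_fintype_fun_eq_card, card_jetIndex]
      exact (Nat.choose_zero_right _).le
    · exact h d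
  rw [h]
  exact isAlgebraicInJets_of_jetRank _

theorem isAlgebraicInJets_milnorNumber (m k : ℕ) :
    IsAlgebraicInJets {F : Fin k → germ (m + 1) | milnorNumber F = ⊤} := by
  simp_rw [milnorNumber_eq_top_iff]
  exact isAlgebraicInJets_of_jetRank _

/-! ### Properness -/

section Properness

variable {m k : ℕ} {A : Fin k → Set (FlatSeq m)}

/-- The first members of a family are the coordinates and the others are zero. -/
def coordinateFamily (n : ℕ) (A : Fin k → Set (FlatSeq m)) : (ℓ : Fin k) → SeqMax (A ℓ) :=
  fun ℓ => if h : ℓ.1 < n ∧ ℓ.1 < m then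
    (show germMax m from ⟨coordinate ⟨ℓ.1, h.2⟩, MvPowerSeries.constantCoeff_X _⟩) else 0

theorem toGerms_smul_coordinateFamily {n : ℕ} {ℓ : Fin k} (t : ℂ) (hn : ℓ.1 < n) (hm : ℓ.1 < m) :
    toGerms (t • coordinateFamily n A) ℓ = t • coordinate ⟨ℓ.1, hm⟩ := by
  have h : coordinateFamily n A ℓ =
      (show germMax m from ⟨coordinate ⟨ℓ.1, hm⟩, MvPowerSeries.constantCoeff_X _⟩) :=
    dif_pos ⟨hn, hm⟩
  exact congrArg (fun x : SeqMax (A ℓ) => t • (show germMax m from x).1) h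

/-- A divisor of the first coordinate without constant term is associated to it, by comparing
orders, and so does not divide the second one. -/
theorem not_isNonCoprime_smul_coordinateFamily (hm : 2 ≤ m) (hk : 2 ≤ k) {t : ℂ} (ht : t ≠ 0) :
    ¬ IsNonCoprime (toGerms (t • coordinateFamily 2 A)) := by
  rintro ⟨g, hg, h⟩
  have hdvd : ∀ i : Fin 2, (g : MvPowerSeries (Fin m) ℂ) ∣ MvPowerSeries.X ⟨i.1, by omega⟩ := by
    intro i
    have h1 := map_dvd (germ m).val (h ⟨i.1, i.2.trans_le hk⟩)
    rw [toGerms_smul_coordinateFamily (ℓ := ⟨i.1, i.2.trans_le hk⟩) t i.2 (i.2.trans_le hm), map_smul] at h1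
    have h2 := dvd_smul_of_dvd t⁻¹ h1
    rwa [inv_smul_smul₀ ht] at h2
  have hg0 : MvPowerSeries.constantCoeff (g : MvPowerSeries (Fin m) ℂ) = 0 := hg
  obtain ⟨u, hu⟩ := hdvd 0
  have hu0 : MvPowerSeries.constantCoeff u ≠ 0 := by
    intro h0
    rw [← MvPowerSeries.one_le_order_iff_constCoeff_eq_zero] at hg0 h0
    have h1 := congrArg MvPowerSeries.order hu
    rw [order_mul, MvPowerSeries.X, MvPowerSeries.order_monomial_of_ne_zero one_ne_zero,
      Finsupp.degree_single] at h1
    have h2 := add_le_add hg0 h0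
    rw [← h1] at h2
    exact absurd h2 (by norm_num)
  have hX : (MvPowerSeries.X ⟨0, by omega⟩ : MvPowerSeries (Fin m) ℂ) ∣ g :=
    ⟨u⁻¹, by
      rw [show (MvPowerSeries.X ⟨0, by omega⟩ : MvPowerSeries (Fin m) ℂ) = g * u from hu, mul_assoc,
        MvPowerSeries.mul_inv_cancel _ hu0, mul_one]⟩
  have h3 := MvPowerSeries.X_dvd_iff.1 (hX.trans (hdvd 1)) (Finsupp.single ⟨1, by omega⟩ 1)
    (by simp)
  simp [MvPowerSeries.coeff_X] at h3

theorem milnorNumber_smul_coordinateFamily {m k : ℕ} {A : Fin k → Set (FlatSeq (m + 1))}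
    (hmk : m + 1 ≤ k) {t : ℂ} (ht : t ≠ 0) :
    milnorNumber (toGerms (t • coordinateFamily (m + 1) A)) ≠ ⊤ := by
  refine milnorNumber_ne_top_of_orderIdeal_le (N := 0) ?_
  rw [orderIdeal_succ, orderIdeal_zero, Ideal.mul_top, Ideal.span_le]
  rintro _ ⟨i, rfl⟩
  have h1 : toGerms (t • coordinateFamily (m + 1) A) ⟨i.1, i.2.trans_le hmk⟩ ∈
    Ideal.span (Set.range (toGerms (t • coordinateFamily (m + 1) A))) := Ideal.subset_span ⟨_, rfl⟩
  rw [toGerms_smul_coordinateFamily (ℓ := ⟨i.1, i.2.trans_le hmk⟩) t i.2 i.2] at h1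
  have h2 := Submodule.smul_of_tower_mem _ t⁻¹ h1
  rwa [inv_smul_smul₀ ht] at h2

theorem isNonCoprime_zero (hm : 0 < m) : IsNonCoprime (toGerms (0 : (ℓ : Fin k) → SeqMax (A ℓ))) :=
  ⟨coordinate ⟨0, hm⟩, MvPowerSeries.constantCoeff_X _, fun _ => dvd_zero _⟩

end Properness

/-! ### Formal power series -/

/-- Power series, as members of the family of all power series. -/
def ofFormal {m : ℕ} (f : MvPowerSeries (Fin m) ℂ) : Member (fun _ => ⊤) m :=
  Member.of f Algebra.mem_top

theorem ofFormal_dvd_iff {m : ℕ} {f g : MvPowerSeries (Fin m) ℂ} :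
    ofFormal g ∣ ofFormal f ↔ g ∣ f := by
  constructor
  · exact fun h => map_dvd Member.ser h
  · rintro ⟨u, rfl⟩
    exact ⟨ofFormal u, rfl⟩

theorem isFormallyNonCoprime_iff {m k : ℕ} (F : Fin k → MvPowerSeries (Fin (m + 2)) ℂ) :
    IsFormallyNonCoprime F ↔ ∀ d, jetRank (d + 1) F ≤ (m + 2 + d).choose d := by
  refine Iff.trans ?_ (isWeierstrassFamily_top.exists_dvd_iff fun ℓ => ofFormal (F ℓ))
  constructor
  · rintro ⟨g, hg, h⟩
    exact ⟨ofFormal g, hg, fun ℓ => ofFormal_dvd_iff.2 (h ℓ)⟩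
  · rintro ⟨g, hg, h⟩
    exact ⟨g.ser, hg, fun ℓ => map_dvd Member.ser (h ℓ)⟩

/-! ### Composite pairs -/

section Pairs

variable {m : ℕ} {f₁ f₂ : MvPowerSeries (Fin m) ℂ}

theorem IsCompositeAtRank.symm {d : ℕ} (h : IsCompositeAtRank f₁ f₂ d) :
    IsCompositeAtRank f₂ f₁ d := by
  obtain ⟨h₁, h₂, heq, q, hq, hne⟩ := h
  exact ⟨h₂, h₁, fun n hn => (heq n hn).symm, q, by rwa [min_comm], hne.symm⟩

theorem coe_neg (p : MvPolynomial (Fin m) ℂ) :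
    ((-p : MvPolynomial (Fin m) ℂ) : MvPowerSeries (Fin m) ℂ) = -(p : MvPowerSeries (Fin m) ℂ) :=
  map_neg (MvPolynomial.coeToMvPowerSeries.ringHom (R := ℂ)) p

theorem range_pairMap (f₁ f₂ : MvPowerSeries (Fin m) ℂ) (d : ℕ) :
    LinearMap.range (pairMap f₁ f₂ d) = LinearMap.range (macaulayMap ![f₁, f₂] d) := by
  refine le_antisymm ?_ ?_
  · rintro _ ⟨h, rfl⟩
    refine ⟨![h.1, -h.2], ?_⟩
    change jet (d + 1) _ = jet (d + 1) _
    congr 1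
    simp [Fin.sum_univ_two, sub_eq_add_neg, coe_neg]
  · rintro _ ⟨h, rfl⟩
    refine ⟨(h 0, -h 1), ?_⟩
    change jet (d + 1) _ = jet (d + 1) _
    congr 1
    simp [Fin.sum_univ_two, sub_eq_add_neg, coe_neg]

/-- The truncation of a power series, as a polynomial of bounded degree. -/
def truncation (d : ℕ) (f : MvPowerSeries (Fin m) ℂ) :
    MvPolynomial.restrictTotalDegree (Fin m) ℂ d :=
  ⟨ofCoords m d (coords m d f), ofCoords_mem _ _ _⟩

theorem coeff_truncation {d : ℕ} (f : MvPowerSeries (Fin m) ℂ) {n : Fin m →₀ ℕ} (hn : n.degree ≤ d) :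
    (truncation d f).1.coeff n = MvPowerSeries.coeff n f := by
  rw [truncation, coeff_ofCoords, dif_pos hn, coords_apply]

theorem coeff_mul_truncation {d : ℕ} (hf : MvPowerSeries.constantCoeff f₁ = 0)
    (h : MvPowerSeries (Fin m) ℂ) {n : Fin m →₀ ℕ} (hn : n.degree ≤ d + 1) :
    MvPowerSeries.coeff n (f₁ * ((truncation d h).1 : MvPowerSeries (Fin m) ℂ)) =
      MvPowerSeries.coeff n (f₁ * h) := by
  have h1 := coords_succ_mul_congr hf (coords_serOfCoords (coords m d h))
  rw [serOfCoords_apply] at h1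
  exact congrFun h1 ⟨n, hn⟩

theorem isCompositeAtRank_of_order_gt {d : ℕ} (h₁ : ((d + 1 : ℕ) : ℕ∞) < f₁.order)
    (h₂ : ((d + 1 : ℕ) : ℕ∞) < f₂.order) : IsCompositeAtRank f₁ f₂ d := by
  have hpos : (((0 : Fin m →₀ ℕ).degree : ℕ) : ℕ∞) < min f₁.order f₂.order := by
    rw [map_zero]
    exact lt_of_le_of_lt (Nat.cast_le.2 (Nat.zero_le _)) (lt_min h₁ h₂)
  refine ⟨truncation d 1, truncation d 1, fun n hn => ?_, 0, hpos, Or.inl ?_⟩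
  · have hz : ∀ f : MvPowerSeries (Fin m) ℂ, ((d + 1 : ℕ) : ℕ∞) < f.order → ∀ g,
        MvPowerSeries.coeff n (f * g) = 0 := fun f hf g => by
      refine MvPowerSeries.coeff_of_lt_order (lt_of_le_of_lt (Nat.cast_le.2 hn) ?_)
      rw [order_mul]
      exact hf.trans_le le_self_add
    rw [hz _ h₁, hz _ h₂]
  · rw [coeff_truncation _ (by simp)]
    simp

theorem isCompositeAtRank_of_zero_left (hf₂ : MvPowerSeries.constantCoeff f₂ = 0) (d : ℕ) :
    IsCompositeAtRank 0 f₂ d := by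
  rw [← MvPowerSeries.one_le_order_iff_constCoeff_eq_zero] at hf₂
  refine ⟨truncation d 1, 0, fun n _ => by simp, 0, ?_, Or.inl ?_⟩
  · rw [map_zero, MvPowerSeries.order_zero, top_inf_eq]
    exact lt_of_lt_of_le (by simp) hf₂
  · rw [coeff_truncation _ (by simp)]
    simp

/-- The relation (g a) b = (g b) a has a cofactor `a` of order below that of g a. Truncation at `d`
keeps its leading term, unless that term has degree above `d`; then both orders exceed d + 1 and the
constant cofactors 1 work. -/
theorem isCompositeAtRank_of_eq_mul {g a b : MvPowerSeries (Fin m) ℂ}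
    (hg : MvPowerSeries.constantCoeff g = 0) (ha : g * a ≠ 0)
    (hle : (g * a).order ≤ (g * b).order) (d : ℕ) : IsCompositeAtRank (g * a) (g * b) d := by
  have ha0 : a ≠ 0 := right_ne_zero_of_mul ha
  have hν := MvPowerSeries.ne_zero_iff_order_finite.1 ha0
  obtain ⟨q, hq, hqa⟩ := MvPowerSeries.exists_coeff_ne_zero_and_order hν
  have hlt : (q.degree : ℕ∞) + 1 ≤ (g * a).order := by
    rw [hqa, order_mul, add_comm]
    exact add_le_add_left (MvPowerSeries.one_le_order_iff_constCoeff_eq_zero.2 hg) _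
  by_cases hd : q.degree ≤ d
  · refine ⟨truncation d b, truncation d a, fun n hn => ?_, q, ?_, Or.inr ?_⟩
    · rw [coeff_mul_truncation (by rw [map_mul, hg, zero_mul]) _ hn,
        coeff_mul_truncation (by rw [map_mul, hg, zero_mul]) _ hn]
      congr 1
      ring
    · rw [min_eq_left hle]
      exact (ENat.add_one_le_iff (ENat.natCast_ne_top _)).1 hlt
    · rwa [coeff_truncation _ hd]
  · have h1 : ((d + 1 : ℕ) : ℕ∞) < (g * a).order := by
      refine lt_of_lt_of_le ?_ hlt
      exact_mod_cast (by omega : d + 1 < q.degree + 1)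
    exact isCompositeAtRank_of_order_gt h1 (h1.trans_le hle)

theorem IsFormallyNonCoprime.isCompositeAtRank (hf₁ : MvPowerSeries.constantCoeff f₁ = 0)
    (hf₂ : MvPowerSeries.constantCoeff f₂ = 0) (h : IsFormallyNonCoprime ![f₁, f₂]) (d : ℕ) :
    IsCompositeAtRank f₁ f₂ d := by
  by_cases h₁ : f₁ = 0
  · exact h₁ ▸ isCompositeAtRank_of_zero_left hf₂ d
  by_cases h₂ : f₂ = 0
  · exact h₂ ▸ (isCompositeAtRank_of_zero_left hf₁ d).symm
  obtain ⟨g, hg, hdvd⟩ := h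
  obtain ⟨a, rfl⟩ : g ∣ f₁ := hdvd 0
  obtain ⟨b, rfl⟩ : g ∣ f₂ := hdvd 1
  rcases le_total (g * a).order (g * b).order with hle | hle
  · exact isCompositeAtRank_of_eq_mul hg h₁ hle d
  · exact (isCompositeAtRank_of_eq_mul hg h₂ hle d).symm

/-- The equation for the coefficient at `n` of `f₁ h₁ - f₂ h₂` in the coefficients of `h₁, h₂`. -/
def pairEquation (f₁ f₂ : MvPowerSeries (Fin m) ℂ) (n : Fin m →₀ ℕ) :
    ((Fin m →₀ ℕ) ⊕ (Fin m →₀ ℕ)) →₀ ℂ :=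
  ∑ p ∈ Finset.HasAntidiagonal.antidiagonal n,
    (Finsupp.single (Sum.inl p.2) (MvPowerSeries.coeff p.1 f₁) -
      Finsupp.single (Sum.inr p.2) (MvPowerSeries.coeff p.1 f₂))

theorem linearCombination_pairEquation (h₁ h₂ : MvPowerSeries (Fin m) ℂ) (n : Fin m →₀ ℕ) :
    Finsupp.linearCombination ℂ (Sum.elim (fun q => MvPowerSeries.coeff q h₁)
      (fun q => MvPowerSeries.coeff q h₂)) (pairEquation f₁ f₂ n) =
    MvPowerSeries.coeff n (f₁ * h₁) - MvPowerSeries.coeff n (f₂ * h₂) := by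
  rw [pairEquation, map_sum, MvPowerSeries.coeff_mul, MvPowerSeries.coeff_mul,
    ← Finset.sum_sub_distrib]
  refine Finset.sum_congr rfl fun p _ => ?_
  rw [map_sub, Finsupp.linearCombination_single, Finsupp.linearCombination_single]
  rfl

/-- A system of linear equations, each of them in finitely many unknowns, has a solution with a
given non-zero unknown unless the equations force that unknown to vanish. -/
theorem exists_solution_or_single_mem {ι X : Type*} (e : ι → X →₀ ℂ) (x : X) :
    (∃ h : X → ℂ, (∀ i, Finsupp.linearCombination ℂ h (e i) = 0) ∧ h x ≠ 0) ∨
      Finsupp.single x 1 ∈ Submodule.span ℂ (Set.range e) := by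
  by_cases hx : Finsupp.single x 1 ∈ Submodule.span ℂ (Set.range e)
  · exact Or.inr hx
  · left
    obtain ⟨φ, hφ, hker⟩ := Submodule.exists_le_ker_of_notMem hx
    have hlin : Finsupp.linearCombination ℂ (fun y => φ (Finsupp.single y 1)) = φ := by
      ext y
      simp
    refine ⟨fun y => φ (Finsupp.single y 1), fun i => ?_, hφ⟩
    rw [hlin]
    exact hker (Submodule.subset_span ⟨i, rfl⟩)

/-- Compactness for linear systems: if no formal solution had a nonzero unknown of degree below the
minimal order, the equations would force each of these finitely many unknowns to vanish. Finitely
many equations would do so already, contradicting compositeness at a large rank. -/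
theorem isComposite_of_forall_isCompositeAtRank (h : ∀ d, IsCompositeAtRank f₁ f₂ d) :
    IsComposite f₁ f₂ := by
  by_cases htop : min f₁.order f₂.order = ⊤
  · rw [min_eq_top, MvPowerSeries.order_eq_top_iff, MvPowerSeries.order_eq_top_iff] at htop
    refine ⟨1, 1, by rw [htop.1, htop.2], Or.inl ?_⟩
    rw [htop.2, MvPowerSeries.order_zero, lt_top_iff_ne_top, ne_eq, MvPowerSeries.order_eq_top_iff]
    exact one_ne_zero
  obtain ⟨μ, hμ⟩ := ENat.ne_top_iff_exists.1 htop
  let e := pairEquation f₁ f₂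
  by_contra hnot
  have hsolve : ∀ (x : (Fin m →₀ ℕ) ⊕ (Fin m →₀ ℕ)), Sum.elim Finsupp.degree Finsupp.degree x < μ →
      Finsupp.single x 1 ∈ Submodule.span ℂ (Set.range e) := by
    intro x hx
    refine (exists_solution_or_single_mem e x).resolve_left ?_
    rintro ⟨h, hh, hne⟩
    let h₁ : MvPowerSeries (Fin m) ℂ := fun q => h (Sum.inl q)
    let h₂ : MvPowerSeries (Fin m) ℂ := fun q => h (Sum.inr q)
    have hS : Sum.elim (fun q => MvPowerSeries.coeff q h₁) (fun q => MvPowerSeries.coeff q h₂) = h := by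
      funext x
      cases x <;> rfl
    refine hnot ⟨h₁, h₂, ?_, ?_⟩
    · ext n
      rw [← sub_eq_zero, ← linearCombination_pairEquation, hS]
      exact hh n
    · rcases x with q | q
      · left
        refine lt_of_le_of_lt (MvPowerSeries.order_le (f := h₁) (d := q) hne) ?_
        refine lt_of_lt_of_le (Nat.cast_lt.2 hx) ?_
        rw [hμ]
        exact min_le_right _ _
      · right
        refine lt_of_le_of_lt (MvPowerSeries.order_le (f := h₂) (d := q) hne) ?_
        refine lt_of_lt_of_le (Nat.cast_lt.2 hx) ?_
        rw [hμ]
        exact min_le_left _ _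
  let U : ℕ → Submodule ℂ (((Fin m →₀ ℕ) ⊕ (Fin m →₀ ℕ)) →₀ ℂ) := fun d =>
    Submodule.span ℂ (e '' {n | n.degree ≤ d + 1})
  have hUmono : Monotone U := fun a b hab =>
    Submodule.span_mono (Set.image_mono fun n (hn : n.degree ≤ a + 1) => hn.trans (by omega))
  have hU : Submodule.span ℂ (Set.range e) ≤ ⨆ d, U d := by
    rw [Submodule.span_le]
    rintro _ ⟨n, rfl⟩
    exact le_iSup U n.degree (Submodule.subset_span ⟨n, Nat.le_succ _, rfl⟩)
  have hex : ∀ y : JetIndex m μ ⊕ JetIndex m μ, ∃ d,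
      Sum.elim Finsupp.degree Finsupp.degree (y.map Subtype.val Subtype.val) < μ →
        Finsupp.single (y.map Subtype.val Subtype.val) 1 ∈ U d := by
    intro y
    by_cases hy : Sum.elim Finsupp.degree Finsupp.degree (y.map Subtype.val Subtype.val) < μ
    · obtain ⟨d, hd⟩ := (Submodule.mem_iSup_of_directed U hUmono.directed_le).1 (hU (hsolve _ hy))
      exact ⟨d, fun _ => hd⟩
    · exact ⟨0, fun h => absurd h hy⟩
  -- The supremum of the `D y` is one rank at which all unknowns of degree below `μ` are forced to
  -- vanish.
  choose D hD using hex
  obtain ⟨h₁, h₂, heq, q, hq, hne⟩ := h (Finset.univ.sup D)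
  rw [← hμ, Nat.cast_lt] at hq
  have hker : U (Finset.univ.sup D) ≤ LinearMap.ker (Finsupp.linearCombination ℂ
      (Sum.elim (fun q => MvPowerSeries.coeff q (h₁.1 : MvPowerSeries (Fin m) ℂ))
        (fun q => MvPowerSeries.coeff q (h₂.1 : MvPowerSeries (Fin m) ℂ)))) := by
    rw [Submodule.span_le]
    rintro _ ⟨n, hn, rfl⟩
    rw [SetLike.mem_coe, LinearMap.mem_ker]
    exact (linearCombination_pairEquation _ _ n).trans (sub_eq_zero.2 (heq n hn))
  have hle : ∀ y, U (D y) ≤ U (Finset.univ.sup D) := fun y =>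
    hUmono (Finset.le_sup (Finset.mem_univ y))
  rcases hne with hne | hne
  · have h1 := hker (hle _ (hD (Sum.inl ⟨q, hq.le⟩) hq))
    rw [LinearMap.mem_ker, Sum.map_inl, Finsupp.linearCombination_single, one_smul] at h1
    exact hne ((MvPolynomial.coeff_coe _ _).symm.trans h1)
  · have h1 := hker (hle _ (hD (Sum.inr ⟨q, hq.le⟩) hq))
    rw [LinearMap.mem_ker, Sum.map_inr, Finsupp.linearCombination_single, one_smul] at h1
    exact hne ((MvPolynomial.coeff_coe _ _).symm.trans h1)

theorem isFormallyNonCoprime_pair_symm (h : IsFormallyNonCoprime ![f₁, f₂]) :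
    IsFormallyNonCoprime ![f₂, f₁] := by
  obtain ⟨g, hg, hdvd⟩ := h
  exact ⟨g, hg, Fin.forall_fin_two.2 ⟨hdvd 1, hdvd 0⟩⟩

/-- If the pair were coprime, Euclid's lemma would make `f₂` divide `h₁`, against the inequality of
orders. -/
theorem isFormallyNonCoprime_of_order_lt {f₁ f₂ h₁ h₂ : MvPowerSeries (Fin (m + 1)) ℂ}
    (hf₁ : MvPowerSeries.constantCoeff f₁ = 0) (heq : f₁ * h₁ = f₂ * h₂)
    (hlt : h₁.order < f₂.order) : IsFormallyNonCoprime ![f₁, f₂] := by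
  by_cases h0 : f₂ = 0
  · exact ⟨f₁, hf₁, Fin.forall_fin_two.2 ⟨dvd_rfl, h0 ▸ dvd_zero _⟩⟩
  by_contra hnot
  have := isWeierstrassFamily_top.isIntegrallyClosed m
  have h1 : ofFormal f₂ ∣ ofFormal h₁ := by
    refine isWeierstrassFamily_top.dvd_of_dvd_mul (f₂ := ofFormal f₁) (fun h => h0 ?_)
      (fun g hg hg₂ hg₁ => hnot ?_) ?_
    · exact congrArg Member.ser h
    · exact ⟨g.ser, hg, Fin.forall_fin_two.2 ⟨map_dvd Member.ser hg₁, map_dvd Member.ser hg₂⟩⟩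
    · exact ofFormal_dvd_iff.2 ⟨h₂, heq⟩
  obtain ⟨u, rfl⟩ := ofFormal_dvd_iff.1 h1
  rw [order_mul] at hlt
  exact absurd hlt (not_lt.2 le_self_add)

theorem IsComposite.isFormallyNonCoprime {f₁ f₂ : MvPowerSeries (Fin (m + 1)) ℂ}
    (hf₁ : MvPowerSeries.constantCoeff f₁ = 0) (hf₂ : MvPowerSeries.constantCoeff f₂ = 0)
    (h : IsComposite f₁ f₂) : IsFormallyNonCoprime ![f₁, f₂] := by
  obtain ⟨h₁, h₂, heq, hlt | hlt⟩ := h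
  · exact isFormallyNonCoprime_of_order_lt hf₁ heq hlt
  · exact isFormallyNonCoprime_pair_symm (isFormallyNonCoprime_of_order_lt hf₂ heq.symm hlt)

theorem pair_tfae {f₁ f₂ : MvPowerSeries (Fin (m + 2)) ℂ}
    (hf₁ : MvPowerSeries.constantCoeff f₁ = 0) (hf₂ : MvPowerSeries.constantCoeff f₂ = 0) :
    List.TFAE [
      IsFormallyNonCoprime ![f₁, f₂],
      IsComposite f₁ f₂,
      ∀ d : ℕ, IsCompositeAtRank f₁ f₂ d,
      ∀ d : ℕ, (pairMap f₁ f₂ d).rank ≤ ((m + 2 + d).choose d : Cardinal)] := by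
  tfae_have 1 → 3 := fun h => h.isCompositeAtRank hf₁ hf₂
  tfae_have 3 → 2 := isComposite_of_forall_isCompositeAtRank
  tfae_have 2 → 1 := fun h => h.isFormallyNonCoprime hf₁ hf₂
  tfae_have 1 ↔ 4 := by
    rw [isFormallyNonCoprime_iff]
    refine forall_congr' fun d => ?_
    rw [LinearMap.rank, range_pairMap, ← LinearMap.rank,
      rank_macaulayMap (Fin.forall_fin_two.2 ⟨hf₁, hf₂⟩), Nat.cast_le]
  tfae_finish

end Pairs

end GermSpaces

end

open GermSpaces in
theorem mainTheorem8 (m k : ℕ) (hm : 2 ≤ m) (hk : 2 ≤ k)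
    (A : Fin k → Set (FlatSeq m)) (hA : ∀ ℓ, (A ℓ).Nonempty) :
    -- the non-coprime families form a proper analytic set
    IsProperAnalyticSet {F : (ℓ : Fin k) → SeqMax (A ℓ) | IsNonCoprime (toGerms F)} ∧
    -- which is defined by polynomial conditions on jets
    IsAlgebraicInJets {F : Fin k → germ m | IsNonCoprime F} ∧
    -- namely by rank conditions on the jet maps, or the minors of the Macaulay-type matrices
    (∀ F : Fin k → germ m, (∀ ℓ, F ℓ ∈ germMax m) →
      (IsNonCoprime F ↔ ∀ d : ℕ,
        (macaulayMap (fun ℓ => (F ℓ : MvPowerSeries (Fin m) ℂ)) d).rank ≤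
          ((m + d).choose d : Cardinal)) ∧
      (IsNonCoprime F ↔ ∀ (d : ℕ)
        (r : Fin ((m + d).choose d + 1) →
          {q : Fin m →₀ ℕ // 0 < q.degree ∧ q.degree ≤ d + 1})
        (c : Fin ((m + d).choose d + 1) → Fin k × {p : Fin m →₀ ℕ // p.degree ≤ d}),
        ((macaulayMatrix (fun ℓ => (F ℓ : MvPowerSeries (Fin m) ℂ)) d).submatrix r c).det = 0)) ∧
    -- the same criterion for formal power series
    (∀ F : Fin k → MvPowerSeries (Fin m) ℂ, (∀ ℓ, MvPowerSeries.constantCoeff (F ℓ) = 0) →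
      (IsFormallyNonCoprime F ↔ ∀ d : ℕ,
        (macaulayMap F d).rank ≤ ((m + d).choose d : Cardinal))) ∧
    -- for pairs of formal power series: composite, composite at every rank, rank condition
    (∀ f₁ f₂ : MvPowerSeries (Fin m) ℂ,
      MvPowerSeries.constantCoeff f₁ = 0 → MvPowerSeries.constantCoeff f₂ = 0 →
      List.TFAE [
        IsFormallyNonCoprime ![f₁, f₂],
        IsComposite f₁ f₂,
        ∀ d : ℕ, IsCompositeAtRank f₁ f₂ d,
        ∀ d : ℕ, (pairMap f₁ f₂ d).rank ≤ ((m + d).choose d : Cardinal)]) ∧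
    -- relation with the Milnor number
    (∀ F : Fin k → germ m, IsNonCoprime F → milnorNumber F = ⊤) ∧
    (m = 2 → ∀ F : Fin k → germ m, milnorNumber F = ⊤ → IsNonCoprime F) ∧
    -- the families with infinite Milnor number
    IsAnalyticSet {F : (ℓ : Fin k) → SeqMax (A ℓ) | milnorNumber (toGerms F) = ⊤} ∧
    IsAlgebraicInJets {F : Fin k → germ m | milnorNumber F = ⊤} ∧
    (m ≤ k → IsProperAnalyticSet
      {F : (ℓ : Fin k) → SeqMax (A ℓ) | milnorNumber (toGerms F) = ⊤}) := by
  obtain ⟨m, rfl⟩ := Nat.exists_eq_add_of_le' hm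
  have hmil : IsAnalyticSet {F : (ℓ : Fin k) → SeqMax (A ℓ) | milnorNumber (toGerms F) = ⊤} :=
    (isAlgebraicInJets_milnorNumber (m + 1) k).isAnalyticSet hA
  refine ⟨?_, isAlgebraicInJets_isNonCoprime m k, fun F hF => ⟨?_, ?_⟩, fun F hF => ?_,
    fun f₁ f₂ hf₁ hf₂ => pair_tfae hf₁ hf₂, fun F hF => hF.milnorNumber_eq_top, ?_, hmil,
    isAlgebraicInJets_milnorNumber (m + 1) k, fun hmk => ?_⟩
  · exact isProperAnalyticSet_of_smul_notMem
      ((isAlgebraicInJets_isNonCoprime m k).isAnalyticSet hA) (isNonCoprime_zero (by omega))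
      (coordinateFamily 2 A) fun t ht => not_isNonCoprime_smul_coordinateFamily hm hk ht
  · rw [isNonCoprime_iff]
    refine forall_congr' fun d => ?_
    rw [rank_macaulayMap (fun ℓ => hF ℓ), Nat.cast_le]
  · rw [isNonCoprime_iff]
    exact forall_congr' fun d => jetRank_succ_le_iff_macaulayMatrix (fun ℓ => hF ℓ) d _
  · rw [isFormallyNonCoprime_iff]
    refine forall_congr' fun d => ?_
    rw [rank_macaulayMap hF, Nat.cast_le]
  · intro h2 F hF
    obtain rfl : m = 0 := by omega
    exact isNonCoprime_of_milnorNumber_eq_top hF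
  · exact isProperAnalyticSet_of_smul_notMem hmil
      (isNonCoprime_zero (m := m + 2) (by omega)).milnorNumber_eq_top
      (coordinateFamily (m + 2) A) fun t ht => milnorNumber_smul_coordinateFamily hmk ht
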